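/- Let $0<\alpha<1$ and $\omega_0\in (L^1\cap L^\infty)(\mathbb{R}^2)$, and let $u_0=K*\omega_0$ be the velocity field given by the Biot–Savart law, $K(x)=\frac{1}{2\pi}\frac{x^\perp}{|x|^2}$, $x^\perp=(-x_2,x_1)$. For functions and vector fields on $\mathbb{R}^2$ let $\|f\|_{C^\alpha}=\sup_x|f(x)|+\sup_{x\ne y}\frac{|f(x)-f(y)|}{|x-y|^\alpha}$, let $C^\alpha$ be the set of those with finite norm, and let $C^{\alpha-1}=\{f+\operatorname{div}v: f,v\in C^\alpha\}$ (distributions), with $\|h\|_{C^{\alpha-1}}=\inf\{\|f\|_{C^\alpha}+\|v\|_{C^\alpha}: h=f+\operatorname{div}v\}$. Divergences are taken in the sense of distributions, and $Y\cdot\nabla\omega_0:=\operatorname{div}(\omega_0Y)-\omega_0\operatorname{div}Y$. The statement $Y\cdot\nabla u_0\in C^\alpha$ means that $u_0$ has a locally integrable weak gradient $\nabla u_0$ and that $Y\cdot\nabla u_0=(\nabla u_0)Y$ is equal almost everywhere to a function in $C^\alpha$, whose norm is then $\|Y\cdot\nabla u_0\|_{C^\alpha}$. (a) (One vector field.) Let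 $\Sigma\subseteq\mathbb{R}^2$ be closed, and let $\omega_0$ be $C^\alpha$ on $\mathbb{R}^2\setminus\Sigma$, in the sense that it is bounded there and $|\omega_0(x)-\omega_0(y)|\le M|x-y|^\alpha$ for some constant $M$ and all $x,y$ such that the segment $[x,y]$ does not meet $\Sigma$. (This holds in particular if the inequality holds for all $x,y\in\mathbb{R}^2\setminus\Sigma$.) Let $Y_0\in C^\alpha$ be a vector field with $\operatorname{div}Y_0\in C^\alpha$ such that, for some $c,\delta_0>0$, $|Y_0|\ge c$ on $\{x: d(x,\Sigma)<\delta_0\}$. Then $$Y_0\cdot\nabla\omega_0\in C^{\alpha-1}\iff \operatorname{div}(\omega_0Y_0)\in C^{\alpha-1}\iff Y_0\cdot\nabla u_0\in C^\alpha .$$ (b) (A family of vector fields.) Let $Y_0=(Y_0^{(\lambda)})_{\lambda\in\Lambda}$ be a family of vector fields with $\sup_\lambda\|Y_0^{(\lambda)}\|_{C^\alpha}<\infty$, $\sup_\lambda\|\operatorname{div}Y_0^{(\lambda)}\|_{C^\alpha}<\infty$ and $\inf_{x\in\mathbb{R}^2}\sup_\lambda|Y_0^{(\lambda)}(x)|>0$.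 Then the three conditions $$\sup_\lambda\|Y_0^{(\lambda)}\cdot\nabla\omega_0\|_{C^{\alpha-1}}<\infty,\qquad \sup_\lambda\|\operatorname{div}(\omega_0Y_0^{(\lambda)})\|_{C^{\alpha-1}}<\infty,\qquad \sup_\lambda\|Y_0^{(\lambda)}\cdot\nabla u_0\|_{C^\alpha}<\infty$$ are equivalent (a norm being $\infty$ for an object outside the space). -/

import Mathlib

open MeasureTheory Set TopologicalSpace
open scoped NNReal ENNReal Distributions LineDeriv

noncomputable section

namespace Serfati

/-- The Euclidean plane. -/
abbrev Plane : Type := EuclideanSpace ℝ (Fin 2)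

/-- Real-valued (Schwartz) distributions on the plane. -/
abbrev Dist : Type := 𝓓'((⊤ : Opens Plane), ℝ)

/-- The `i`-th vector of the standard basis of the plane. -/
def stdVec (i : Fin 2) : Plane := EuclideanSpace.single i 1

/-! ### Functions as distributions, weak derivatives -/

/-- The distribution `φ ↦ ∫ φ f` defined by a locally integrable function `f`
(it is zero if `f` is not locally integrable). -/
def ofFun (f : Plane → ℝ) : Dist :=
  (TestFunction.integralAgainstBilinCLM (ContinuousLinearMap.mul ℝ ℝ) volume f :
    𝓓((⊤ : Opens Plane), ℝ) →L[ℝ] ℝ)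

/-- The distributional divergence `∂₁ v¹ + ∂₂ v²` of a vector field `v`. -/
def divDist (v : Plane → Plane) : Dist :=
  ∑ i : Fin 2, ∂_{stdVec i} (ofFun fun x => v x i)

/-- The function `D` is the distributional divergence of the vector field `Y`. -/
def IsWeakDiv (Y : Plane → Plane) (D : Plane → ℝ) : Prop :=
  LocallyIntegrable Y volume ∧ LocallyIntegrable D volume ∧ divDist Y = ofFun D

/-- The matrix-valued function `G`, `G x e = ∂_e u (x)`, is the weak gradient (Jacobian matrix)
of the vector field `u`. -/
def IsWeakJacobian (u : Plane → Plane) (G : Plane → Plane →L[ℝ] Plane) : Prop :=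
  LocallyIntegrable u volume ∧ LocallyIntegrable G volume ∧
    ∀ i j : Fin 2, ∂_{stdVec j} (ofFun fun x => u x i) = ofFun fun x => G x (stdVec j) i

/-- The distribution `Y · ∇ f = div (f Y) - f div Y`, where the function `divY` is the
divergence of the vector field `Y`. -/
def dirDeriv (Y : Plane → Plane) (divY : Plane → ℝ) (f : Plane → ℝ) : Dist :=
  divDist (fun x => f x • Y x) - ofFun fun x => f x * divY x

/-! ### Hölder spaces -/

/-- The `C^α` norm (supremum norm plus Hölder seminorm) of a function on the plane; the function
belongs to `C^α` if and only if it is finite. -/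
def holderNorm {E : Type*} [NormedAddCommGroup E] (α : ℝ≥0) (f : Plane → E) : ℝ≥0∞ :=
  (⨆ x, ‖f x‖ₑ) + eHolderNorm α f

/-- The `C^α` norm of a function that is defined up to equality almost everywhere: the norm of its
continuous representative, and `∞` if it has no representative in `C^α`. -/
def holderNormAE {E : Type*} [NormedAddCommGroup E] (α : ℝ≥0) (f : Plane → E) : ℝ≥0∞ :=
  ⨅ (g : Plane → E) (_ : g =ᵐ[volume] f), holderNorm α g

/-- The norm of `C^{α-1} = {f + div v : f, v ∈ C^α}`, namely
`inf {‖f‖_{C^α} + ‖v‖_{C^α} : h = f + div v}`; the distribution `h` belongs to `C^{α-1}` if and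
only if it is finite. -/
def negHolderNorm (α : ℝ≥0) (h : Dist) : ℝ≥0∞ :=
  ⨅ (f : Plane → ℝ) (v : Plane → Plane) (_ : h = ofFun f + divDist v),
    holderNorm α f + holderNorm α v

/-- The function `f` is bounded and `α`-Hölder on the open set `U`, where two points of `U` are
compared if the segment between them lies in `U`, so that `f` may have different limits on the two
sides of the boundary of `U`. -/
def IsHolderInside (α : ℝ≥0) (f : Plane → ℝ) (U : Set Plane) : Prop :=
  ∃ M : ℝ≥0, (∀ x ∈ U, ‖f x‖ ≤ M) ∧
    ∀ x y, segment ℝ x y ⊆ U → edist (f x) (f y) ≤ M * edist x y ^ (α : ℝ)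

/-- It is enough that `f` is bounded and Hölder on `U` for all pairs of points. -/
theorem IsHolderInside.of_holderOnWith {α M : ℝ≥0} {f : Plane → ℝ} {U : Set Plane}
    (hb : ∀ x ∈ U, ‖f x‖ ≤ M) (h : HolderOnWith M α f U) : IsHolderInside α f U :=
  ⟨M, hb, fun x y hxy => h x (hxy (left_mem_segment ℝ x y)) y (hxy (right_mem_segment ℝ x y))⟩

/-! ### The Biot-Savart law -/

/-- The Biot-Savart kernel `K(x) = x^⊥ / (2π |x|²)`, `x^⊥ = (-x₂, x₁)`. -/
def biotSavartKernel (x : Plane) : Plane :=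
  (2 * Real.pi * ‖x‖ ^ 2)⁻¹ • !₂[-(x 1), x 0]

/-- The velocity field `K * ω` with vorticity `ω`. -/
def biotSavart (ω : Plane → ℝ) (x : Plane) : Plane :=
  ∫ y, ω y • biotSavartKernel (x - y)

/-! ### Sanity checks -/

theorem ofFun_apply {f : Plane → ℝ} (hf : LocallyIntegrable f volume)
    (φ : 𝓓((⊤ : Opens Plane), ℝ)) : ofFun f φ = ∫ x, φ x * f x :=
  TestFunction.integralAgainstBilinCLM_eq_integral (hf.locallyIntegrableOn _)

end Serfati

end

/-!
Both parts of the theorem are instances of one statement about a family of vector fields `Y` that is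
bounded below near a set `S`, with `ω` Hölder off `S` (`iSup_norm_lt_top_iff`): a single vector
field is a family with one member, and for the second part `S` is the whole plane.

*The velocity gradient.* Let `K_t` (`kern t`) be the Biot-Savart kernel smoothed inside the ball of
radius `t`, and `DK_t` (`kernD t`) its Jacobian matrix. The regularized velocity `K_t * ω` has a
Jacobian matrix `A_t` (`velD t ω`) with trace zero and with curl equal to a mollification of `ω`. A
trace-free matrix of the plane is controlled by its curl and by its value at one nonzero vector
(`norm_mul_norm_le_of_divOp_eq_zero`), so near `S` a bound for `A_t` follows from bounds for the
vectors `A_t Y`. Away from `S` the matrices `A_t` are bounded, and form a Cauchy family as `t` tends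
to `0`, because the compactly supported kernels `L_t = DK_t - DK_1` (`nearD t`) have mean zero and
`ω` is Hölder there (`exists_norm_velD_sub_le_of_notMem`).

*The splitting.* Up to the Hölder term `A_1 Y`, the vector `A_t Y` at `x` is
`∫ L_t(x - y) ω(y) Y(y) dy + ∫ L_t(x - y) ω(y) (Y(x) - Y(y)) dy` (`velD_apply_eq`). The second
integral is a commutator. It is bounded and Cauchy in `t` for any Hölder `Y` and any bounded `ω`,
and it is Hölder uniformly in `t` as soon as the matrices `A_t` are bounded
(`exists_holderBdd_comm`): for points at distance `h` the kernel may be regularized at the scale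
`h`, and then the factor in front of `Y(x) - Y(x')` is a difference `A_h - A_1`. The first integral
is `K_t * div (ω Y)` up to the Hölder term `K_1 * div (ω Y)`.

*From `div (ω Y)` to `Y · ∇u`.* If `div (ω Y) = f + div v` with Hölder `f` and `v`, a Schauder
estimate bounds the first integral in `C^α`, uniformly in `t` (`exists_holderBdd_of_divDist_eq`; its
singular part is again a commutator, with `ω` replaced by `1`). So `A_t Y` is bounded, hence `A_t`
is bounded, hence the commutator and `A_t Y` are uniformly Hölder. Moreover `A_t` converges almost
everywhere, and its limit is the weak Jacobian matrix of the velocity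
(`exists_isWeakJacobian_holderBdd`).

*From `Y · ∇u` to `div (ω Y)`.* If the velocity has a weak Jacobian matrix `G`, then `A_t` is the
mollification of `G` by Liouville's theorem (`IsWeakJacobian.velD_eq`). Near `S` the matrix `G` is
bounded because `G Y` and its curl are, so `A_t` is bounded and the commutators converge to Hölder
functions. By the splitting, `K_t * div (ω Y)` converges to a Hölder vector field `H`. The curl of
`H` is `div (ω Y)`, so that `div (ω Y)` is the divergence of the rotated field
(`exists_holderBdd_divDist_eq`).

*The directional derivative of `ω`.* It differs from `div (ω Y)` by the function `ω div Y`, which is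
bounded and integrable, and is therefore the divergence of its rotated velocity field, which is
Hölder (`exists_dirDeriv_add_divDist_eq`).
-/

noncomputable section

namespace Serfati

/-! ### Radial integrals in the plane -/

theorem integrable_indicator_norm_rpow {β : ℝ} (hβ : 0 < β) (r : ℝ) :
    Integrable (fun z : Plane => (Iic r).indicator (fun s : ℝ => s ^ (β - 2)) ‖z‖) volume := by
  rw [integrable_fun_norm_addHaar volume (f := (Iic r).indicator fun s : ℝ => s ^ (β - 2))]
  have h : IntegrableOn (fun y : ℝ => y ^ (β - 1)) (Ioc 0 r) volume := by
    rcases le_or_gt r 0 with hr | hr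
    · simp [Ioc_eq_empty (not_lt.2 hr)]
    · exact ((intervalIntegrable_iff_integrableOn_Ioc_of_le hr.le).1
        (intervalIntegral.intervalIntegrable_rpow' (by linarith)))
  have h2 : IntegrableOn ((Iic r).indicator fun y : ℝ => y ^ (β - 1)) (Ioi 0) volume := by
    rw [IntegrableOn, integrable_indicator_iff measurableSet_Iic, IntegrableOn,
      Measure.restrict_restrict measurableSet_Iic, inter_comm]
    exact h
  refine h2.congr_fun (fun y (hy : 0 < y) => ?_) measurableSet_Ioi
  simp only [finrank_euclideanSpace, Fintype.card_fin, indicator]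
  split_ifs
  · rw [smul_eq_mul, ← Real.rpow_natCast, ← Real.rpow_add hy]
    congr 1
    norm_num
    ring
  · simp

theorem integral_indicator_norm_rpow {β : ℝ} (hβ : 0 < β) {r : ℝ} (hr : 0 ≤ r) :
    ∫ z : Plane, (Iic r).indicator (fun s : ℝ => s ^ (β - 2)) ‖z‖ = 2 * Real.pi / β * r ^ β := by
  rw [integral_fun_norm_addHaar volume ((Iic r).indicator fun s : ℝ => s ^ (β - 2))]
  have h1 : volume.real (Metric.ball (0 : Plane) 1) = Real.pi := by
    rw [Measure.real, EuclideanSpace.volume_ball_fin_two]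
    simp [Real.pi_pos.le]
  have h2 : ∫ y in Ioi (0 : ℝ), y ^ (Module.finrank ℝ Plane - 1) •
      (Iic r).indicator (fun s : ℝ => s ^ (β - 2)) y = r ^ β / β := by
    have : ∫ y in Ioi (0 : ℝ), (Iic r).indicator (fun y : ℝ => y ^ (β - 1)) y = r ^ β / β := by
      rw [integral_indicator measurableSet_Iic, Measure.restrict_restrict measurableSet_Iic,
        inter_comm, Ioi_inter_Iic, ← intervalIntegral.integral_of_le hr,
        integral_rpow (Or.inl (by linarith))]
      simp [hβ.ne']
    rw [← this]
    refine setIntegral_congr_fun measurableSet_Ioi (fun y (hy : 0 < y) => ?_)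
    simp only [finrank_euclideanSpace, Fintype.card_fin, indicator]
    split_ifs
    · rw [smul_eq_mul, ← Real.rpow_natCast, ← Real.rpow_add hy]
      congr 1
      norm_num
      ring
    · simp
  rw [h1, h2]
  simp
  ring

theorem integrable_add_norm_rpow {β : ℝ} (hβ : β < -2) {h : ℝ} (hh : 0 < h) :
    Integrable (fun z : Plane => (h + ‖z‖) ^ β) volume ∧
      ∫ z : Plane, (h + ‖z‖) ^ β = h ^ (β + 2) * ∫ z : Plane, (1 + ‖z‖) ^ β := by
  have h1 : Integrable (fun z : Plane => (1 + ‖z‖) ^ β) volume := by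
    have := integrable_one_add_norm (E := Plane) (μ := volume) (r := -β) (by simp; linarith)
    simpa using this
  have e : (fun z : Plane => (h + ‖z‖) ^ β) = fun z => h ^ β * (1 + ‖h⁻¹ • z‖) ^ β := by
    ext z
    rw [norm_smul, norm_inv, Real.norm_of_nonneg hh.le,
      ← Real.mul_rpow hh.le (by positivity), mul_add, mul_one, mul_inv_cancel_left₀ hh.ne']
  constructor
  · rw [e]
    exact (h1.comp_smul (inv_ne_zero hh.ne')).const_mul _
  · rw [e, integral_const_mul, Measure.integral_comp_smul volume (fun z : Plane => (1 + ‖z‖) ^ β)]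
    simp only [finrank_euclideanSpace, Fintype.card_fin, smul_eq_mul]
    rw [abs_of_nonneg (by positivity), Real.rpow_add hh, inv_pow, inv_inv, ← mul_assoc]
    norm_num

/-! ### Bounded Hölder functions -/

/-- The function `f` and its `α`-Hölder quotients are bounded by `C`. -/
def HolderBdd {E : Type*} [NormedAddCommGroup E] (α C : ℝ) (f : Plane → E) : Prop :=
  (∀ x, ‖f x‖ ≤ C) ∧ ∀ x y, ‖f x - f y‖ ≤ C * ‖x - y‖ ^ α

section HolderBdd

variable {E F : Type*} [NormedAddCommGroup E] [NormedAddCommGroup F] {α C D : ℝ}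
  {f g : Plane → E}

theorem HolderBdd.nonneg (h : HolderBdd α C f) : 0 ≤ C := (norm_nonneg _).trans (h.1 0)

theorem HolderBdd.mono (h : HolderBdd α C f) (hCD : C ≤ D) : HolderBdd α D f :=
  ⟨fun x => (h.1 x).trans hCD, fun x y => (h.2 x y).trans (by gcongr)⟩

theorem HolderBdd.add (hf : HolderBdd α C f) (hg : HolderBdd α D g) :
    HolderBdd α (C + D) (fun x => f x + g x) := by
  refine ⟨fun x => (norm_add_le _ _).trans (add_le_add (hf.1 x) (hg.1 x)), fun x y => ?_⟩
  rw [add_sub_add_comm, add_mul]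
  exact (norm_add_le _ _).trans (add_le_add (hf.2 x y) (hg.2 x y))

theorem HolderBdd.neg (hf : HolderBdd α C f) : HolderBdd α C (fun x => -f x) := by
  refine ⟨fun x => by simpa using hf.1 x, fun x y => ?_⟩
  rw [neg_sub_neg, norm_sub_rev]
  exact hf.2 x y

theorem HolderBdd.sub (hf : HolderBdd α C f) (hg : HolderBdd α D g) :
    HolderBdd α (C + D) (fun x => f x - g x) := by
  simpa only [sub_eq_add_neg] using hf.add hg.neg

theorem HolderBdd.isometry_comp [NormedSpace ℝ E] [NormedSpace ℝ F] (hf : HolderBdd α C f)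
    (L : E →ₗᵢ[ℝ] F) : HolderBdd α C (fun x => L (f x)) := by
  refine ⟨fun x => by simpa using hf.1 x, fun x y => ?_⟩
  rw [← map_sub, L.norm_map]
  exact hf.2 x y

theorem HolderBdd.clm_apply [NormedSpace ℝ E] [NormedSpace ℝ F] {A : Plane → E →L[ℝ] F}
    (hA : HolderBdd α C A) (hf : HolderBdd α D f) :
    HolderBdd α (2 * (C * D)) (fun x => A x (f x)) := by
  have hC := hA.nonneg
  have hD := hf.nonneg
  refine ⟨fun x => ?_, fun x y => ?_⟩
  · calc ‖A x (f x)‖ ≤ ‖A x‖ * ‖f x‖ := (A x).le_opNorm _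
      _ ≤ C * D := mul_le_mul (hA.1 x) (hf.1 x) (norm_nonneg _) hC
      _ ≤ 2 * (C * D) := by nlinarith [mul_nonneg hC hD]
  · have e : A x (f x) - A y (f y) = (A x - A y) (f x) + A y (f x - f y) := by simp
    rw [e]
    calc _ ≤ ‖A x - A y‖ * ‖f x‖ + ‖A y‖ * ‖f x - f y‖ :=
          (norm_add_le _ _).trans (add_le_add ((A x - A y).le_opNorm _) ((A y).le_opNorm _))
      _ ≤ (C * ‖x - y‖ ^ α) * D + C * (D * ‖x - y‖ ^ α) := by
          gcongr
          exacts [hA.2 x y, hf.1 x, hA.1 y, hf.2 x y]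
      _ = _ := by ring

theorem HolderBdd.of_tendsto {u : ℕ → Plane → E} (hu : ∀ n, HolderBdd α C (u n))
    (h : ∀ x, Filter.Tendsto (fun n => u n x) Filter.atTop (nhds (f x))) : HolderBdd α C f :=
  ⟨fun x => le_of_tendsto' (h x).norm fun n => (hu n).1 x,
    fun x y => le_of_tendsto' ((h x).sub (h y)).norm fun n => (hu n).2 x y⟩

/-- A bounded function that is Hölder at distances at most `1` is Hölder. -/
theorem HolderBdd.of_local (hα : 0 < α) (h1 : ∀ x, ‖f x‖ ≤ C)
    (h2 : ∀ x y, ‖x - y‖ ≤ 1 → ‖f x - f y‖ ≤ D * ‖x - y‖ ^ α) :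
    HolderBdd α (2 * C + |D|) f := by
  have hC : 0 ≤ C := (norm_nonneg _).trans (h1 0)
  refine ⟨fun x => (h1 x).trans (by linarith [abs_nonneg D]), fun x y => ?_⟩
  rcases le_total ‖x - y‖ 1 with h | h
  · refine (h2 x y h).trans ?_
    gcongr
    linarith [le_abs_self D]
  · calc ‖f x - f y‖ ≤ C + C := (norm_sub_le _ _).trans (add_le_add (h1 x) (h1 y))
      _ ≤ (2 * C + |D|) * 1 := by linarith [abs_nonneg D]
      _ ≤ _ := by
        gcongr
        exact Real.one_le_rpow h hα.le

theorem HolderBdd.continuous (hα : 0 < α) (h : HolderBdd α C f) : Continuous f := by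
  refine continuous_iff_continuousAt.2 fun x => ?_
  rw [ContinuousAt, tendsto_iff_norm_sub_tendsto_zero]
  have : Filter.Tendsto (fun y : Plane => C * ‖y - x‖ ^ α) (nhds x) (nhds (C * ‖x - x‖ ^ α)) := by
    refine Continuous.tendsto ?_ x
    exact continuous_const.mul ((by fun_prop : Continuous fun y : Plane => ‖y - x‖).rpow_const
      fun _ => Or.inr hα.le)
  rw [sub_self, norm_zero, Real.zero_rpow hα.ne', mul_zero] at this
  exact squeeze_zero (fun y => norm_nonneg _) (fun y => h.2 y x) this

theorem HolderBdd.locallyIntegrable (hα : 0 < α) (h : HolderBdd α C f) :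
    LocallyIntegrable f volume :=
  (h.continuous hα).locallyIntegrable

theorem HolderBdd.holderNorm_le {a : ℝ≥0} (h : HolderBdd a C f) :
    holderNorm a f ≤ ENNReal.ofReal (2 * C) := by
  have hC := h.nonneg
  have h1 : (⨆ x, ‖f x‖ₑ) ≤ ENNReal.ofReal C := iSup_le fun x => by
    rw [← ofReal_norm]
    exact ENNReal.ofReal_le_ofReal (h.1 x)
  have h2 : HolderWith C.toNNReal a f := fun x y => by
    rw [edist_dist, edist_dist, dist_eq_norm, dist_eq_norm,
      ENNReal.ofReal_rpow_of_nonneg (norm_nonneg (x - y)) a.coe_nonneg]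
    calc ENNReal.ofReal ‖f x - f y‖ ≤ ENNReal.ofReal (C * ‖x - y‖ ^ (a : ℝ)) :=
          ENNReal.ofReal_le_ofReal (h.2 x y)
      _ = _ := ENNReal.ofReal_mul hC
  calc holderNorm a f ≤ ENNReal.ofReal C + ENNReal.ofReal C := add_le_add h1 h2.eHolderNorm_le
    _ = _ := by rw [← ENNReal.ofReal_add hC hC, two_mul]

theorem holderBdd_of_holderNorm_le {a : ℝ≥0} (hC : 0 ≤ C)
    (h : holderNorm a f ≤ ENNReal.ofReal C) : HolderBdd a C f := by
  have h1 : ∀ x, ‖f x‖ₑ ≤ ENNReal.ofReal C := fun x =>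
    (le_iSup (fun x => ‖f x‖ₑ) x).trans (le_self_add.trans h)
  have h2 : eHolderNorm a f ≤ ENNReal.ofReal C := le_add_self.trans h
  have h3 : MemHolder a f := eHolderNorm_lt_top.1 (h2.trans_lt ENNReal.ofReal_lt_top)
  have h4 : (nnHolderNorm a f : ℝ) ≤ C := by
    rw [← h3.coe_nnHolderNorm_eq_eHolderNorm, ENNReal.ofReal, ENNReal.coe_le_coe] at h2
    simpa [hC] using (NNReal.coe_le_coe.2 h2)
  refine ⟨fun x => ?_, fun x y => ?_⟩
  · have := h1 x
    rwa [← ofReal_norm, ENNReal.ofReal_le_ofReal_iff hC] at this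
  · have := h3.holderWith.dist_le x y
    rw [dist_eq_norm, dist_eq_norm] at this
    exact this.trans (by gcongr)

end HolderBdd

/-! ### Test functions and distributions -/

/-- A smooth compactly supported function as a test function on the plane. -/
def mkTest (φ : Plane → ℝ) (h1 : ContDiff ℝ (⊤ : ℕ∞) φ) (h2 : HasCompactSupport φ) :
    𝓓((⊤ : Opens Plane), ℝ) :=
  ⟨φ, h1, h2, fun _ _ => trivial⟩

theorem integrable_continuous_compact_smul {E : Type*} [NormedAddCommGroup E] [NormedSpace ℝ E]
    {φ : Plane → ℝ} (h1 : Continuous φ) (h2 : HasCompactSupport φ) {f : Plane → E}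
    (hf : LocallyIntegrable f volume) : Integrable (fun x => φ x • f x) volume :=
  hf.integrable_smul_left_of_hasCompactSupport h1 h2

theorem locallyIntegrable_apply {v : Plane → Plane} (hv : LocallyIntegrable v volume) (i : Fin 2) :
    LocallyIntegrable (fun x => v x i) volume := fun x => by
  obtain ⟨s, hs, h⟩ := hv x
  exact ⟨s, hs, (EuclideanSpace.proj i : Plane →L[ℝ] ℝ).integrable_comp h⟩

theorem eq_sum_stdVec (x : Plane) : x = ∑ i, x i • stdVec i := by
  ext j
  fin_cases j <;> simp [stdVec]

theorem lineDeriv_ofFun_apply {f : Plane → ℝ} (hf : LocallyIntegrable f volume) (e : Plane)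
    (φ : 𝓓((⊤ : Opens Plane), ℝ)) : (∂_{e} (ofFun f)) φ = -∫ x, fderiv ℝ φ x e * f x := by
  rw [Distribution.lineDerivOp_apply_apply, map_neg, ofFun_apply hf]
  congr 2

theorem integrable_fderiv_apply_mul {φ : Plane → ℝ} (h1 : ContDiff ℝ (⊤ : ℕ∞) φ)
    (h2 : HasCompactSupport φ) {f : Plane → ℝ} (hf : LocallyIntegrable f volume) (e : Plane) :
    Integrable (fun x => fderiv ℝ φ x e * f x) volume :=
  integrable_continuous_compact_smul (φ := fun x => fderiv ℝ φ x e)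
    ((h1.continuous_fderiv (by simp)).clm_apply continuous_const)
    (h2.fderiv_apply (𝕜 := ℝ) e) hf

theorem divDist_apply {v : Plane → Plane} (hv : LocallyIntegrable v volume)
    (φ : 𝓓((⊤ : Opens Plane), ℝ)) : divDist v φ = -∫ x, fderiv ℝ φ x (v x) := by
  have hi := fun i => locallyIntegrable_apply hv i
  have e : ∀ x, fderiv ℝ φ x (v x) = ∑ i, fderiv ℝ φ x (stdVec i) * v x i := fun x => by
    conv_lhs => rw [eq_sum_stdVec (v x)]
    simp [mul_comm]
  have h : divDist v φ = ∑ i : Fin 2, (∂_{stdVec i} (ofFun fun x => v x i)) φ := by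
    rw [divDist]
    exact map_sum (⟨⟨fun T : Dist => T φ, rfl⟩, fun _ _ => rfl⟩ : Dist →+ ℝ) _ _
  simp_rw [h, e, lineDeriv_ofFun_apply (hi _)]
  rw [integral_finsetSum _ fun i _ =>
    integrable_fderiv_apply_mul φ.contDiff φ.hasCompactSupport (hi i) (stdVec i),
    Finset.sum_neg_distrib]

/-! ### Trace and curl of a linear map of the plane -/

/-- The rotation `x ↦ x^⊥ = (-x₂, x₁)` by a right angle. -/
def rot : Plane →ₗᵢ[ℝ] Plane where
  toFun x := !₂[-(x 1), x 0]
  map_add' x y := by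
    ext i
    fin_cases i <;> simp [add_comm]
  map_smul' c x := by
    ext i
    fin_cases i <;> simp
  norm_map' x := by
    simp [EuclideanSpace.norm_eq, add_comm]

@[simp] theorem rot_apply_zero (x : Plane) : rot x 0 = -(x 1) := rfl

@[simp] theorem rot_apply_one (x : Plane) : rot x 1 = x 0 := rfl

/-- The `i`-th coordinate as a continuous linear form. -/
def coordL (i : Fin 2) : Plane →L[ℝ] ℝ := EuclideanSpace.proj i

@[simp] theorem coordL_apply (i : Fin 2) (x : Plane) : coordL i x = x i := rfl

/-- The trace of a Jacobian matrix, that is, the divergence of the vector field. -/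
def divOp : (Plane →L[ℝ] Plane) →L[ℝ] ℝ :=
  (coordL 0).comp (ContinuousLinearMap.apply ℝ Plane (stdVec 0)) +
    (coordL 1).comp (ContinuousLinearMap.apply ℝ Plane (stdVec 1))

/-- The antisymmetric part `∂₁u² - ∂₂u¹` of a Jacobian matrix, that is, the curl of the
vector field. -/
def curlOp : (Plane →L[ℝ] Plane) →L[ℝ] ℝ :=
  (coordL 1).comp (ContinuousLinearMap.apply ℝ Plane (stdVec 0)) -
    (coordL 0).comp (ContinuousLinearMap.apply ℝ Plane (stdVec 1))

theorem divOp_apply (B : Plane →L[ℝ] Plane) : divOp B = B (stdVec 0) 0 + B (stdVec 1) 1 := rfl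

theorem curlOp_apply (B : Plane →L[ℝ] Plane) : curlOp B = B (stdVec 0) 1 - B (stdVec 1) 0 := rfl

theorem clm_apply_eq (B : Plane →L[ℝ] Plane) (x : Plane) :
    B x = x 0 • B (stdVec 0) + x 1 • B (stdVec 1) := by
  conv_lhs => rw [eq_sum_stdVec x]
  simp

theorem abs_coord_le (x : Plane) (i : Fin 2) : |x i| ≤ ‖x‖ := by
  simpa using PiLp.norm_apply_le x i

theorem norm_le_abs_add_abs (x : Plane) : ‖x‖ ≤ |x 0| + |x 1| := by
  rw [EuclideanSpace.norm_eq, Fin.sum_univ_two]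
  refine Real.sqrt_le_iff.2 ⟨by positivity, ?_⟩
  simp only [Real.norm_eq_abs]
  nlinarith [abs_nonneg (x 0), abs_nonneg (x 1)]

theorem norm_sq_eq (x : Plane) : ‖x‖ ^ 2 = x 0 ^ 2 + x 1 ^ 2 := by
  rw [EuclideanSpace.norm_sq_eq, Fin.sum_univ_two]
  simp

theorem norm_clm_le (B : Plane →L[ℝ] Plane) : ‖B‖ ≤ ‖B (stdVec 0)‖ + ‖B (stdVec 1)‖ := by
  refine B.opNorm_le_bound (by positivity) fun x => ?_
  rw [clm_apply_eq, add_mul]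
  refine (norm_add_le _ _).trans ?_
  rw [norm_smul, norm_smul, mul_comm, mul_comm (‖x 1‖)]
  gcongr
  exacts [abs_coord_le x 0, abs_coord_le x 1]

/-- A trace-free Jacobian matrix is controlled by its antisymmetric part and its action on a single
nonzero vector. -/
theorem norm_mul_norm_le_of_divOp_eq_zero (B : Plane →L[ℝ] Plane) (hB : divOp B = 0) (y : Plane) :
    ‖B‖ * ‖y‖ ≤ 8 * (‖B y‖ + |curlOp B| * ‖y‖) := by
  rcases eq_or_ne y 0 with rfl | hy
  · simp
  have hy' : 0 < ‖y‖ := norm_pos_iff.2 hy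
  set p := B (stdVec 0) 0
  set r := B (stdVec 0) 1
  set q := B (stdVec 1) 0
  have hs : B (stdVec 1) 1 = -p := by
    rw [divOp_apply] at hB
    linarith
  set w := curlOp B with hw
  have hr : r = q + w := by
    rw [hw, curlOp_apply]
    ring
  have h0 : B y 0 = y 0 * p + y 1 * q := by
    rw [clm_apply_eq]
    simp [p, q]
  have h1 : B y 1 = y 0 * r - y 1 * p := by
    rw [clm_apply_eq]
    simp [p, r, hs]
    ring
  -- the entries of the matrix are recovered by a complex division by `y`
  have hp : p * ‖y‖ ^ 2 = y 0 * B y 0 - y 1 * B y 1 + w * (y 0 * y 1) := by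
    rw [h0, h1, hr, norm_sq_eq]
    ring
  have hq : q * ‖y‖ ^ 2 = y 1 * B y 0 + y 0 * B y 1 - w * (y 0 * y 0) := by
    rw [h0, h1, hr, norm_sq_eq]
    ring
  have a0 := abs_coord_le y 0
  have a1 := abs_coord_le y 1
  have b0 := abs_coord_le (B y) 0
  have b1 := abs_coord_le (B y) 1
  have hb := norm_nonneg (B y)
  have aux : ∀ s t : ℝ, |s| ≤ ‖y‖ → |t| ≤ ‖B y‖ → |s * t| ≤ ‖y‖ * ‖B y‖ := fun s t hs ht => by
    rw [abs_mul]
    exact mul_le_mul hs ht (abs_nonneg _) hy'.le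
  have aux2 : ∀ s t : ℝ, |s| ≤ ‖y‖ → |t| ≤ ‖y‖ → |w * (s * t)| ≤ |w| * (‖y‖ * ‖y‖) :=
    fun s t hs ht => by
    rw [abs_mul, abs_mul]
    exact mul_le_mul_of_nonneg_left (mul_le_mul hs ht (abs_nonneg _) hy'.le) (abs_nonneg _)
  have hp' : |p| * ‖y‖ ≤ 2 * ‖B y‖ + |w| * ‖y‖ := by
    refine le_of_mul_le_mul_right ?_ hy'
    have : |p| * ‖y‖ * ‖y‖ = |p * ‖y‖ ^ 2| := by
      rw [abs_mul, abs_of_nonneg (by positivity : (0 : ℝ) ≤ ‖y‖ ^ 2)]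
      ring
    rw [this, hp]
    have e1 := aux _ _ a0 b0
    have e2 := aux _ _ a1 b1
    have e3 := aux2 _ _ a0 a1
    have := abs_add_le (y 0 * B y 0 - y 1 * B y 1) (w * (y 0 * y 1))
    have := abs_sub (y 0 * B y 0) (y 1 * B y 1)
    nlinarith
  have hq' : |q| * ‖y‖ ≤ 2 * ‖B y‖ + |w| * ‖y‖ := by
    refine le_of_mul_le_mul_right ?_ hy'
    have : |q| * ‖y‖ * ‖y‖ = |q * ‖y‖ ^ 2| := by
      rw [abs_mul, abs_of_nonneg (by positivity : (0 : ℝ) ≤ ‖y‖ ^ 2)]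
      ring
    rw [this, hq]
    have e1 := aux _ _ a1 b0
    have e2 := aux _ _ a0 b1
    have e3 := aux2 _ _ a0 a0
    have := abs_sub (y 1 * B y 0 + y 0 * B y 1) (w * (y 0 * y 0))
    have := abs_add_le (y 1 * B y 0) (y 0 * B y 1)
    nlinarith
  have hr' : |r| ≤ |q| + |w| := by
    rw [hr]
    exact abs_add_le _ _
  have hn : ‖B‖ ≤ 2 * |p| + 2 * |q| + |w| := by
    have := norm_clm_le B
    have e0 := norm_le_abs_add_abs (B (stdVec 0))
    have e1 := norm_le_abs_add_abs (B (stdVec 1))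
    rw [hs, abs_neg] at e1
    linarith
  nlinarith [abs_nonneg w]

/-! ### The regularized Biot-Savart kernels -/

/-- A smooth function of the squared radius that vanishes near `0` and is `1` from `1` on. -/
def cutoff (s : ℝ) : ℝ := Real.smoothTransition (2 * s - 1)

/-- The profile `cutoff s / (2 π s)`, extended smoothly by `0`. -/
def profile (s : ℝ) : ℝ := cutoff s / (2 * Real.pi * s)

/-- The Biot-Savart kernel, smoothly cut off inside the unit ball. -/
def regKernel (x : Plane) : Plane := profile (‖x‖ ^ 2) • rot x

/-- The kernel `K_t(x) = t⁻¹ K_1(x / t)`, which equals the Biot-Savart kernel for `|x| ≥ t`. -/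
def kern (t : ℝ) (x : Plane) : Plane := t⁻¹ • regKernel (t⁻¹ • x)

/-- The Jacobian matrix of the regularized kernel `kern t`. -/
def kernD (t : ℝ) : Plane → Plane →L[ℝ] Plane := fderiv ℝ (kern t)

/-- The curl of `regKernel`: a radial probability density supported in the unit ball. -/
def bump (x : Plane) : ℝ := deriv cutoff (‖x‖ ^ 2) / Real.pi

/-- The curl of `kern t`: the approximate identity obtained from `bump` by scaling. -/
def mollifier (t : ℝ) (x : Plane) : ℝ := (t ^ 2)⁻¹ * bump (t⁻¹ • x)

theorem contDiff_cutoff : ContDiff ℝ (⊤ : ℕ∞) cutoff :=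
  Real.smoothTransition.contDiff.comp (by fun_prop)

theorem cutoff_of_le {s : ℝ} (hs : s ≤ 1 / 2) : cutoff s = 0 :=
  Real.smoothTransition.zero_of_nonpos (by linarith)

theorem cutoff_of_one_le {s : ℝ} (hs : 1 ≤ s) : cutoff s = 1 :=
  Real.smoothTransition.one_of_one_le (by linarith)

theorem monotone_cutoff : Monotone cutoff := fun _ _ h =>
  Real.smoothTransition.monotone (by linarith)

theorem mul_profile (s : ℝ) : s * profile s = cutoff s / (2 * Real.pi) := by
  rcases eq_or_ne s 0 with rfl | hs
  · simp [cutoff_of_le]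
  · rw [profile]
    field_simp

theorem contDiff_profile : ContDiff ℝ (⊤ : ℕ∞) profile := by
  refine contDiff_iff_contDiffAt.2 fun s => ?_
  rcases lt_or_ge s (1 / 2) with h | h
  · refine (contDiffAt_const (c := (0 : ℝ))).congr_of_eventuallyEq ?_
    filter_upwards [Iio_mem_nhds h] with y hy
    simp [profile, cutoff_of_le (le_of_lt hy)]
  · exact contDiff_cutoff.contDiffAt.div (by fun_prop)
      (mul_ne_zero (by positivity) (by linarith))

theorem contDiff_regKernel : ContDiff ℝ (⊤ : ℕ∞) regKernel :=
  (contDiff_profile.comp (contDiff_norm_sq ℝ)).smul rot.toContinuousLinearMap.contDiff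

theorem contDiff_kern (t : ℝ) : ContDiff ℝ (⊤ : ℕ∞) (kern t) :=
  (contDiff_regKernel.comp (contDiff_const_smul t⁻¹)).const_smul t⁻¹

theorem differentiable_kern (t : ℝ) : Differentiable ℝ (kern t) :=
  (contDiff_kern t).differentiable (by simp)

theorem contDiff_kernD (t : ℝ) : ContDiff ℝ (⊤ : ℕ∞) (kernD t) :=
  (contDiff_kern t).fderiv_right (by simp)

theorem continuous_kernD (t : ℝ) : Continuous (kernD t) := (contDiff_kernD t).continuous

theorem regKernel_eq (x : Plane) : regKernel x = cutoff (‖x‖ ^ 2) • biotSavartKernel x := by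
  rw [regKernel, biotSavartKernel, smul_smul, profile, div_eq_mul_inv]
  rfl

theorem norm_biotSavartKernel (x : Plane) : ‖biotSavartKernel x‖ = (2 * Real.pi)⁻¹ * ‖x‖⁻¹ := by
  change ‖(2 * Real.pi * ‖x‖ ^ 2)⁻¹ • rot x‖ = _
  rw [norm_smul, rot.norm_map, Real.norm_of_nonneg (by positivity)]
  rcases eq_or_ne ‖x‖ 0 with h | h
  · simp [h]
  · field_simp

theorem biotSavartKernel_smul {c : ℝ} (hc : 0 < c) (x : Plane) :
    biotSavartKernel (c • x) = c⁻¹ • biotSavartKernel x := by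
  change (2 * Real.pi * ‖c • x‖ ^ 2)⁻¹ • rot (c • x) = c⁻¹ • (2 * Real.pi * ‖x‖ ^ 2)⁻¹ • rot x
  rw [norm_smul, map_smul, smul_smul, smul_smul, Real.norm_of_nonneg hc.le]
  congr 1
  rcases eq_or_ne ‖x‖ 0 with h | h
  · simp [h]
  · field_simp

theorem kern_eq {t : ℝ} (ht : 0 < t) (x : Plane) :
    kern t x = cutoff (‖t⁻¹ • x‖ ^ 2) • biotSavartKernel x := by
  rw [kern, regKernel_eq, biotSavartKernel_smul (by positivity), inv_inv, smul_comm, smul_smul,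
    smul_smul, mul_assoc, inv_mul_cancel₀ ht.ne', mul_one]

theorem kern_of_le {t : ℝ} (ht : 0 < t) {x : Plane} (hx : t ≤ ‖x‖) :
    kern t x = biotSavartKernel x := by
  rw [kern_eq ht, cutoff_of_one_le, one_smul]
  rw [norm_smul, norm_inv, Real.norm_of_nonneg ht.le]
  exact one_le_pow₀ (by rwa [inv_mul_eq_div, one_le_div ht])

theorem norm_kern_sub_le {t : ℝ} (ht : 0 < t) (x : Plane) :
    ‖kern t x - biotSavartKernel x‖ ≤ (Iic t).indicator (fun s : ℝ => s ^ ((1 : ℝ) - 2)) ‖x‖ := by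
  rw [indicator]
  split_ifs with h
  · rw [kern_eq ht]
    set c := cutoff (‖t⁻¹ • x‖ ^ 2)
    have h0 : 0 ≤ c := Real.smoothTransition.nonneg _
    have h1 : c ≤ 1 := Real.smoothTransition.le_one _
    have e : c • biotSavartKernel x - biotSavartKernel x = (c - 1) • biotSavartKernel x := by
      rw [sub_smul, one_smul]
    rw [e, norm_smul, norm_biotSavartKernel]
    have h2 : ‖x‖ ^ ((1 : ℝ) - 2) = ‖x‖⁻¹ := by
      norm_num
      rw [Real.rpow_neg_one]
    have h3 : ‖c - 1‖ ≤ 1 := by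
      rw [Real.norm_eq_abs, abs_le]
      constructor <;> linarith
    have h4 : (2 * Real.pi)⁻¹ ≤ 1 := inv_le_one_of_one_le₀ (by linarith [Real.pi_gt_three])
    rw [h2]
    have h5 : 0 ≤ ‖x‖⁻¹ := by positivity
    calc ‖c - 1‖ * ((2 * Real.pi)⁻¹ * ‖x‖⁻¹) ≤ 1 * (1 * ‖x‖⁻¹) := by gcongr
      _ = _ := by ring
  · rw [kern_of_le ht (le_of_lt (not_le.1 h)), sub_self, norm_zero]

theorem kernD_apply_eq {t : ℝ} (x : Plane) :
    kernD t x = (t ^ 2)⁻¹ • fderiv ℝ regKernel (t⁻¹ • x) := by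
  have h : HasFDerivAt regKernel (fderiv ℝ regKernel (t⁻¹ • x)) (t⁻¹ • x) :=
    (contDiff_regKernel.differentiable (by simp) _).hasFDerivAt
  have h2 := (h.comp x ((hasFDerivAt_id x).const_smul t⁻¹)).const_smul t⁻¹
  have : kernD t x = _ := h2.fderiv
  rw [this]
  ext1 v
  simp [smul_smul, sq]

theorem kernD_eq_of_lt {t s : ℝ} (ht : 0 < t) (hs : 0 < s) {x : Plane} (hx : max t s < ‖x‖) :
    kernD t x = kernD s x := by
  refine Filter.EventuallyEq.fderiv_eq ?_
  filter_upwards [(isOpen_lt continuous_const continuous_norm).mem_nhds hx] with y hy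
  have hy' : max t s < ‖y‖ := hy
  rw [kern_of_le ht ((le_max_left _ _).trans hy'.le),
    kern_of_le hs ((le_max_right _ _).trans hy'.le)]

/-- A continuous function that is homogeneous of degree `-n` off the unit ball decays. -/
theorem exists_decay {F : Type*} [NormedAddCommGroup F] [NormedSpace ℝ F] {f : Plane → F}
    (hf : Continuous f) (n : ℕ)
    (h : ∀ x : Plane, 1 < ‖x‖ → ∀ c : ℝ, 1 ≤ c → f (c • x) = (c ^ n)⁻¹ • f x) :
    ∃ A : ℝ, 0 ≤ A ∧ ∀ x, ‖f x‖ ≤ A * ((1 + ‖x‖) ^ n)⁻¹ := by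
  obtain ⟨A, hA⟩ := (isCompact_closedBall (0 : Plane) 2).exists_bound_of_continuousOn
    hf.continuousOn
  have hA0 : 0 ≤ A := (norm_nonneg _).trans (hA 0 (by simp))
  refine ⟨A * 3 ^ n, by positivity, fun x => ?_⟩
  rw [mul_assoc, ← div_eq_mul_inv, ← div_pow]
  rcases le_or_gt ‖x‖ 2 with hx | hx
  · refine (hA x (by simpa using hx)).trans (le_mul_of_one_le_right hA0 (one_le_pow₀ ?_))
    rw [one_le_div (by positivity)]
    linarith
  · have hx0 : 0 < ‖x‖ := by linarith
    have hy : ‖(2 / ‖x‖) • x‖ = 2 := by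
      rw [norm_smul, Real.norm_of_nonneg (by positivity)]
      field_simp
    have e : x = (‖x‖ / 2) • ((2 / ‖x‖) • x) := by
      rw [smul_smul]
      field_simp
      simp
    rw [e, h _ (by rw [hy]; norm_num) _ (by linarith), ← e, norm_smul,
      Real.norm_of_nonneg (by positivity), mul_comm, ← inv_pow, inv_div]
    refine mul_le_mul (hA _ (by simp [hy])) ?_ (by positivity) hA0
    gcongr ?_ ^ n
    rw [div_le_div_iff₀ hx0 (by positivity)]
    linarith

theorem fderiv_homogeneous {F : Type*} [NormedAddCommGroup F] [NormedSpace ℝ F] {f : Plane → F}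
    (hf : Differentiable ℝ f) (n : ℕ)
    (h : ∀ x : Plane, 1 < ‖x‖ → ∀ c : ℝ, 1 ≤ c → f (c • x) = (c ^ n)⁻¹ • f x)
    (x : Plane) (hx : 1 < ‖x‖) (c : ℝ) (hc : 1 ≤ c) :
    fderiv ℝ f (c • x) = (c ^ (n + 1))⁻¹ • fderiv ℝ f x := by
  have hc0 : c ≠ 0 := by linarith
  have h1 : HasFDerivAt (fun y : Plane => f (c • y)) (c • fderiv ℝ f (c • x)) x := by
    have := (hf (c • x)).hasFDerivAt.comp x ((hasFDerivAt_id x).const_smul c)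
    refine this.congr_fderiv ?_
    ext1 v
    simp
  have h2 : HasFDerivAt (fun y : Plane => f (c • y)) ((c ^ n)⁻¹ • fderiv ℝ f x) x := by
    refine ((hf x).hasFDerivAt.const_smul _).congr_of_eventuallyEq ?_
    filter_upwards [(isOpen_lt continuous_const continuous_norm).mem_nhds hx] with y hy
    exact h y hy c hc
  have h3 := h1.unique h2
  rw [pow_succ, mul_inv, mul_comm, mul_smul, ← h3, smul_smul, inv_mul_cancel₀ hc0, one_smul]

theorem regKernel_homogeneous (x : Plane) (hx : 1 < ‖x‖) (c : ℝ) (hc : 1 ≤ c) :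
    regKernel (c • x) = (c ^ 1)⁻¹ • regKernel x := by
  have h1 : 1 ≤ ‖x‖ ^ 2 := one_le_pow₀ hx.le
  have h2 : 1 ≤ ‖c • x‖ ^ 2 := by
    rw [norm_smul, Real.norm_of_nonneg (by linarith)]
    exact one_le_pow₀ (one_le_mul_of_one_le_of_one_le hc hx.le)
  rw [regKernel_eq, regKernel_eq, cutoff_of_one_le h1, cutoff_of_one_le h2,
    biotSavartKernel_smul (by linarith)]
  simp

/-- The decay of the derivatives of the regularized kernels, uniformly in the regularization. -/
theorem exists_kernel_bound : ∃ A : ℝ, 0 ≤ A ∧ (∀ x, ‖regKernel x‖ ≤ A) ∧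
    (∀ t, 0 < t → ∀ x, ‖kernD t x‖ ≤ A * ((t + ‖x‖) ^ 2)⁻¹) ∧
    ∀ t, 0 < t → ∀ x y, ‖x - y‖ ≤ t →
      ‖kernD t x - kernD t y‖ ≤ A * ‖x - y‖ * ((t + ‖x‖) ^ 3)⁻¹ := by
  have d0 : Differentiable ℝ regKernel := contDiff_regKernel.differentiable (by simp)
  have c1 : ContDiff ℝ (⊤ : ℕ∞) (fderiv ℝ regKernel) := contDiff_regKernel.fderiv_right (by simp)
  have c2 : ContDiff ℝ (⊤ : ℕ∞) (fderiv ℝ (fderiv ℝ regKernel)) := c1.fderiv_right (by simp)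
  have d1 : Differentiable ℝ (fderiv ℝ regKernel) := c1.differentiable (by simp)
  have h0 := regKernel_homogeneous
  have h1 := fderiv_homogeneous d0 1 h0
  have h2 := fderiv_homogeneous d1 2 h1
  obtain ⟨A0, hA0, hb0⟩ := exists_decay contDiff_regKernel.continuous 1 h0
  obtain ⟨A1, hA1, hb1⟩ := exists_decay c1.continuous 2 h1
  obtain ⟨A2, hA2, hb2⟩ := exists_decay c2.continuous 3 h2
  refine ⟨A0 + A1 + 8 * A2, by positivity, fun x => ?_, fun t ht x => ?_,
    fun t ht x y hxy => ?_⟩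
  · refine (hb0 x).trans ?_
    have : ((1 + ‖x‖) ^ 1)⁻¹ ≤ 1 := inv_le_one_of_one_le₀ (by simp)
    nlinarith
  · have e : (t + ‖x‖) ^ 2 = t ^ 2 * (1 + ‖t⁻¹ • x‖) ^ 2 := by
      rw [norm_smul, norm_inv, Real.norm_of_nonneg ht.le, ← mul_pow, mul_add,
        mul_inv_cancel_left₀ ht.ne', mul_one]
    rw [kernD_apply_eq, norm_smul, norm_inv, Real.norm_of_nonneg (by positivity), e, mul_inv]
    calc (t ^ 2)⁻¹ * ‖fderiv ℝ regKernel (t⁻¹ • x)‖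
        ≤ (t ^ 2)⁻¹ * (A1 * ((1 + ‖t⁻¹ • x‖) ^ 2)⁻¹) := by gcongr; exact hb1 _
      _ = A1 * ((t ^ 2)⁻¹ * ((1 + ‖t⁻¹ • x‖) ^ 2)⁻¹) := by ring
      _ ≤ _ := by gcongr; linarith
  · have hfd : ∀ z, HasFDerivAt (kernD t)
        ((t ^ 3)⁻¹ • fderiv ℝ (fderiv ℝ regKernel) (t⁻¹ • z)) z := fun z => by
      have e : kernD t = fun x => (t ^ 2)⁻¹ • fderiv ℝ regKernel (t⁻¹ • x) :=
        funext fun x => kernD_apply_eq x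
      rw [e]
      have := ((d1 (t⁻¹ • z)).hasFDerivAt.comp z
        ((hasFDerivAt_id z).const_smul t⁻¹)).const_smul (t ^ 2)⁻¹
      refine this.congr_fderiv ?_
      ext1 v
      simp only [_root_.smul_apply, ContinuousLinearMap.comp_apply,
        ContinuousLinearMap.id_apply, map_smul, smul_smul]
      congr 1
      field_simp
    have hz : ∀ z ∈ segment ℝ x y, ‖(t ^ 3)⁻¹ • fderiv ℝ (fderiv ℝ regKernel) (t⁻¹ • z)‖
        ≤ 8 * A2 * ((t + ‖x‖) ^ 3)⁻¹ := fun z hz => by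
      have hzx : ‖z - x‖ ≤ t := by
        have := norm_sub_le_of_mem_segment hz
        rw [norm_sub_rev y x] at this
        exact this.trans hxy
      have h4 : (t + ‖x‖) / 2 ≤ t + ‖z‖ := by
        have := norm_sub_norm_le x z
        rw [norm_sub_rev] at this
        linarith [norm_nonneg z]
      have e : (t + ‖z‖) ^ 3 = t ^ 3 * (1 + ‖t⁻¹ • z‖) ^ 3 := by
        rw [norm_smul, norm_inv, Real.norm_of_nonneg ht.le, ← mul_pow, mul_add,
          mul_inv_cancel_left₀ ht.ne', mul_one]
      refine (ContinuousLinearMap.opNorm_smul_le _ _).trans ?_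
      rw [norm_inv, Real.norm_of_nonneg (by positivity)]
      calc (t ^ 3)⁻¹ * ‖fderiv ℝ (fderiv ℝ regKernel) (t⁻¹ • z)‖
          ≤ (t ^ 3)⁻¹ * (A2 * ((1 + ‖t⁻¹ • z‖) ^ 3)⁻¹) := by gcongr; exact hb2 _
        _ = A2 * ((t + ‖z‖) ^ 3)⁻¹ := by rw [e, mul_inv]; ring
        _ ≤ A2 * (((t + ‖x‖) / 2) ^ 3)⁻¹ := by gcongr
        _ = _ := by rw [div_pow, inv_div]; ring
    have := (convex_segment x y).norm_image_sub_le_of_norm_hasFDerivWithin_le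
      (fun z _ => (hfd z).hasFDerivWithinAt) hz (right_mem_segment ℝ x y) (left_mem_segment ℝ x y)
    refine this.trans ?_
    rw [mul_right_comm]
    gcongr
    linarith

theorem hasFDerivAt_regKernel (x : Plane) : HasFDerivAt regKernel
    (profile (‖x‖ ^ 2) • rot.toContinuousLinearMap +
      ((deriv profile (‖x‖ ^ 2)) • (2 • innerSL ℝ x)).smulRight (rot x)) x := by
  have h1 : HasDerivAt profile (deriv profile (‖x‖ ^ 2)) (‖x‖ ^ 2) :=
    (contDiff_profile.differentiable (by simp) _).hasDerivAt
  exact (h1.comp_hasFDerivAt x (hasStrictFDerivAt_norm_sq x).hasFDerivAt).smul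
    rot.toContinuousLinearMap.hasFDerivAt

theorem deriv_cutoff_eq (s : ℝ) :
    deriv cutoff s = 2 * Real.pi * (profile s + s * deriv profile s) := by
  have h1 : HasDerivAt profile (deriv profile s) s :=
    (contDiff_profile.differentiable (by simp) _).hasDerivAt
  have h2 := ((hasDerivAt_id s).mul h1).const_mul (2 * Real.pi)
  have e : (fun y => 2 * Real.pi * ((id : ℝ → ℝ) * profile) y) = cutoff := by
    ext y
    simp only [Pi.mul_apply, id, mul_profile]
    field_simp
  rw [e] at h2
  rw [h2.deriv]
  simp

theorem divOp_fderiv_regKernel (x : Plane) : divOp (fderiv ℝ regKernel x) = 0 := by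
  rw [(hasFDerivAt_regKernel x).fderiv, divOp_apply]
  simp [stdVec, EuclideanSpace.inner_single_right]
  ring

theorem curlOp_fderiv_regKernel (x : Plane) : curlOp (fderiv ℝ regKernel x) = bump x := by
  rw [(hasFDerivAt_regKernel x).fderiv, curlOp_apply, bump, deriv_cutoff_eq, norm_sq_eq]
  simp [stdVec, EuclideanSpace.inner_single_right]
  field_simp
  ring

theorem divOp_kernD (t : ℝ) (x : Plane) : divOp (kernD t x) = 0 := by
  rw [kernD_apply_eq, map_smul, divOp_fderiv_regKernel, smul_zero]

theorem curlOp_kernD (t : ℝ) (x : Plane) : curlOp (kernD t x) = mollifier t x := by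
  rw [kernD_apply_eq, map_smul, curlOp_fderiv_regKernel, smul_eq_mul, mollifier]

/-! ### The approximate identity -/

theorem contDiff_bump : ContDiff ℝ (⊤ : ℕ∞) bump :=
  ((contDiff_cutoff.iterate_deriv 1).comp (contDiff_norm_sq ℝ)).div_const _

theorem bump_nonneg (x : Plane) : 0 ≤ bump x :=
  div_nonneg (monotone_cutoff.deriv_nonneg) Real.pi_pos.le

theorem bump_of_lt {x : Plane} (hx : 1 < ‖x‖) : bump x = 0 := by
  have h : deriv cutoff (‖x‖ ^ 2) = deriv (fun _ => (1 : ℝ)) (‖x‖ ^ 2) := by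
    refine Filter.EventuallyEq.deriv_eq ?_
    filter_upwards [Ioi_mem_nhds (one_lt_pow₀ hx two_ne_zero)] with y hy
    exact cutoff_of_one_le (le_of_lt hy)
  simp [bump, h]

theorem hasCompactSupport_bump : HasCompactSupport bump :=
  HasCompactSupport.intro (isCompact_closedBall (0 : Plane) 1) fun x hx =>
    bump_of_lt (by simpa using hx)

theorem integral_bump : ∫ x, bump x = 1 := by
  change ∫ x : Plane, (fun r : ℝ => deriv cutoff (r ^ 2) / Real.pi) ‖x‖ = 1
  rw [integral_fun_norm_addHaar volume (fun r : ℝ => deriv cutoff (r ^ 2) / Real.pi)]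
  have h1 : volume.real (Metric.ball (0 : Plane) 1) = Real.pi := by
    rw [Measure.real, EuclideanSpace.volume_ball_fin_two]
    simp [Real.pi_pos.le]
  have h2 : ∫ y in Ioi (0 : ℝ), y ^ (Module.finrank ℝ Plane - 1) •
      (deriv cutoff (y ^ 2) / Real.pi) = 1 / (2 * Real.pi) := by
    have hd : ∀ y ∈ Ioi (0 : ℝ), HasDerivAt (fun y => cutoff (y ^ 2) / (2 * Real.pi))
        (y ^ (Module.finrank ℝ Plane - 1) • (deriv cutoff (y ^ 2) / Real.pi)) y := fun y _ => by
      have h3 : HasDerivAt cutoff (deriv cutoff (y ^ 2)) ((fun y : ℝ => y ^ 2) y) :=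
        (contDiff_cutoff.differentiable (by simp) _).hasDerivAt
      refine ((HasDerivAt.comp (h := fun y : ℝ => y ^ 2) y h3 (hasDerivAt_pow 2 y)).div_const
        (2 * Real.pi)).congr_deriv ?_
      simp
      field_simp
    have hc : Continuous fun y => cutoff (y ^ 2) / (2 * Real.pi) :=
      (contDiff_cutoff.continuous.comp (continuous_pow 2)).div_const _
    have hl : Filter.Tendsto (fun y => cutoff (y ^ 2) / (2 * Real.pi)) Filter.atTop
        (nhds (1 / (2 * Real.pi))) := by
      refine tendsto_const_nhds.congr' ?_
      filter_upwards [Filter.eventually_ge_atTop 1] with y hy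
      rw [cutoff_of_one_le (one_le_pow₀ hy)]
    rw [integral_Ioi_of_hasDerivAt_of_nonneg hc.continuousWithinAt hd (fun y hy => ?_) hl]
    · simp [cutoff_of_le]
    · exact mul_nonneg (pow_nonneg (le_of_lt hy) _)
        (div_nonneg monotone_cutoff.deriv_nonneg Real.pi_pos.le)
  rw [h1, h2]
  simp

theorem mollifier_nonneg (t : ℝ) (x : Plane) : 0 ≤ mollifier t x :=
  mul_nonneg (by positivity) (bump_nonneg _)

theorem mollifier_of_lt {t : ℝ} (ht : 0 < t) {x : Plane} (hx : t < ‖x‖) : mollifier t x = 0 := by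
  rw [mollifier, bump_of_lt, mul_zero]
  rwa [norm_smul, norm_inv, Real.norm_of_nonneg ht.le, inv_mul_eq_div, one_lt_div ht]

theorem contDiff_mollifier (t : ℝ) : ContDiff ℝ (⊤ : ℕ∞) (mollifier t) :=
  contDiff_const.mul (contDiff_bump.comp (contDiff_const_smul (t⁻¹ : ℝ)))

theorem hasCompactSupport_mollifier {t : ℝ} (ht : 0 < t) : HasCompactSupport (mollifier t) :=
  HasCompactSupport.intro (isCompact_closedBall (0 : Plane) t) fun x hx =>
    mollifier_of_lt ht (by simpa using hx)

theorem integrable_mollifier {t : ℝ} (ht : 0 < t) : Integrable (mollifier t) volume :=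
  (contDiff_mollifier t).continuous.integrable_of_hasCompactSupport (hasCompactSupport_mollifier ht)

theorem integral_mollifier {t : ℝ} (ht : 0 < t) : ∫ x, mollifier t x = 1 := by
  simp only [mollifier]
  rw [integral_const_mul, Measure.integral_comp_smul volume bump, integral_bump]
  simp [finrank_euclideanSpace, ht.ne']

/-! ### Singular integrals against Hölder functions -/

/-- A constant that bounds the regularized kernels and their derivatives. -/
def kernelConst : ℝ := exists_kernel_bound.choose

theorem kernelConst_nonneg : 0 ≤ kernelConst := exists_kernel_bound.choose_spec.1

theorem norm_regKernel_le (x : Plane) : ‖regKernel x‖ ≤ kernelConst :=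
  exists_kernel_bound.choose_spec.2.1 x

theorem norm_kernD_le {t : ℝ} (ht : 0 < t) (x : Plane) :
    ‖kernD t x‖ ≤ kernelConst * ((t + ‖x‖) ^ 2)⁻¹ :=
  exists_kernel_bound.choose_spec.2.2.1 t ht x

theorem norm_kernD_sub_le {t : ℝ} (ht : 0 < t) {x y : Plane} (h : ‖x - y‖ ≤ t) :
    ‖kernD t x - kernD t y‖ ≤ kernelConst * ‖x - y‖ * ((t + ‖x‖) ^ 3)⁻¹ :=
  exists_kernel_bound.choose_spec.2.2.2 t ht x y h

/-- The kernels for two regularization parameters differ only at small distances, so that their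
difference integrates a Hölder modulus to a small quantity. -/
theorem kernD_sub_mul_le {α : ℝ} (hα : 0 < α) (hα2 : α < 2) {t s : ℝ} (ht : 0 < t) (hs : 0 < s)
    (z : Plane) : ‖kernD t z - kernD s z‖ * ‖z‖ ^ α ≤
      2 * kernelConst * (Iic (max t s)).indicator (fun r : ℝ => r ^ (α - 2)) ‖z‖ := by
  have hA := kernelConst_nonneg
  rw [indicator]
  split_ifs with h
  · rcases eq_or_ne z 0 with rfl | hz
    · rw [norm_zero, Real.zero_rpow hα.ne', Real.zero_rpow (by linarith)]
      simp
    have hz' : 0 < ‖z‖ := norm_pos_iff.2 hz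
    have hb : ∀ r : ℝ, 0 < r → ‖kernD r z‖ ≤ kernelConst * (‖z‖ ^ 2)⁻¹ := fun r hr => by
      refine (norm_kernD_le hr z).trans ?_
      gcongr
      linarith
    have e : ‖z‖ ^ (α - 2) = (‖z‖ ^ 2)⁻¹ * ‖z‖ ^ α := by
      rw [Real.rpow_sub hz', div_eq_inv_mul]
      norm_num
    rw [e, ← mul_assoc]
    gcongr
    refine (norm_sub_le _ _).trans ?_
    linarith [hb t ht, hb s hs]
  · rw [kernD_eq_of_lt ht hs (not_le.1 h)]
    simp

theorem norm_integral_kernD_sub_le {F : Type*} [NormedAddCommGroup F] [NormedSpace ℝ F]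
    {α : ℝ} (hα : 0 < α) (hα2 : α < 2) {t s : ℝ} (ht : 0 < t) (hs : 0 < s) {M : ℝ} (hM : 0 ≤ M)
    (x : Plane) {Φ : Plane → F}
    (h : ∀ᵐ y, ‖Φ y‖ ≤ M * (‖kernD t (x - y) - kernD s (x - y)‖ * ‖x - y‖ ^ α)) :
    ‖∫ y, Φ y‖ ≤ M * (4 * Real.pi * kernelConst / α * max t s ^ α) := by
  have hi := ((integrable_indicator_norm_rpow hα (max t s)).const_mul
    (M * (2 * kernelConst))).comp_sub_left x
  refine (norm_integral_le_of_norm_le hi ?_).trans (le_of_eq ?_)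
  · filter_upwards [h] with y hy
    refine hy.trans ?_
    rw [mul_assoc]
    exact mul_le_mul_of_nonneg_left (kernD_sub_mul_le hα hα2 ht hs _) hM
  · rw [integral_sub_left_eq_self (fun z : Plane => M * (2 * kernelConst) *
      (Iic (max t s)).indicator (fun r : ℝ => r ^ (α - 2)) ‖z‖), integral_const_mul,
      integral_indicator_norm_rpow hα (ht.le.trans (le_max_left t s))]
    ring

/-- The compactly supported part of the kernel `kernD t`. -/
def nearD (t : ℝ) (z : Plane) : Plane →L[ℝ] Plane := kernD t z - kernD 1 z

theorem continuous_nearD (t : ℝ) : Continuous (nearD t) :=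
  (continuous_kernD t).sub (continuous_kernD 1)

theorem nearD_of_lt {t : ℝ} (ht : 0 < t) (ht1 : t ≤ 1) {z : Plane} (hz : 1 < ‖z‖) :
    nearD t z = 0 := by
  rw [nearD, kernD_eq_of_lt ht one_pos (by rwa [max_eq_right ht1]), sub_self]

@[simp] theorem nearD_one (z : Plane) : nearD 1 z = 0 := sub_self _

theorem hasCompactSupport_nearD_sub {t : ℝ} (ht : 0 < t) (ht1 : t ≤ 1) (x : Plane) :
    HasCompactSupport fun y => nearD t (x - y) :=
  HasCompactSupport.intro (isCompact_closedBall x 1) fun y hy => nearD_of_lt ht ht1 <| by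
    rwa [Metric.mem_closedBall, not_le, dist_comm, dist_eq_norm] at hy

/-- The commutator of the singular integral with kernel `nearD t` and the multiplication by `v`. -/
def comm (b : Plane → ℝ) (v : Plane → Plane) (t : ℝ) (x : Plane) : Plane :=
  ∫ y, b y • nearD t (x - y) (v x - v y)

section comm

variable {α B V : ℝ} {b : Plane → ℝ} {v : Plane → Plane} {t : ℝ}

theorem integrable_smul_nearD (hb : LocallyIntegrable b volume) (ht : 0 < t) (ht1 : t ≤ 1)
    (x : Plane) : Integrable (fun y => b y • nearD t (x - y)) volume :=
  hb.integrable_smul_right_of_hasCompactSupport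
    ((continuous_nearD t).comp (continuous_const.sub continuous_id))
    (hasCompactSupport_nearD_sub ht ht1 x)

theorem integrable_nearD_apply (hb : LocallyIntegrable b volume) (ht : 0 < t) (ht1 : t ≤ 1)
    (x : Plane) {w : Plane → Plane} (hw : Continuous w) :
    Integrable (fun y => b y • nearD t (x - y) (w y)) volume := by
  refine hb.integrable_smul_right_of_hasCompactSupport (by
    exact ((continuous_nearD t).comp (continuous_const.sub continuous_id)).clm_apply hw) ?_
  refine (hasCompactSupport_nearD_sub ht ht1 x).mono fun y hy h => hy ?_
  simp only at h ⊢
  rw [h]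
  rfl

theorem norm_comm_sub_le (hα : 0 < α) (hα2 : α < 2) (hb : LocallyIntegrable b volume)
    (hB : ∀ᵐ y, |b y| ≤ B) (hvc : Continuous v)
    (hv : ∀ x y, ‖v x - v y‖ ≤ V * ‖x - y‖ ^ α) (hV : 0 ≤ V)
    (ht : 0 < t) (ht1 : t ≤ 1) {s : ℝ} (hs : 0 < s) (hs1 : s ≤ 1) (x : Plane) :
    ‖comm b v t x - comm b v s x‖ ≤
      B * V * (4 * Real.pi * kernelConst / α * max t s ^ α) := by
  have hB0 : 0 ≤ B := by
    obtain ⟨y, hy⟩ := hB.exists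
    exact (abs_nonneg _).trans hy
  rw [comm, comm, ← integral_sub
    (integrable_nearD_apply hb ht ht1 x (w := fun y => v x - v y) (continuous_const.sub hvc))
    (integrable_nearD_apply hb hs hs1 x (w := fun y => v x - v y) (continuous_const.sub hvc))]
  refine norm_integral_kernD_sub_le hα hα2 ht hs (by positivity) x ?_
  filter_upwards [hB] with y hy
  rw [← smul_sub, norm_smul, Real.norm_eq_abs, ← _root_.sub_apply,
    show nearD t (x - y) - nearD s (x - y) = kernD t (x - y) - kernD s (x - y) by
      simp [nearD]]
  calc |b y| * ‖(kernD t (x - y) - kernD s (x - y)) (v x - v y)‖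
      ≤ B * (‖kernD t (x - y) - kernD s (x - y)‖ * (V * ‖x - y‖ ^ α)) := by
        gcongr
        refine (ContinuousLinearMap.le_opNorm _ _).trans ?_
        gcongr
        exact hv x y
    _ = _ := by ring

theorem comm_one (b : Plane → ℝ) (v : Plane → Plane) (x : Plane) : comm b v 1 x = 0 := by
  simp [comm]

theorem norm_comm_le (hα : 0 < α) (hα2 : α < 2) (hb : LocallyIntegrable b volume)
    (hB : ∀ᵐ y, |b y| ≤ B) (hvc : Continuous v)
    (hv : ∀ x y, ‖v x - v y‖ ≤ V * ‖x - y‖ ^ α) (hV : 0 ≤ V)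
    (ht : 0 < t) (ht1 : t ≤ 1) (x : Plane) :
    ‖comm b v t x‖ ≤ B * V * (4 * Real.pi * kernelConst / α) := by
  have := norm_comm_sub_le hα hα2 hb hB hvc hv hV ht ht1 one_pos le_rfl x
  rwa [comm_one, sub_zero, max_eq_right ht1, Real.one_rpow, mul_one] at this

theorem norm_nearD_sub_le {h : ℝ} (ht1 : t ≤ 1) {x x' : Plane}
    (hx : ‖x - x'‖ ≤ h) (h0 : 0 < h) (hht : h ≤ t) (y : Plane) :
    ‖nearD t (x - y) - nearD t (x' - y)‖ ≤ 2 * kernelConst * h * ((t + ‖x - y‖) ^ 3)⁻¹ := by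
  have hA := kernelConst_nonneg
  have ht : 0 < t := h0.trans_le hht
  have e : x - y - (x' - y) = x - x' := by abel
  have b : ∀ s, t ≤ s → ‖kernD s (x - y) - kernD s (x' - y)‖ ≤
      kernelConst * h * ((t + ‖x - y‖) ^ 3)⁻¹ := fun s hs => by
    refine (norm_kernD_sub_le (ht.trans_le hs) (by rw [e]; linarith)).trans ?_
    rw [e]
    have : 0 < t + ‖x - y‖ := by positivity
    have := hs.trans' ht.le
    gcongr
  have e2 : nearD t (x - y) - nearD t (x' - y) =
      (kernD t (x - y) - kernD t (x' - y)) - (kernD 1 (x - y) - kernD 1 (x' - y)) := by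
    simp only [nearD]
    abel
  rw [e2]
  refine (norm_sub_le _ _).trans ?_
  linarith [b t le_rfl, b 1 ht1]

/-- The Hölder estimate of the commutator at points closer than the regularization scale: the
difference splits into `v x - v x'`, against which the singular integral of `b` is bounded, and a
difference of kernels, which decays like `|x - y| ^ (α - 3)` against the modulus of `v`. -/
theorem norm_comm_sub_comm_le (hα : 0 < α) (hα1 : α < 1) (hb : LocallyIntegrable b volume)
    (hB : ∀ᵐ y, |b y| ≤ B) (hv : HolderBdd α V v) (ht : 0 < t) (ht1 : t ≤ 1) {N : ℝ}
    (hN : ∀ x, ‖∫ y, b y • nearD t (x - y)‖ ≤ N) {x x' : Plane} {h : ℝ} (h0 : 0 < h)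
    (hx : ‖x - x'‖ = h) (hht : h ≤ t) :
    ‖comm b v t x - comm b v t x'‖ ≤ N * (V * h ^ α) +
      2 * kernelConst * B * V * (∫ z : Plane, (1 + ‖z‖) ^ (α - 3)) * h ^ α := by
  have hA := kernelConst_nonneg
  have hV := hv.nonneg
  have hvc := hv.continuous hα
  have hB0 : 0 ≤ B := by
    obtain ⟨y, hy⟩ := hB.exists
    exact (abs_nonneg _).trans hy
  have hN0 : 0 ≤ N := (norm_nonneg _).trans (hN 0)
  have hI' : 0 ≤ ∫ z : Plane, (1 + ‖z‖) ^ (α - 3) := integral_nonneg fun z => by positivity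
  have h2 : comm b v t x - comm b v t x' = (∫ y, b y • nearD t (x - y)) (v x - v x') +
      ∫ y, b y • (nearD t (x - y) - nearD t (x' - y)) (v x' - v y) := by
    have i1 := fun z z' => integrable_nearD_apply hb ht ht1 z
      (w := fun y => v z' - v y) (continuous_const.sub hvc)
    have i3 := (integrable_smul_nearD hb ht ht1 x).apply_continuousLinearMap (v x - v x')
    have i4 : Integrable (fun y => b y • (nearD t (x - y) - nearD t (x' - y)) (v x' - v y))
        volume := by
      refine ((i1 x x').sub (i1 x' x')).congr (Filter.Eventually.of_forall fun y => ?_)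
      simp only [Pi.sub_apply, _root_.sub_apply, smul_sub]
    rw [comm, comm, ← integral_sub (i1 x x) (i1 x' x'), ContinuousLinearMap.integral_apply
      (integrable_smul_nearD hb ht ht1 x), ← integral_add i3 i4]
    congr 1
    ext1 y
    simp only [_root_.smul_apply, _root_.sub_apply, map_sub, smul_sub]
    abel
  have h3 : ‖(∫ y, b y • nearD t (x - y)) (v x - v x')‖ ≤ N * (V * h ^ α) := by
    rw [← hx]
    exact (ContinuousLinearMap.le_opNorm _ _).trans
      (mul_le_mul (hN x) (hv.2 x x') (norm_nonneg _) hN0)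
  have h4 : ‖∫ y, b y • (nearD t (x - y) - nearD t (x' - y)) (v x' - v y)‖ ≤
      2 * kernelConst * B * V * (∫ z : Plane, (1 + ‖z‖) ^ (α - 3)) * h ^ α := by
    obtain ⟨j1, j2⟩ := integrable_add_norm_rpow (β := α - 3) (by linarith) ht
    have j3 := (j1.const_mul (2 * kernelConst * B * V * h)).comp_sub_left x
    refine (norm_integral_le_of_norm_le j3 ?_).trans ?_
    · filter_upwards [hB] with y hy
      rw [norm_smul, Real.norm_eq_abs]
      have hp : 0 < t + ‖x - y‖ := by positivity
      have hv' : ‖v x' - v y‖ ≤ V * (t + ‖x - y‖) ^ α := by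
        refine (hv.2 x' y).trans ?_
        gcongr
        calc ‖x' - y‖ = ‖(x - y) - (x - x')‖ := by congr 1; abel
          _ ≤ ‖x - y‖ + ‖x - x'‖ := norm_sub_le _ _
          _ ≤ t + ‖x - y‖ := by linarith
      have e : (t + ‖x - y‖) ^ (α - 3) = ((t + ‖x - y‖) ^ 3)⁻¹ * (t + ‖x - y‖) ^ α := by
        rw [Real.rpow_sub hp, div_eq_inv_mul]
        norm_num
      calc |b y| * ‖(nearD t (x - y) - nearD t (x' - y)) (v x' - v y)‖
          ≤ B * ((2 * kernelConst * h * ((t + ‖x - y‖) ^ 3)⁻¹) * (V * (t + ‖x - y‖) ^ α)) := by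
            refine mul_le_mul hy ?_ (norm_nonneg _) hB0
            refine (ContinuousLinearMap.le_opNorm _ _).trans ?_
            exact mul_le_mul (norm_nearD_sub_le ht1 hx.le h0 hht y) hv' (norm_nonneg _)
              (by positivity)
        _ = _ := by rw [e]; ring
    · rw [integral_sub_left_eq_self (fun z : Plane => 2 * kernelConst * B * V * h *
        (t + ‖z‖) ^ (α - 3)), integral_const_mul, j2]
      have e1 : t ^ (α - 3 + 2) ≤ h ^ (α - 3 + 2) :=
        Real.rpow_le_rpow_of_nonpos h0 hht (by linarith)
      have e2 : h ^ α = h * h ^ (α - 3 + 2) := by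
        rw [← Real.rpow_one_add' h0.le (by linarith)]
        congr 1
        ring
      rw [e2]
      generalize ∫ z : Plane, (1 + ‖z‖) ^ (α - 3) = I at hI' ⊢
      calc 2 * kernelConst * B * V * h * (t ^ (α - 3 + 2) * I)
          ≤ 2 * kernelConst * B * V * h * (h ^ (α - 3 + 2) * I) := by gcongr
        _ = _ := by ring
  rw [h2]
  exact (norm_add_le _ _).trans (add_le_add h3 h4)

/-- The commutator with a Hölder function maps to Hölder functions, uniformly in the
regularization, as soon as the regularized singular integrals of `b` are bounded. -/
theorem exists_holderBdd_comm (hα : 0 < α) (hα1 : α < 1) : ∃ C : ℝ, 0 ≤ C ∧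
    ∀ (b : Plane → ℝ) (v : Plane → Plane) (B V N : ℝ), LocallyIntegrable b volume →
      (∀ᵐ y, |b y| ≤ B) → HolderBdd α V v →
      (∀ t, 0 < t → t ≤ 1 → ∀ x, ‖∫ y, b y • nearD t (x - y)‖ ≤ N) →
      ∀ t, 0 < t → t ≤ 1 → HolderBdd α (C * (B + N) * V) (comm b v t) := by
  have hα2 : α < 2 := by linarith
  have hA := kernelConst_nonneg
  obtain ⟨c1, hc1⟩ : ∃ c1, c1 = 4 * Real.pi * kernelConst / α := ⟨_, rfl⟩
  have hc1' : 0 ≤ c1 := by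
    rw [hc1]
    positivity
  obtain ⟨I, hI⟩ : ∃ I, I = ∫ z : Plane, (1 + ‖z‖) ^ (α - 3) := ⟨_, rfl⟩
  have hI' : 0 ≤ I := by
    rw [hI]
    exact integral_nonneg fun z => by positivity
  refine ⟨4 * c1 + 1 + 2 * kernelConst * I, by positivity, ?_⟩
  intro b v B V N hb hB hv hN t ht ht1
  have hV := hv.nonneg
  have hvc := hv.continuous hα
  have hB0 : 0 ≤ B := by
    obtain ⟨y, hy⟩ := hB.exists
    exact (abs_nonneg _).trans hy
  have hN0 : 0 ≤ N := (norm_nonneg _).trans (hN 1 one_pos le_rfl 0)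
  have hloc : ∀ x x', ‖x - x'‖ ≤ 1 → ‖comm b v t x - comm b v t x'‖ ≤
      (2 * (B * V * c1) + N * V + 2 * kernelConst * B * V * I) * ‖x - x'‖ ^ α := by
    intro x x' hxx
    rcases eq_or_ne x x' with rfl | hne
    · rw [sub_self, norm_zero]
      positivity
    obtain ⟨h, hh⟩ : ∃ h, ‖x - x'‖ = h := ⟨_, rfl⟩
    have h0 : 0 < h := hh ▸ norm_pos_iff.2 (sub_ne_zero.2 hne)
    rw [hh] at hxx ⊢
    -- at scales below `h` the kernel may be replaced by the one regularized at the scale `h`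
    obtain ⟨τ, hτ⟩ : ∃ τ, τ = max t h := ⟨_, rfl⟩
    have hτ0 : 0 < τ := hτ ▸ ht.trans_le (le_max_left _ _)
    have hτ1 : τ ≤ 1 := hτ ▸ max_le ht1 hxx
    have hτh : h ≤ τ := hτ ▸ le_max_right _ _
    have h1 : ∀ z, ‖comm b v t z - comm b v τ z‖ ≤ B * V * c1 * h ^ α := fun z => by
      rcases le_total h t with hht | hht
      · rw [hτ, max_eq_left hht, sub_self, norm_zero]
        positivity
      · have := norm_comm_sub_le hα hα2 hb hB hvc hv.2 hV ht ht1 hτ0 hτ1 z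
        rw [max_eq_right hht] at hτ
        subst hτ
        rwa [← hc1, max_eq_right hht, ← mul_assoc] at this
    have h2 := norm_comm_sub_comm_le hα hα1 hb hB hv hτ0 hτ1 (hN τ hτ0 hτ1) h0 hh hτh
    rw [← hI] at h2
    calc ‖comm b v t x - comm b v t x'‖
        = ‖(comm b v t x - comm b v τ x) - (comm b v t x' - comm b v τ x') +
            (comm b v τ x - comm b v τ x')‖ := by congr 1; abel
      _ ≤ ‖comm b v t x - comm b v τ x‖ + ‖comm b v t x' - comm b v τ x'‖ +
            ‖comm b v τ x - comm b v τ x'‖ :=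
          (norm_add_le _ _).trans (add_le_add_left (norm_sub_le _ _) _)
      _ ≤ B * V * c1 * h ^ α + B * V * c1 * h ^ α +
            (N * (V * h ^ α) + 2 * kernelConst * B * V * I * h ^ α) :=
          add_le_add (add_le_add (h1 x) (h1 x')) h2
      _ = _ := by ring
  refine (HolderBdd.of_local hα
    (norm_comm_le hα hα2 hb hB hvc hv.2 hV ht ht1) hloc).mono ?_
  rw [← hc1, abs_of_nonneg (by positivity)]
  have e1 : 0 ≤ 4 * c1 * N * V := by positivity
  have e2 : 0 ≤ B * V := by positivity
  have e3 : 0 ≤ 2 * kernelConst * N * V * I := by positivity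
  linarith

end comm

/-! ### Regularized velocity fields -/

theorem continuous_kern (t : ℝ) : Continuous (kern t) := (contDiff_kern t).continuous

theorem norm_kern_le {t : ℝ} (ht : 0 < t) (x : Plane) : ‖kern t x‖ ≤ kernelConst * t⁻¹ := by
  rw [kern, norm_smul, norm_inv, Real.norm_of_nonneg ht.le, mul_comm]
  exact mul_le_mul_of_nonneg_right (norm_regKernel_le _) (by positivity)

theorem norm_kernD_le' {t : ℝ} (ht : 0 < t) (x : Plane) :
    ‖kernD t x‖ ≤ kernelConst * (t ^ 2)⁻¹ := by
  have := kernelConst_nonneg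
  refine (norm_kernD_le ht x).trans ?_
  gcongr
  linarith [norm_nonneg x]

theorem measurable_biotSavartKernel : Measurable biotSavartKernel := by
  have h : Measurable fun x : Plane => (2 * Real.pi * ‖x‖ ^ 2)⁻¹ := by fun_prop
  exact h.smul rot.continuous.measurable

theorem integrable_kern_sub {t : ℝ} (ht : 0 < t) :
    Integrable (fun x => kern t x - biotSavartKernel x) volume :=
  (integrable_indicator_norm_rpow one_pos t).mono'
    ((continuous_kern t).measurable.sub measurable_biotSavartKernel).aestronglyMeasurable
    (Filter.Eventually.of_forall (norm_kern_sub_le ht))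

/-- The velocity field of the vorticity `ω` for the regularized kernel. -/
def vel (t : ℝ) (ω : Plane → ℝ) (x : Plane) : Plane := ∫ y, ω y • kern t (x - y)

/-- The Jacobian matrix of the regularized velocity field. -/
def velD (t : ℝ) (ω : Plane → ℝ) (x : Plane) : Plane →L[ℝ] Plane := ∫ y, ω y • kernD t (x - y)

/-- The function `f` averaged against the approximate identity `mollifier t`. -/
def mollify {E : Type*} [NormedAddCommGroup E] [NormedSpace ℝ E] (t : ℝ) (f : Plane → E)
    (x : Plane) : E := ∫ y, mollifier t (x - y) • f y

section velocity

variable {ω : Plane → ℝ} {t B : ℝ}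

theorem integrable_smul_kern (hω : Integrable ω volume) (ht : 0 < t) (x : Plane) :
    Integrable (fun y => ω y • kern t (x - y)) volume :=
  hω.smul_bdd (kernelConst * t⁻¹)
    ((continuous_kern t).comp (continuous_const.sub continuous_id)).aestronglyMeasurable
    (Filter.Eventually.of_forall fun y => norm_kern_le ht (x - y))

theorem integrable_smul_kernD (hω : Integrable ω volume) (ht : 0 < t) (x : Plane) :
    Integrable (fun y => ω y • kernD t (x - y)) volume :=
  hω.smul_bdd (kernelConst * (t ^ 2)⁻¹)
    ((continuous_kernD t).comp (continuous_const.sub continuous_id)).aestronglyMeasurable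
    (Filter.Eventually.of_forall fun y => norm_kernD_le' ht (x - y))

theorem hasFDerivAt_vel (hω : Integrable ω volume) (ht : 0 < t) (x : Plane) :
    HasFDerivAt (vel t ω) (velD t ω x) x := by
  refine hasFDerivAt_integral_of_dominated_of_fderiv_le (s := univ)
    (F := fun x y => ω y • kern t (x - y)) (F' := fun x y => ω y • kernD t (x - y))
    (bound := fun y => |ω y| * (kernelConst * (t ^ 2)⁻¹)) Filter.univ_mem
    (Filter.Eventually.of_forall fun z => (integrable_smul_kern hω ht z).aestronglyMeasurable)
    (integrable_smul_kern hω ht x) (integrable_smul_kernD hω ht x).aestronglyMeasurable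
    (Filter.Eventually.of_forall fun y z _ => ?_) (hω.abs.mul_const _)
    (Filter.Eventually.of_forall fun y z _ => ?_)
  · rw [norm_smul, Real.norm_eq_abs]
    exact mul_le_mul_of_nonneg_left (norm_kernD_le' ht _) (abs_nonneg _)
  · have h : HasFDerivAt (kern t) (kernD t (z - y)) (z - y) :=
      (differentiable_kern t _).hasFDerivAt
    refine HasFDerivAt.const_smul ?_ (ω y)
    exact HasFDerivAt.comp (g := kern t) z h ((hasFDerivAt_id z).sub_const y)

theorem continuous_velD (hω : Integrable ω volume) (ht : 0 < t) : Continuous (velD t ω) := by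
  refine continuous_of_dominated (bound := fun y => |ω y| * (kernelConst * (t ^ 2)⁻¹))
    (fun x => (integrable_smul_kernD hω ht x).aestronglyMeasurable)
    (fun x => Filter.Eventually.of_forall fun y => ?_) (hω.abs.mul_const _)
    (Filter.Eventually.of_forall fun y => ?_)
  · rw [norm_smul, Real.norm_eq_abs]
    exact mul_le_mul_of_nonneg_left (norm_kernD_le' ht _) (abs_nonneg _)
  · have h : Continuous fun x => kernD t (x - y) :=
      (continuous_kernD t).comp (continuous_id.sub continuous_const)
    exact h.const_smul (ω y)

theorem continuous_vel (hω : Integrable ω volume) (ht : 0 < t) : Continuous (vel t ω) :=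
  continuous_iff_continuousAt.2 fun x => (hasFDerivAt_vel hω ht x).continuousAt

theorem norm_velD_le (hω : Integrable ω volume) (ht : 0 < t) (x : Plane) :
    ‖velD t ω x‖ ≤ kernelConst * (t ^ 2)⁻¹ * ∫ y, |ω y| := by
  rw [mul_comm, ← integral_mul_const]
  refine norm_integral_le_of_norm_le (hω.abs.mul_const _) (Filter.Eventually.of_forall fun y => ?_)
  rw [norm_smul, Real.norm_eq_abs]
  exact mul_le_mul_of_nonneg_left (norm_kernD_le' ht _) (abs_nonneg _)

theorem norm_vel_le (hω : Integrable ω volume) (ht : 0 < t) (x : Plane) :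
    ‖vel t ω x‖ ≤ kernelConst * t⁻¹ * ∫ y, |ω y| := by
  rw [mul_comm, ← integral_mul_const]
  refine norm_integral_le_of_norm_le (hω.abs.mul_const _) (Filter.Eventually.of_forall fun y => ?_)
  rw [norm_smul, Real.norm_eq_abs]
  exact mul_le_mul_of_nonneg_left (norm_kern_le ht _) (abs_nonneg _)

theorem divOp_velD (hω : Integrable ω volume) (ht : 0 < t) (x : Plane) :
    divOp (velD t ω x) = 0 := by
  rw [velD, ← ContinuousLinearMap.integral_comp_comm _ (integrable_smul_kernD hω ht x)]
  simp [divOp_kernD]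

theorem curlOp_velD (hω : Integrable ω volume) (ht : 0 < t) (x : Plane) :
    curlOp (velD t ω x) = mollify t ω x := by
  rw [velD, ← ContinuousLinearMap.integral_comp_comm _ (integrable_smul_kernD hω ht x)]
  simp [curlOp_kernD, mollify, mul_comm]

theorem norm_vel_sub_le (hω : Integrable ω volume) (hB : ∀ᵐ y, |ω y| ≤ B) (ht : 0 < t)
    (x : Plane) : ‖vel t ω x - biotSavart ω x‖ ≤ B * (2 * Real.pi * t) := by
  have h1 : Integrable (fun y => ω y • (kern t (x - y) - biotSavartKernel (x - y))) volume :=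
    ((integrable_kern_sub ht).comp_sub_left x).bdd_smul B hω.aestronglyMeasurable hB
  have h2 : Integrable (fun y => ω y • biotSavartKernel (x - y)) volume := by
    refine ((integrable_smul_kern hω ht x).sub h1).congr (Filter.Eventually.of_forall fun y => ?_)
    simp [smul_sub]
  have e : vel t ω x - biotSavart ω x =
      ∫ y, ω y • (kern t (x - y) - biotSavartKernel (x - y)) := by
    rw [vel, biotSavart, ← integral_sub (integrable_smul_kern hω ht x) h2]
    simp only [smul_sub]
  have h3 := ((integrable_indicator_norm_rpow one_pos t).const_mul B).comp_sub_left x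
  rw [e]
  refine (norm_integral_le_of_norm_le h3 ?_).trans (le_of_eq ?_)
  · filter_upwards [hB] with y hy
    rw [norm_smul]
    exact mul_le_mul hy (norm_kern_sub_le ht _) (norm_nonneg _) ((abs_nonneg _).trans hy)
  · rw [integral_sub_left_eq_self (fun z : Plane => B *
      (Iic t).indicator (fun r : ℝ => r ^ ((1 : ℝ) - 2)) ‖z‖), integral_const_mul,
      integral_indicator_norm_rpow one_pos ht.le]
    simp

/-! ### Hölder estimates for convolutions -/

/-- An integral whose integrand depends Lipschitz continuously on the parameter, with integrable
Lipschitz constants, is Hölder. -/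
theorem holderBdd_integral {F : Type*} [NormedAddCommGroup F] [NormedSpace ℝ F] {α A : ℝ}
    (hα : 0 < α) (hα1 : α ≤ 1) {Φ : Plane → Plane → F} {g : Plane → ℝ}
    (hA : 0 ≤ A) (hg : Integrable g volume) (hg0 : ∀ y, 0 ≤ g y)
    (hΦ : ∀ x, Integrable (Φ x) volume) (h1 : ∀ x y, ‖Φ x y‖ ≤ A * g y)
    (h2 : ∀ x x' y, ‖x - x'‖ ≤ 1 → ‖Φ x y - Φ x' y‖ ≤ A * ‖x - x'‖ * g y) :
    HolderBdd α (3 * (A * ∫ y, g y)) (fun x => ∫ y, Φ x y) := by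
  have hI : 0 ≤ ∫ y, g y := integral_nonneg hg0
  have b1 : ∀ x, ‖∫ y, Φ x y‖ ≤ A * ∫ y, g y := fun x => by
    rw [← integral_const_mul]
    exact norm_integral_le_of_norm_le (hg.const_mul A) (Filter.Eventually.of_forall (h1 x))
  refine (HolderBdd.of_local hα b1 (D := A * ∫ y, g y) fun x x' hx => ?_).mono ?_
  · rw [← integral_sub (hΦ x) (hΦ x')]
    calc ‖∫ y, (Φ x y - Φ x' y)‖ ≤ ∫ y, A * ‖x - x'‖ * g y :=
          norm_integral_le_of_norm_le (hg.const_mul _)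
            (Filter.Eventually.of_forall fun y => h2 x x' y hx)
      _ = (A * ∫ y, g y) * ‖x - x'‖ := by rw [integral_const_mul]; ring
      _ ≤ _ := by
        gcongr
        exact Real.self_le_rpow_of_le_one (norm_nonneg _) hx hα1
  · rw [abs_of_nonneg (by positivity)]
    linarith

theorem holderBdd_velD_one {α : ℝ} (hα : 0 < α) (hα1 : α ≤ 1) (hω : Integrable ω volume) :
    HolderBdd α (3 * (kernelConst * ∫ y, |ω y|)) (velD 1 ω) := by
  have hA := kernelConst_nonneg
  refine holderBdd_integral hα hα1 hA hω.abs (fun y => abs_nonneg _)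
    (integrable_smul_kernD hω one_pos) (fun x y => ?_) fun x x' y hx => ?_
  · rw [norm_smul, mul_comm, Real.norm_eq_abs]
    gcongr
    simpa using norm_kernD_le' one_pos (x - y)
  · have e0 : ω y • kernD 1 (x - y) - ω y • kernD 1 (x' - y) =
      ω y • (kernD 1 (x - y) - kernD 1 (x' - y)) := (smul_sub _ _ _).symm
    rw [e0, norm_smul, mul_comm, Real.norm_eq_abs]
    gcongr
    have e : x - y - (x' - y) = x - x' := by abel
    have := norm_kernD_sub_le one_pos (x := x - y) (y := x' - y) (by rwa [e])
    rw [e] at this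
    refine this.trans (mul_le_of_le_one_right (by positivity) (inv_le_one_of_one_le₀ ?_))
    exact one_le_pow₀ (by linarith [norm_nonneg (x - y)])

/-- The vector field `∫ DK_t(x - y) Z(y) dy`, that is, the regularized kernel applied to the
divergence of `Z`. -/
def velDiv (t : ℝ) (Z : Plane → Plane) (x : Plane) : Plane := ∫ y, kernD t (x - y) (Z y)

theorem integrable_kernD_apply {Z : Plane → Plane} (hZ : Integrable Z volume) (ht : 0 < t)
    (x : Plane) : Integrable (fun y => kernD t (x - y) (Z y)) volume := by
  refine (hZ.norm.const_mul (kernelConst * (t ^ 2)⁻¹)).mono'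
    (ContinuousLinearMap.aestronglyMeasurable_comp₂ (ContinuousLinearMap.id ℝ _)
      ((continuous_kernD t).comp (continuous_const.sub continuous_id)).aestronglyMeasurable
      hZ.aestronglyMeasurable) (Filter.Eventually.of_forall fun y => ?_)
  exact (ContinuousLinearMap.le_opNorm _ _).trans
    (mul_le_mul_of_nonneg_right (norm_kernD_le' ht _) (norm_nonneg _))

theorem holderBdd_velDiv_one {α : ℝ} (hα : 0 < α) (hα1 : α ≤ 1) {Z : Plane → Plane}
    (hZ : Integrable Z volume) : HolderBdd α (3 * (kernelConst * ∫ y, ‖Z y‖)) (velDiv 1 Z) := by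
  have hA := kernelConst_nonneg
  refine holderBdd_integral hα hα1 hA hZ.norm (fun y => norm_nonneg _)
    (integrable_kernD_apply hZ one_pos) (fun x y => ?_) fun x x' y hx => ?_
  · refine (ContinuousLinearMap.le_opNorm _ _).trans ?_
    gcongr
    simpa using norm_kernD_le' one_pos (x - y)
  · rw [← _root_.sub_apply]
    refine (ContinuousLinearMap.le_opNorm _ _).trans ?_
    gcongr
    have e : x - y - (x' - y) = x - x' := by abel
    have := norm_kernD_sub_le one_pos (x := x - y) (y := x' - y) (by rwa [e])
    rw [e] at this
    refine this.trans (mul_le_of_le_one_right (by positivity) (inv_le_one_of_one_le₀ ?_))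
    exact one_le_pow₀ (by linarith [norm_nonneg (x - y)])

/-- The gradient of the velocity regularized at the scale `h` grows at most like `h ^ (α - 1)`:
its kernel is at most a multiple of `h ^ (α - 1) * |x - y| ^ (-1 - α)` near the diagonal. -/
theorem norm_velD_le_rpow {α : ℝ} (hα : 0 < α) (hα1 : α < 1) (hω : Integrable ω volume)
    (hB : ∀ᵐ y, |ω y| ≤ B) {h : ℝ} (h0 : 0 < h) (h1 : h ≤ 1) (x : Plane) :
    ‖velD h ω x‖ ≤
      kernelConst * (B * (2 * Real.pi / (1 - α)) + ∫ y, |ω y|) * h ^ (α - 1) := by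
  have hA := kernelConst_nonneg
  have hα' : 0 < 1 - α := by linarith
  have hh : 1 ≤ h ^ (α - 1) := Real.one_le_rpow_of_pos_of_le_one_of_nonpos h0 h1 (by linarith)
  have i1 := ((integrable_indicator_norm_rpow hα' 1).const_mul B).comp_sub_left x
  have i2 := ((i1.add hω.abs).const_mul (kernelConst * h ^ (α - 1)))
  refine (norm_integral_le_of_norm_le i2 ?_).trans (le_of_eq ?_)
  · have hx : ∀ᵐ y : Plane, y ≠ x := by simp [ae_iff, measure_singleton]
    filter_upwards [hB, hx] with y hy hyx
    have hr : 0 < ‖x - y‖ := norm_pos_iff.2 (sub_ne_zero.2 hyx.symm)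
    have hk := norm_kernD_le h0 (x - y)
    rw [norm_smul, Real.norm_eq_abs, Pi.add_apply]
    have hB0 : 0 ≤ B := (abs_nonneg _).trans hy
    rw [indicator]
    split_ifs with hr1
    · have e1 : ((h + ‖x - y‖) ^ 2)⁻¹ ≤ h ^ (α - 1) * ‖x - y‖ ^ (1 - α - 2) := by
        have e2 : ((h + ‖x - y‖) ^ 2)⁻¹ =
            (h + ‖x - y‖) ^ (α - 1) * (h + ‖x - y‖) ^ (1 - α - 2) := by
          rw [← Real.rpow_add (by positivity), ← Real.rpow_natCast, ← Real.rpow_neg (by positivity)]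
          congr 1
          push_cast
          ring
        rw [e2]
        refine mul_le_mul ?_ ?_ (by positivity) (by positivity)
        · exact Real.rpow_le_rpow_of_nonpos h0 (by linarith) (by linarith)
        · exact Real.rpow_le_rpow_of_nonpos hr (by linarith) (by linarith)
      calc |ω y| * ‖kernD h (x - y)‖
          ≤ B * (kernelConst * (h ^ (α - 1) * ‖x - y‖ ^ (1 - α - 2))) := by
            gcongr
            exact hk.trans (by gcongr)
        _ ≤ B * (kernelConst * (h ^ (α - 1) * ‖x - y‖ ^ (1 - α - 2))) +
            kernelConst * h ^ (α - 1) * |ω y| := le_add_of_nonneg_right (by positivity)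
        _ = _ := by ring
    · rw [mul_zero, zero_add, mul_comm]
      gcongr
      refine hk.trans ?_
      gcongr
      refine (inv_le_one_of_one_le₀ (one_le_pow₀ ?_)).trans hh
      have : 1 < ‖x - y‖ := not_le.1 hr1
      linarith
  · simp only [Pi.add_apply]
    rw [integral_const_mul, integral_add i1 hω.abs,
      integral_sub_left_eq_self (fun z : Plane => B *
      (Iic 1).indicator (fun r : ℝ => r ^ (1 - α - 2)) ‖z‖), integral_const_mul,
      integral_indicator_norm_rpow hα' zero_le_one, Real.one_rpow]
    ring

/-- The velocity field of a bounded integrable vorticity is Hölder continuous. -/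
theorem exists_holderBdd_biotSavart {α : ℝ} (hα : 0 < α) (hα1 : α < 1) : ∃ C : ℝ, 0 ≤ C ∧
    ∀ (ω : Plane → ℝ) (B : ℝ), Integrable ω volume → (∀ᵐ y, |ω y| ≤ B) →
      HolderBdd α (C * (B + ∫ y, |ω y|)) (biotSavart ω) := by
  have hA := kernelConst_nonneg
  have hα' : 0 < 1 - α := by linarith
  refine ⟨2 * (kernelConst + 2 * Real.pi) + 4 * Real.pi +
    kernelConst * (2 * Real.pi / (1 - α) + 1), by positivity, fun ω B hω hB => ?_⟩
  have hB0 : 0 ≤ B := by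
    obtain ⟨y, hy⟩ := hB.exists
    exact (abs_nonneg _).trans hy
  obtain ⟨J, hJ⟩ : ∃ J, J = ∫ y, |ω y| := ⟨_, rfl⟩
  have hJ0 : 0 ≤ J := by
    rw [hJ]
    exact integral_nonneg fun y => abs_nonneg _
  have b1 : ∀ x, ‖biotSavart ω x‖ ≤ kernelConst * J + B * (2 * Real.pi) := fun x => by
    have h1 := norm_vel_le hω one_pos x
    have h2 := norm_vel_sub_le hω hB one_pos x
    rw [← hJ] at h1
    have h3 := norm_sub_le (vel 1 ω x) (vel 1 ω x - biotSavart ω x)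
    rw [sub_sub_cancel] at h3
    simp only [inv_one, mul_one] at h1 h2
    linarith
  have b2 : ∀ x x', ‖x - x'‖ ≤ 1 → ‖biotSavart ω x - biotSavart ω x'‖ ≤
      (4 * Real.pi * B + kernelConst * (B * (2 * Real.pi / (1 - α)) + J)) * ‖x - x'‖ ^ α := by
    intro x x' hx
    rcases eq_or_ne x x' with rfl | hne
    · rw [sub_self, norm_zero]
      positivity
    have h0 : 0 < ‖x - x'‖ := norm_pos_iff.2 (sub_ne_zero.2 hne)
    -- regularize at the scale given by the distance of the two points
    generalize hh : ‖x - x'‖ = h at h0 hx ⊢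
    have c1 := norm_vel_sub_le hω hB h0 x
    have c2 := norm_vel_sub_le hω hB h0 x'
    have c3 : ‖vel h ω x - vel h ω x'‖ ≤
        kernelConst * (B * (2 * Real.pi / (1 - α)) + J) * h ^ (α - 1) * h := by
      have := convex_univ.norm_image_sub_le_of_norm_hasFDerivWithin_le
        (fun z _ => (hasFDerivAt_vel hω h0 z).hasFDerivWithinAt)
        (fun z _ => norm_velD_le_rpow hα hα1 hω hB h0 hx z) (mem_univ x') (mem_univ x)
      rwa [hh, ← hJ] at this
    have c4 : h ^ (α - 1) * h = h ^ α := by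
      rw [← Real.rpow_add_one h0.ne']
      simp
    have c5 : h ≤ h ^ α := Real.self_le_rpow_of_le_one h0.le hx hα1.le
    calc ‖biotSavart ω x - biotSavart ω x'‖
        = ‖(vel h ω x' - biotSavart ω x') - (vel h ω x - biotSavart ω x) +
            (vel h ω x - vel h ω x')‖ := by congr 1; abel
      _ ≤ (‖vel h ω x' - biotSavart ω x'‖ + ‖vel h ω x - biotSavart ω x‖) +
            ‖vel h ω x - vel h ω x'‖ :=
          (norm_add_le _ _).trans (add_le_add_left (norm_sub_le _ _) _)
      _ ≤ (B * (2 * Real.pi * h) + B * (2 * Real.pi * h)) +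
            kernelConst * (B * (2 * Real.pi / (1 - α)) + J) * h ^ (α - 1) * h := by gcongr
      _ = 4 * Real.pi * B * h +
            kernelConst * (B * (2 * Real.pi / (1 - α)) + J) * (h ^ (α - 1) * h) := by ring
      _ ≤ 4 * Real.pi * B * h ^ α +
            kernelConst * (B * (2 * Real.pi / (1 - α)) + J) * (h ^ (α - 1) * h) := by gcongr
      _ = _ := by rw [c4]; ring
  refine (HolderBdd.of_local hα b1 b2).mono ?_
  rw [← hJ, abs_of_nonneg (by positivity)]
  have e1 : 0 ≤ kernelConst * B := by positivity
  have e2 : 0 ≤ Real.pi * J := by positivity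
  have e3 : 0 ≤ kernelConst * (2 * Real.pi / (1 - α)) * J := by positivity
  have e4 : 0 ≤ Real.pi * B := by positivity
  nlinarith

end velocity

/-! ### Passing to the limit in the regularization -/

/-- A sequence of regularization parameters in `(0, 1]` that tends to `0`. -/
def scale (n : ℕ) : ℝ := ((n : ℝ) + 1)⁻¹

theorem scale_pos (n : ℕ) : 0 < scale n := by
  rw [scale]
  positivity

theorem scale_le_one (n : ℕ) : scale n ≤ 1 := inv_le_one_of_one_le₀ (by simp)

theorem tendsto_scale : Filter.Tendsto scale Filter.atTop (nhds 0) :=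
  tendsto_inv_atTop_zero.comp (tendsto_natCast_atTop_atTop.atTop_add tendsto_const_nhds)

theorem integrable_mollifier_smul {E : Type*} [NormedAddCommGroup E] [NormedSpace ℝ E]
    {f : Plane → E} (hf : LocallyIntegrable f volume) {t : ℝ} (ht : 0 < t) (x : Plane) :
    Integrable (fun y => mollifier t (x - y) • f y) volume :=
  integrable_continuous_compact_smul (φ := fun y => mollifier t (x - y))
    ((contDiff_mollifier t).continuous.comp (continuous_const.sub continuous_id))
    (HasCompactSupport.intro (isCompact_closedBall x t) fun y hy => mollifier_of_lt ht <| by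
      rwa [Metric.mem_closedBall, not_le, dist_comm, dist_eq_norm] at hy) hf

theorem ae_tendsto_mollify {E : Type*} [NormedAddCommGroup E] [NormedSpace ℝ E] [CompleteSpace E]
    {f : Plane → E} (hf : LocallyIntegrable f volume) : ∀ᵐ x, Filter.Tendsto
      (fun n => mollify (scale n) f x) Filter.atTop (nhds (f x)) := by
  obtain ⟨P, hP⟩ := hasCompactSupport_bump.exists_bound_of_continuous contDiff_bump.continuous
  have hP0 : 0 ≤ P := (norm_nonneg _).trans (hP 0)
  filter_upwards [IsUnifLocDoublingMeasure.ae_tendsto_average_norm_sub volume hf 1] with x hx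
  have h1 := hx (l := Filter.atTop) (fun _ : ℕ => x) scale
    (tendsto_nhdsWithin_iff.2 ⟨tendsto_scale, Filter.Eventually.of_forall scale_pos⟩)
    (Filter.Eventually.of_forall fun n => by simpa using (scale_pos n).le)
  rw [tendsto_iff_norm_sub_tendsto_zero]
  have h2 := h1.const_mul (P * Real.pi)
  rw [mul_zero] at h2
  refine squeeze_zero (fun n => norm_nonneg _) (fun n => ?_) h2
  have ht := scale_pos n
  generalize scale n = t at ht
  have hi : IntegrableOn (fun y => ‖f y - f x‖) (Metric.closedBall x t) volume :=
    ((hf.integrableOn_isCompact (isCompact_closedBall x t)).sub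
      (integrableOn_const measure_closedBall_lt_top.ne)).norm
  have hconst : ∫ y, mollifier t (x - y) • f x = f x := by
    rw [integral_smul_const, integral_sub_left_eq_self (mollifier t), integral_mollifier ht,
      one_smul]
  have e : mollify t f x - f x = ∫ y, mollifier t (x - y) • (f y - f x) := by
    conv_lhs => rw [← hconst]
    rw [mollify, ← integral_sub (integrable_mollifier_smul hf ht x)
      (((integrable_mollifier ht).comp_sub_left x).smul_const _)]
    simp only [smul_sub]
  rw [e]
  refine (norm_integral_le_of_norm_le
    (g := (Metric.closedBall x t).indicator fun y => (t ^ 2)⁻¹ * P * ‖f y - f x‖)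
    ((integrable_indicator_iff Metric.isClosed_closedBall.measurableSet).2 (hi.const_mul _))
    (Filter.Eventually.of_forall fun y => ?_)).trans (le_of_eq ?_)
  · rw [indicator]
    split_ifs with hy
    · rw [norm_smul, mollifier, norm_mul, Real.norm_of_nonneg (by positivity)]
      gcongr
      exact hP _
    · rw [Metric.mem_closedBall, not_le, dist_comm, dist_eq_norm] at hy
      rw [mollifier_of_lt ht hy, zero_smul, norm_zero]
  · rw [integral_indicator Metric.isClosed_closedBall.measurableSet, integral_const_mul,
      setAverage_eq, smul_eq_mul, Measure.real, EuclideanSpace.volume_closedBall_fin_two]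
    have : (ENNReal.ofReal t ^ 2 * ENNReal.ofReal Real.pi).toReal = t ^ 2 * Real.pi := by
      simp [ht.le, Real.pi_pos.le]
    rw [this]
    field_simp

theorem norm_mollify_le {E : Type*} [NormedAddCommGroup E] [NormedSpace ℝ E] {f : Plane → E}
    {M : ℝ} {t : ℝ} (ht : 0 < t) (x : Plane) (hM : ∀ᵐ y, ‖x - y‖ ≤ t → ‖f y‖ ≤ M) :
    ‖mollify t f x‖ ≤ M := by
  have h1 := ((integrable_mollifier ht).comp_sub_left x).mul_const M
  refine (norm_integral_le_of_norm_le h1 ?_).trans (le_of_eq ?_)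
  · filter_upwards [hM] with y hy
    rw [norm_smul, Real.norm_of_nonneg (mollifier_nonneg _ _)]
    rcases le_or_gt ‖x - y‖ t with h | h
    · exact mul_le_mul_of_nonneg_left (hy h) (mollifier_nonneg _ _)
    · rw [mollifier_of_lt ht h, zero_mul, zero_mul]
  · rw [integral_mul_const, integral_sub_left_eq_self (mollifier t), integral_mollifier ht, one_mul]

theorem abs_mollify_le {f : Plane → ℝ} {B : ℝ} (hB : ∀ᵐ y, |f y| ≤ B) {t : ℝ} (ht : 0 < t)
    (x : Plane) : |mollify t f x| ≤ B := by
  rw [← Real.norm_eq_abs]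
  exact norm_mollify_le ht x (hB.mono fun _ h _ => h)

/-- Dominated convergence for the pairing with a fixed integrable field of linear forms. -/
theorem tendsto_integral_clm_apply {F : Type*} [NormedAddCommGroup F] [NormedSpace ℝ F]
    {w : Plane → F →L[ℝ] ℝ} (hw : Integrable w volume) {f : ℕ → Plane → F} {g : Plane → F} {M : ℝ}
    (hf : ∀ n, AEStronglyMeasurable (f n) volume) (hM : ∀ n, ∀ᵐ x, ‖f n x‖ ≤ M)
    (h : ∀ᵐ x, Filter.Tendsto (fun n => f n x) Filter.atTop (nhds (g x))) :
    Filter.Tendsto (fun n => ∫ x, w x (f n x)) Filter.atTop (nhds (∫ x, w x (g x))) := by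
  refine tendsto_integral_of_dominated_convergence (fun x => ‖w x‖ * M) (fun n => ?_)
    (hw.norm.mul_const M) (fun n => ?_) ?_
  · exact ContinuousLinearMap.aestronglyMeasurable_comp₂ (ContinuousLinearMap.id ℝ _)
      hw.aestronglyMeasurable (hf n)
  · filter_upwards [hM n] with x hx
    exact (ContinuousLinearMap.le_opNorm _ _).trans (by gcongr)
  · filter_upwards [h] with x hx
    exact ((w x).continuous.tendsto _).comp hx

theorem tendsto_integral_mul {w : Plane → ℝ} (hw : Integrable w volume) {f : ℕ → Plane → ℝ}
    {g : Plane → ℝ} {M : ℝ}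
    (hf : ∀ n, AEStronglyMeasurable (f n) volume) (hM : ∀ n, ∀ᵐ x, ‖f n x‖ ≤ M)
    (h : ∀ᵐ x, Filter.Tendsto (fun n => f n x) Filter.atTop (nhds (g x))) :
    Filter.Tendsto (fun n => ∫ x, w x * f n x) Filter.atTop (nhds (∫ x, w x * g x)) :=
  tendsto_integral_clm_apply (w := fun x => ContinuousLinearMap.mul ℝ ℝ (w x))
    ((ContinuousLinearMap.mul ℝ ℝ).integrable_comp hw) hf hM h

section test

variable {φ : Plane → ℝ}

theorem integrable_fderiv_test (h1 : ContDiff ℝ (⊤ : ℕ∞) φ) (h2 : HasCompactSupport φ) :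
    Integrable (fderiv ℝ φ) volume :=
  (h1.continuous_fderiv (by simp)).integrable_of_hasCompactSupport (h2.fderiv (𝕜 := ℝ))

theorem integrable_fderiv_apply (h1 : ContDiff ℝ (⊤ : ℕ∞) φ) (h2 : HasCompactSupport φ)
    {v : Plane → Plane} (hv : LocallyIntegrable v volume) :
    Integrable (fun x => fderiv ℝ φ x (v x)) volume := by
  have e : (fun x => fderiv ℝ φ x (v x)) =
      fun x => ∑ i, fderiv ℝ φ x (stdVec i) * v x i := by
    ext x
    conv_lhs => rw [eq_sum_stdVec (v x)]
    simp [mul_comm]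
  rw [e]
  exact integrable_finsetSum _ fun i _ =>
    integrable_fderiv_apply_mul h1 h2 (locallyIntegrable_apply hv i) _

/-- Integration by parts against a test function, for one coordinate of a vector field. -/
theorem integral_mul_fderiv_coord (h1 : ContDiff ℝ (⊤ : ℕ∞) φ) (h2 : HasCompactSupport φ)
    {u : Plane → Plane} {Du : Plane → Plane →L[ℝ] Plane} (hu : ∀ x, HasFDerivAt u (Du x) x)
    (hc : Continuous Du) (e : Plane) (i : Fin 2) :
    ∫ x, φ x * Du x e i = -∫ x, fderiv ℝ φ x e * u x i := by
  have huc : Continuous u := continuous_iff_continuousAt.2 fun x => (hu x).continuousAt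
  have hd : ∀ x, HasFDerivAt (fun x => u x i) ((coordL i).comp (Du x)) x := fun x =>
    (coordL i).hasFDerivAt.comp x (hu x)
  have hc1 : Continuous fun x => Du x e i :=
    (coordL i).continuous.comp (hc.clm_apply continuous_const)
  have hc2 : Continuous fun x => u x i := (coordL i).continuous.comp huc
  have h := integral_mul_fderiv_eq_neg_fderiv_mul_of_integrable (μ := volume) (f := φ)
    (g := fun x => u x i) (v := e)
    (integrable_fderiv_apply_mul h1 h2 hc2.locallyIntegrable e) ?_
    (integrable_continuous_compact_smul h1.continuous h2 hc2.locallyIntegrable)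
    (fun x _ => h1.differentiable (by simp) x) (fun x _ => (hd x).differentiableAt)
  · rw [← h]
    simp_rw [fun x => (hd x).fderiv]
    rfl
  · simp_rw [fun x => (hd x).fderiv]
    exact integrable_continuous_compact_smul h1.continuous h2 hc1.locallyIntegrable

theorem fderiv_apply_rot (φ : Plane → ℝ) (x v : Plane) :
    fderiv ℝ φ x (rot v) = fderiv ℝ φ x (stdVec 1) * v 0 - fderiv ℝ φ x (stdVec 0) * v 1 := by
  conv_lhs => rw [eq_sum_stdVec (rot v)]
  simp
  ring

theorem fderiv_apply_eq (φ : Plane → ℝ) (x v : Plane) :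
    fderiv ℝ φ x v = fderiv ℝ φ x (stdVec 0) * v 0 + fderiv ℝ φ x (stdVec 1) * v 1 := by
  conv_lhs => rw [eq_sum_stdVec v]
  simp
  ring

theorem integral_mul_curlOp (h1 : ContDiff ℝ (⊤ : ℕ∞) φ) (h2 : HasCompactSupport φ)
    {u : Plane → Plane} {Du : Plane → Plane →L[ℝ] Plane} (hu : ∀ x, HasFDerivAt u (Du x) x)
    (hc : Continuous Du) : ∫ x, φ x * curlOp (Du x) = ∫ x, fderiv ℝ φ x (rot (u x)) := by
  have huc : Continuous u := continuous_iff_continuousAt.2 fun x => (hu x).continuousAt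
  have i1 : ∀ (e : Plane) (i : Fin 2), Integrable (fun x => φ x * Du x e i) volume := fun e i =>
    integrable_continuous_compact_smul h1.continuous h2 (Continuous.locallyIntegrable
      ((coordL i).continuous.comp (hc.clm_apply continuous_const)))
  have i2 := fun (e : Plane) (i : Fin 2) => integrable_fderiv_apply_mul h1 h2
    (locallyIntegrable_apply (huc.locallyIntegrable (μ := volume)) i) e
  simp_rw [fderiv_apply_rot, curlOp_apply, mul_sub]
  rw [integral_sub (i1 (stdVec 0) 1) (i1 (stdVec 1) 0), integral_sub (i2 _ _) (i2 _ _),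
    integral_mul_fderiv_coord h1 h2 hu hc, integral_mul_fderiv_coord h1 h2 hu hc]
  ring

theorem integral_mul_divOp (h1 : ContDiff ℝ (⊤ : ℕ∞) φ) (h2 : HasCompactSupport φ)
    {u : Plane → Plane} {Du : Plane → Plane →L[ℝ] Plane} (hu : ∀ x, HasFDerivAt u (Du x) x)
    (hc : Continuous Du) : ∫ x, φ x * divOp (Du x) = -∫ x, fderiv ℝ φ x (u x) := by
  have huc : Continuous u := continuous_iff_continuousAt.2 fun x => (hu x).continuousAt
  have i1 : ∀ (e : Plane) (i : Fin 2), Integrable (fun x => φ x * Du x e i) volume := fun e i =>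
    integrable_continuous_compact_smul h1.continuous h2 (Continuous.locallyIntegrable
      ((coordL i).continuous.comp (hc.clm_apply continuous_const)))
  have i2 := fun (e : Plane) (i : Fin 2) => integrable_fderiv_apply_mul h1 h2
    (locallyIntegrable_apply (huc.locallyIntegrable (μ := volume)) i) e
  simp_rw [fun x => fderiv_apply_eq φ x (u x), divOp_apply, mul_add]
  rw [integral_add (i1 (stdVec 0) 0) (i1 (stdVec 1) 1), integral_add (i2 _ _) (i2 _ _),
    integral_mul_fderiv_coord h1 h2 hu hc, integral_mul_fderiv_coord h1 h2 hu hc]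
  ring

end test

/-! ### Divergence and curl of the velocity field -/

section biotSavart

variable {ω : Plane → ℝ} {B : ℝ} {φ : Plane → ℝ}

theorem continuous_mollify {g : Plane → ℝ} (hg : Integrable g volume) {t : ℝ} (ht : 0 < t) :
    Continuous (mollify t g) := by
  rw [show mollify t g = fun x => curlOp (velD t g x) from
    funext fun x => (curlOp_velD hg ht x).symm]
  exact curlOp.continuous.comp (continuous_velD hg ht)

theorem tendsto_vel (hω : Integrable ω volume) (hB : ∀ᵐ y, |ω y| ≤ B) (x : Plane) :
    Filter.Tendsto (fun n => vel (scale n) ω x) Filter.atTop (nhds (biotSavart ω x)) := by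
  rw [tendsto_iff_norm_sub_tendsto_zero]
  have h := (tendsto_scale.const_mul (2 * Real.pi)).const_mul B
  rw [mul_zero, mul_zero] at h
  exact squeeze_zero (fun n => norm_nonneg _)
    (fun n => norm_vel_sub_le hω hB (scale_pos n) x) h

theorem exists_norm_vel_le (hω : Integrable ω volume) (hB : ∀ᵐ y, |ω y| ≤ B) :
    ∃ M, ∀ n x, ‖vel (scale n) ω x‖ ≤ M := by
  obtain ⟨C, hC, h⟩ := exists_holderBdd_biotSavart (α := 1 / 2) (by norm_num) (by norm_num)
  refine ⟨C * (B + ∫ y, |ω y|) + B * (2 * Real.pi), fun n x => ?_⟩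
  have hB0 : 0 ≤ B := by
    obtain ⟨y, hy⟩ := hB.exists
    exact (abs_nonneg _).trans hy
  have h1 := (h ω B hω hB).1 x
  have h2 := norm_vel_sub_le hω hB (scale_pos n) x
  have h3 : B * (2 * Real.pi * scale n) ≤ B * (2 * Real.pi) :=
    mul_le_mul_of_nonneg_left (mul_le_of_le_one_right (by positivity) (scale_le_one n)) hB0
  have h4 := norm_add_le (vel (scale n) ω x - biotSavart ω x) (biotSavart ω x)
  rw [sub_add_cancel] at h4
  linarith

theorem continuous_biotSavart (hω : Integrable ω volume) (hB : ∀ᵐ y, |ω y| ≤ B) :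
    Continuous (biotSavart ω) := by
  obtain ⟨C, hC, h⟩ := exists_holderBdd_biotSavart (α := 1 / 2) (by norm_num) (by norm_num)
  exact (h ω B hω hB).continuous (by norm_num)

/-- The curl of the velocity field is the vorticity, in the sense of distributions. -/
theorem integral_fderiv_rot_biotSavart (hω : Integrable ω volume) (hB : ∀ᵐ y, |ω y| ≤ B)
    (h1 : ContDiff ℝ (⊤ : ℕ∞) φ) (h2 : HasCompactSupport φ) :
    ∫ x, fderiv ℝ φ x (rot (biotSavart ω x)) = ∫ x, φ x * ω x := by
  obtain ⟨M, hM⟩ := exists_norm_vel_le hω hB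
  have l1 := tendsto_integral_clm_apply (integrable_fderiv_test h1 h2) (M := M)
    (f := fun n x => rot (vel (scale n) ω x)) (g := fun x => rot (biotSavart ω x))
    (fun n => (rot.continuous.comp (continuous_vel hω (scale_pos n))).aestronglyMeasurable)
    (fun n => Filter.Eventually.of_forall fun x => by simpa using hM n x)
    (Filter.Eventually.of_forall fun x => (rot.continuous.tendsto _).comp (tendsto_vel hω hB x))
  have l2 := tendsto_integral_mul (h1.continuous.integrable_of_hasCompactSupport h2) (M := B)
    (f := fun n => mollify (scale n) ω) (g := ω)
    (fun n => (continuous_mollify hω (scale_pos n)).aestronglyMeasurable)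
    (fun n => Filter.Eventually.of_forall fun x => abs_mollify_le hB (scale_pos n) x)
    (ae_tendsto_mollify hω.locallyIntegrable)
  refine tendsto_nhds_unique l1 (l2.congr fun n => ?_)
  simp_rw [← curlOp_velD hω (scale_pos n)]
  exact integral_mul_curlOp h1 h2 (hasFDerivAt_vel hω (scale_pos n))
    (continuous_velD hω (scale_pos n))

/-- The velocity field is divergence free, in the sense of distributions. -/
theorem integral_fderiv_biotSavart (hω : Integrable ω volume) (hB : ∀ᵐ y, |ω y| ≤ B)
    (h1 : ContDiff ℝ (⊤ : ℕ∞) φ) (h2 : HasCompactSupport φ) :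
    ∫ x, fderiv ℝ φ x (biotSavart ω x) = 0 := by
  obtain ⟨M, hM⟩ := exists_norm_vel_le hω hB
  have l1 := tendsto_integral_clm_apply (integrable_fderiv_test h1 h2) (M := M)
    (f := fun n x => vel (scale n) ω x) (g := fun x => biotSavart ω x)
    (fun n => (continuous_vel hω (scale_pos n)).aestronglyMeasurable)
    (fun n => Filter.Eventually.of_forall fun x => hM n x)
    (Filter.Eventually.of_forall fun x => tendsto_vel hω hB x)
  refine tendsto_nhds_unique l1 (tendsto_const_nhds.congr fun n => ?_)
  have := integral_mul_divOp h1 h2 (hasFDerivAt_vel hω (scale_pos n))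
      (continuous_velD hω (scale_pos n))
  simp_rw [divOp_velD hω (scale_pos n)] at this
  simp only [mul_zero, integral_zero, zero_eq_neg] at this
  exact this.symm

end biotSavart

/-! ### Weak Jacobian matrices of the velocity field -/

/-- A bounded vector field without divergence and curl has vanishing derivative: its complex
conjugate is an entire function, to which Liouville's theorem applies. -/
theorem eq_zero_of_divOp_curlOp_eq_zero {D : Plane → Plane} {E : Plane → Plane →L[ℝ] Plane}
    (hD : ∀ x, HasFDerivAt D (E x) x) (hdiv : ∀ x, divOp (E x) = 0) (hcurl : ∀ x, curlOp (E x) = 0)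
    {M : ℝ} (hM : ∀ x, ‖D x‖ ≤ M) (x : Plane) : E x = 0 := by
  let p : ℂ →L[ℝ] Plane := Complex.reCLM.smulRight (stdVec 0) + Complex.imCLM.smulRight (stdVec 1)
  let q : Plane →L[ℝ] ℂ := (coordL 0).smulRight 1 - (coordL 1).smulRight Complex.I
  have hp : ∀ x : Plane, p (x 0 + x 1 * Complex.I) = x := fun x => by
    conv_rhs => rw [eq_sum_stdVec x]
    simp [p]
  have hq : ∀ x y : Plane, q x = q y → x = y := fun x y h => by
    have h0 := congrArg Complex.re h
    have h1 := congrArg Complex.im h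
    simp [q] at h0 h1
    ext i
    fin_cases i
    exacts [h0, h1]
  have hf : ∀ z, HasFDerivAt (fun z => q (D (p z))) (q.comp ((E (p z)).comp p)) z := fun z =>
    q.hasFDerivAt.comp z ((hD (p z)).comp z p.hasFDerivAt)
  have hdiff : Differentiable ℂ fun z => q (D (p z)) := fun z => by
    refine differentiableAt_complex_iff_differentiableAt_real.2 ⟨(hf z).differentiableAt, ?_⟩
    rw [(hf z).fderiv]
    have h1 := hdiv (p z)
    have h2 := hcurl (p z)
    rw [divOp_apply] at h1
    rw [curlOp_apply] at h2
    generalize E (p z) = A at h1 h2 ⊢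
    apply Complex.ext
    · simp [p, q]
      linarith
    · simp [p, q]
      linarith
  have hb : Bornology.IsBounded (range fun z => q (D (p z))) := by
    refine isBounded_iff_forall_norm_le.2 ⟨‖q‖ * M, ?_⟩
    rintro _ ⟨z, rfl⟩
    exact (q.le_opNorm _).trans (mul_le_mul_of_nonneg_left (hM _) (norm_nonneg _))
  have hconst : D = fun _ => D 0 := by
    ext1 y
    have := hdiff.apply_eq_apply_of_bounded hb (y 0 + y 1 * Complex.I) 0
    rw [hp, map_zero] at this
    exact hq _ _ this
  have h0 : HasFDerivAt D (0 : Plane →L[ℝ] Plane) x := by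
    rw [hconst]
    exact hasFDerivAt_const _ _
  exact (hD x).unique h0

theorem IsWeakJacobian.integral_mul {u : Plane → Plane} {G : Plane → Plane →L[ℝ] Plane}
    (h : IsWeakJacobian u G) {φ : Plane → ℝ} (h1 : ContDiff ℝ (⊤ : ℕ∞) φ)
    (h2 : HasCompactSupport φ) (i j : Fin 2) :
    ∫ x, φ x * G x (stdVec j) i = -∫ x, fderiv ℝ φ x (stdVec j) * u x i := by
  have hG : LocallyIntegrable (fun x => G x (stdVec j) i) volume := fun x => by
    obtain ⟨s, hs, hi⟩ := h.2.1 x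
    exact ⟨s, hs,
      ((coordL i).comp (ContinuousLinearMap.apply ℝ Plane (stdVec j))).integrable_comp hi⟩
  have e := congrArg (fun T : Dist => T (mkTest φ h1 h2)) (h.2.2 i j)
  simp only [lineDeriv_ofFun_apply (locallyIntegrable_apply h.1 i), ofFun_apply hG] at e
  exact e.symm

theorem locallyIntegrable_clm_comp {F F' : Type*} [NormedAddCommGroup F] [NormedSpace ℝ F]
    [NormedAddCommGroup F'] [NormedSpace ℝ F'] (L : F →L[ℝ] F') {f : Plane → F}
    (hf : LocallyIntegrable f volume) : LocallyIntegrable (fun x => L (f x)) volume := fun x => by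
  obtain ⟨s, hs, h⟩ := hf x
  exact ⟨s, hs, L.integrable_comp h⟩

section

variable {ω : Plane → ℝ} {B : ℝ} {G : Plane → Plane →L[ℝ] Plane}

theorem IsWeakJacobian.ae_divOp_eq (hω : Integrable ω volume) (hB : ∀ᵐ y, |ω y| ≤ B)
    (h : IsWeakJacobian (biotSavart ω) G) : ∀ᵐ x, divOp (G x) = 0 := by
  have hl := locallyIntegrable_clm_comp divOp h.2.1
  refine ae_eq_zero_of_integral_contDiff_smul_eq_zero hl fun φ h1 h2 => ?_
  have hu := (continuous_biotSavart hω hB).locallyIntegrable (μ := volume)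
  have i1 : ∀ i j : Fin 2, Integrable (fun x => φ x * G x (stdVec j) i) volume := fun i j =>
    integrable_continuous_compact_smul h1.continuous h2 (locallyIntegrable_clm_comp
      ((coordL i).comp (ContinuousLinearMap.apply ℝ Plane (stdVec j))) h.2.1)
  have i2 := fun (e : Plane) (i : Fin 2) => integrable_fderiv_apply_mul h1 h2
    (locallyIntegrable_apply hu i) e
  have e := integral_fderiv_biotSavart hω hB h1 h2
  simp_rw [fun x => fderiv_apply_eq φ x (biotSavart ω x)] at e
  rw [integral_add (i2 _ _) (i2 _ _)] at e
  simp_rw [smul_eq_mul, divOp_apply, mul_add]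
  rw [integral_add (i1 _ _) (i1 _ _), h.integral_mul h1 h2, h.integral_mul h1 h2]
  linarith

theorem IsWeakJacobian.ae_curlOp_eq (hω : Integrable ω volume) (hB : ∀ᵐ y, |ω y| ≤ B)
    (h : IsWeakJacobian (biotSavart ω) G) : ∀ᵐ x, curlOp (G x) = ω x := by
  have hl := locallyIntegrable_clm_comp curlOp h.2.1
  refine ae_eq_of_integral_contDiff_smul_eq hl hω.locallyIntegrable fun φ h1 h2 => ?_
  have hu := (continuous_biotSavart hω hB).locallyIntegrable (μ := volume)
  have i1 : ∀ i j : Fin 2, Integrable (fun x => φ x * G x (stdVec j) i) volume := fun i j =>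
    integrable_continuous_compact_smul h1.continuous h2 (locallyIntegrable_clm_comp
      ((coordL i).comp (ContinuousLinearMap.apply ℝ Plane (stdVec j))) h.2.1)
  have i2 := fun (e : Plane) (i : Fin 2) => integrable_fderiv_apply_mul h1 h2
    (locallyIntegrable_apply hu i) e
  have e := integral_fderiv_rot_biotSavart hω hB h1 h2
  simp_rw [fderiv_apply_rot] at e
  rw [integral_sub (i2 _ _) (i2 _ _)] at e
  simp_rw [smul_eq_mul, curlOp_apply, mul_sub]
  rw [integral_sub (i1 _ _) (i1 _ _), h.integral_mul h1 h2, h.integral_mul h1 h2]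
  linarith

theorem exists_hasFDerivAt_mollify {f : Plane → ℝ} (hf : LocallyIntegrable f volume) {t : ℝ}
    (ht : 0 < t) (x : Plane) : ∃ D : Plane →L[ℝ] ℝ, HasFDerivAt (mollify t f) D x ∧
      ∀ e, D e = ∫ y, fderiv ℝ (mollifier t) (x - y) e * f y := by
  have hP1 : ContDiff ℝ 1 (mollifier t) := (contDiff_mollifier t).of_le (by simp)
  have h1 := (hasCompactSupport_mollifier ht).hasFDerivAt_convolution_left
    (ContinuousLinearMap.mul ℝ ℝ) (μ := volume) hP1 hf x
  have e : convolution (mollifier t) f (ContinuousLinearMap.mul ℝ ℝ) volume = mollify t f := by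
    ext1 z
    rw [convolution_eq_swap]
    rfl
  rw [e] at h1
  refine ⟨_, h1, fun v => ?_⟩
  have hc : ConvolutionExistsAt (fderiv ℝ (mollifier t)) f x
      ((ContinuousLinearMap.mul ℝ ℝ).precompL Plane) volume :=
    ((hasCompactSupport_mollifier ht).fderiv (𝕜 := ℝ)).convolutionExists_left _
      (hP1.continuous_fderiv one_ne_zero) hf x
  rw [convolution_eq_swap, ContinuousLinearMap.integral_apply hc.integrable_swap]
  rfl

theorem IsWeakJacobian.hasFDerivAt_mollify {u : Plane → Plane} (h : IsWeakJacobian u G) {t : ℝ}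
    (ht : 0 < t) (x : Plane) : HasFDerivAt (mollify t u) (mollify t G x) x := by
  rw [← hasFDerivWithinAt_univ, hasFDerivWithinAt_euclidean]
  refine fun i => hasFDerivWithinAt_univ.2 ?_
  have e : (fun x => mollify t u x i) = mollify t fun x => u x i := by
    ext z
    exact ((coordL i).integral_comp_comm (integrable_mollifier_smul h.1 ht z)).symm
  obtain ⟨D, hD, hDe⟩ := exists_hasFDerivAt_mollify (locallyIntegrable_apply h.1 i) ht x
  rw [e]
  refine hD.congr_fderiv ?_
  have hφ1 : ContDiff ℝ (⊤ : ℕ∞) fun y => mollifier t (x - y) :=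
    (contDiff_mollifier t).comp (contDiff_const.sub contDiff_id)
  have hφ2 : HasCompactSupport fun y => mollifier t (x - y) :=
    HasCompactSupport.intro (isCompact_closedBall x t) fun y hy => mollifier_of_lt ht <| by
      rwa [Metric.mem_closedBall, not_le, dist_comm, dist_eq_norm] at hy
  have hφ3 : ∀ y, fderiv ℝ (fun y => mollifier t (x - y)) y = -fderiv ℝ (mollifier t) (x - y) :=
    fun y => by
      have := ((contDiff_mollifier t).differentiable (by simp) (x - y)).hasFDerivAt.comp y
        ((hasFDerivAt_id y).const_sub x)
      refine this.fderiv.trans ?_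
      ext1 v
      simp
  have hcomp : ∀ j, D (stdVec j) = mollify t G x (stdVec j) i := fun j => by
    let L : (Plane →L[ℝ] Plane) →L[ℝ] ℝ :=
      (coordL i).comp (ContinuousLinearMap.apply ℝ Plane (stdVec j))
    have e2 : ∫ y, L (mollifier t (x - y) • G y) = L (mollify t G x) :=
      L.integral_comp_comm (integrable_mollifier_smul h.2.1 ht x)
    have e3 := h.integral_mul hφ1 hφ2 i j
    simp_rw [hφ3, _root_.neg_apply, neg_mul, integral_neg, neg_neg] at e3
    rw [hDe, ← e3]
    exact e2
  ext1 v
  conv_lhs => rw [eq_sum_stdVec v]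
  conv_rhs => rw [eq_sum_stdVec v]
  rw [map_sum, map_sum]
  refine Finset.sum_congr rfl fun j _ => ?_
  rw [map_smul, map_smul, hcomp]
  rfl

/-- The Jacobian matrix of the regularized velocity is the mollified weak Jacobian matrix of the
velocity. -/
theorem IsWeakJacobian.velD_eq (hω : Integrable ω volume) (hB : ∀ᵐ y, |ω y| ≤ B)
    (h : IsWeakJacobian (biotSavart ω) G) {t : ℝ} (ht : 0 < t) (x : Plane) :
    velD t ω x = mollify t G x := by
  obtain ⟨C, hC, hu⟩ := exists_holderBdd_biotSavart (α := 1 / 2) (by norm_num) (by norm_num)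
  have hu := (hu ω B hω hB).1
  refine (sub_eq_zero.1 (eq_zero_of_divOp_curlOp_eq_zero
    (D := fun x => mollify t (biotSavart ω) x - vel t ω x)
    (E := fun x => mollify t G x - velD t ω x)
    (fun x => (h.hasFDerivAt_mollify ht x).sub (hasFDerivAt_vel hω ht x))
    (fun z => ?_) (fun z => ?_) (fun z => (norm_sub_le _ _).trans (add_le_add
      (norm_mollify_le ht z (Filter.Eventually.of_forall fun y _ => hu y))
      (norm_vel_le hω ht z))) x)).symm
  · rw [map_sub, divOp_velD hω ht, sub_zero, mollify,
      ← ContinuousLinearMap.integral_comp_comm _ (integrable_mollifier_smul h.2.1 ht z)]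
    refine integral_eq_zero_of_ae ?_
    filter_upwards [h.ae_divOp_eq hω hB] with y hy
    simp [hy]
  · rw [map_sub, curlOp_velD hω ht, mollify,
      ← ContinuousLinearMap.integral_comp_comm _ (integrable_mollifier_smul h.2.1 ht z),
      sub_eq_zero, mollify]
    refine integral_congr_ae ?_
    filter_upwards [h.ae_curlOp_eq hω hB] with y hy
    simp [hy]

/-- A bounded limit of the Jacobian matrices of the regularized velocities is the weak Jacobian
matrix of the velocity. -/
theorem isWeakJacobian_of_tendsto (hω : Integrable ω volume) (hB : ∀ᵐ y, |ω y| ≤ B) {M : ℝ}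
    (hM : ∀ n x, ‖velD (scale n) ω x‖ ≤ M) (hG : AEStronglyMeasurable G volume)
    (h : ∀ᵐ x, Filter.Tendsto (fun n => velD (scale n) ω x) Filter.atTop (nhds (G x))) :
    IsWeakJacobian (biotSavart ω) G := by
  have hGM : ∀ᵐ x, ‖G x‖ ≤ M := by
    filter_upwards [h] with x hx
    exact le_of_tendsto' hx.norm fun n => hM n x
  have hu := (continuous_biotSavart hω hB).locallyIntegrable (μ := volume)
  have hGl : LocallyIntegrable G volume :=
    (memLp_top_of_bound hG M hGM).locallyIntegrable le_top
  refine ⟨hu, hGl, fun i j => ?_⟩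
  let L : (Plane →L[ℝ] Plane) →L[ℝ] ℝ :=
    (coordL i).comp (ContinuousLinearMap.apply ℝ Plane (stdVec j))
  ext φ
  have h1 := φ.contDiff
  have h2 := φ.hasCompactSupport
  have hGj : LocallyIntegrable (fun x => G x (stdVec j) i) volume :=
    locallyIntegrable_clm_comp L hGl
  rw [lineDeriv_ofFun_apply (locallyIntegrable_apply hu i), ofFun_apply hGj]
  obtain ⟨N, hN⟩ := exists_norm_vel_le hω hB
  have hw : Integrable (fun x => fderiv ℝ φ x (stdVec j)) volume :=
    ((h1.continuous_fderiv (by simp)).clm_apply continuous_const).integrable_of_hasCompactSupport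
      (h2.fderiv_apply (𝕜 := ℝ) _)
  have l1 := tendsto_integral_mul hw (M := N)
    (f := fun n x => vel (scale n) ω x i) (g := fun x => biotSavart ω x i)
    (fun n => ((coordL i).continuous.comp (continuous_vel hω (scale_pos n))).aestronglyMeasurable)
    (fun n => Filter.Eventually.of_forall fun x =>
      (abs_coord_le _ i).trans (hN n x))
    (Filter.Eventually.of_forall fun x => ((coordL i).continuous.tendsto _).comp
      (tendsto_vel hω hB x))
  have l2 := tendsto_integral_mul (φ.continuous.integrable_of_hasCompactSupport h2) (M := ‖L‖ * M)
    (f := fun n x => L (velD (scale n) ω x)) (g := fun x => L (G x))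
    (fun n => (L.continuous.comp (continuous_velD hω (scale_pos n))).aestronglyMeasurable)
    (fun n => Filter.Eventually.of_forall fun x => (L.le_opNorm _).trans
      (mul_le_mul_of_nonneg_left (hM n x) (norm_nonneg _)))
    (by filter_upwards [h] with x hx using (L.continuous.tendsto _).comp hx)
  refine tendsto_nhds_unique l1.neg (l2.congr fun n => ?_)
  exact integral_mul_fderiv_coord h1 h2 (hasFDerivAt_vel hω (scale_pos n))
    (continuous_velD hω (scale_pos n)) (stdVec j) i

end

/-! ### Cancellation and the compactly supported part of the kernel -/

/-- The compactly supported part of the kernel `kern t`. -/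
def nearK (t : ℝ) (z : Plane) : Plane := kern t z - kern 1 z

theorem contDiff_nearK (t : ℝ) : ContDiff ℝ (⊤ : ℕ∞) (nearK t) :=
  (contDiff_kern t).sub (contDiff_kern 1)

theorem nearK_of_lt {t : ℝ} (ht : 0 < t) (ht1 : t ≤ 1) {z : Plane} (hz : 1 < ‖z‖) :
    nearK t z = 0 := by
  rw [nearK, kern_of_le ht (ht1.trans hz.le), kern_of_le one_pos hz.le, sub_self]

theorem hasFDerivAt_nearK (t : ℝ) (z : Plane) : HasFDerivAt (nearK t) (nearD t z) z :=
  (differentiable_kern t z).hasFDerivAt.sub (differentiable_kern 1 z).hasFDerivAt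

theorem hasCompactSupport_nearK_sub {t : ℝ} (ht : 0 < t) (ht1 : t ≤ 1) (x : Plane) (i : Fin 2) :
    HasCompactSupport fun y => nearK t (x - y) i :=
  HasCompactSupport.intro (isCompact_closedBall x 1) fun y hy => by
    rw [Metric.mem_closedBall, not_le, dist_comm, dist_eq_norm] at hy
    rw [nearK_of_lt ht ht1 hy]
    rfl

theorem contDiff_nearK_sub (t : ℝ) (x : Plane) (i : Fin 2) :
    ContDiff ℝ (⊤ : ℕ∞) fun y => nearK t (x - y) i :=
  (coordL i).contDiff.comp ((contDiff_nearK t).comp (contDiff_const.sub contDiff_id))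

theorem fderiv_nearK_sub (t : ℝ) (x y e : Plane) (i : Fin 2) :
    fderiv ℝ (fun y => nearK t (x - y) i) y e = -(nearD t (x - y) e i) := by
  have h : HasFDerivAt (fun y => nearK t (x - y)) ((nearD t (x - y)).comp
      (-ContinuousLinearMap.id ℝ Plane)) y :=
    (hasFDerivAt_nearK t (x - y)).comp y ((hasFDerivAt_id y).const_sub x)
  have h2 : HasFDerivAt (fun y => nearK t (x - y) i) _ y := (coordL i).hasFDerivAt.comp y h
  rw [h2.fderiv]
  simp

theorem integrable_nearK {t : ℝ} (ht : 0 < t) : Integrable (nearK t) volume := by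
  refine ((integrable_kern_sub ht).sub (integrable_kern_sub one_pos)).congr
    (Filter.Eventually.of_forall fun z => ?_)
  simp [nearK]

theorem integral_norm_kern_sub_le {t : ℝ} (ht : 0 < t) :
    ∫ x, ‖kern t x - biotSavartKernel x‖ ≤ 2 * Real.pi * t := by
  refine (integral_mono (integrable_kern_sub ht).norm (integrable_indicator_norm_rpow one_pos t)
    (norm_kern_sub_le ht)).trans (le_of_eq ?_)
  rw [integral_indicator_norm_rpow one_pos ht.le]
  simp

theorem integral_norm_nearK_sub_le {t s : ℝ} (ht : 0 < t) (hs : 0 < s) :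
    ∫ x, ‖nearK t x - nearK s x‖ ≤ 4 * Real.pi * max t s := by
  have i1 := (integrable_kern_sub ht).norm
  have i2 := (integrable_kern_sub hs).norm
  calc ∫ x, ‖nearK t x - nearK s x‖
      ≤ ∫ x, (‖kern t x - biotSavartKernel x‖ + ‖kern s x - biotSavartKernel x‖) := by
        refine integral_mono ((integrable_nearK ht).sub (integrable_nearK hs)).norm (i1.add i2)
          fun x => ?_
        have e : nearK t x - nearK s x =
            (kern t x - biotSavartKernel x) - (kern s x - biotSavartKernel x) := by
          simp [nearK]
        simp only [e]
        exact norm_sub_le _ _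
    _ ≤ 2 * Real.pi * t + 2 * Real.pi * s := by
        rw [integral_add i1 i2]
        exact add_le_add (integral_norm_kern_sub_le ht) (integral_norm_kern_sub_le hs)
    _ ≤ 2 * Real.pi * max t s + 2 * Real.pi * max t s := by
        gcongr
        exacts [le_max_left _ _, le_max_right _ _]
    _ = _ := by ring

theorem nearK_one (z : Plane) : nearK 1 z = 0 := sub_self _

/-- The derivative of a compactly supported kernel has mean zero. -/
theorem integral_nearD {t : ℝ} (ht : 0 < t) (ht1 : t ≤ 1) (x : Plane) :
    ∫ y, nearD t (x - y) = 0 := by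
  have hint : Integrable (fun y => nearD t (x - y)) volume :=
    ((continuous_nearD t).comp
      (continuous_const.sub continuous_id)).integrable_of_hasCompactSupport
      (hasCompactSupport_nearD_sub ht ht1 x)
  ext e i
  rw [ContinuousLinearMap.integral_apply hint]
  have hint2 : Integrable (fun y => nearD t (x - y) e) volume := hint.apply_continuousLinearMap e
  have h2 : ∫ y, nearD t (x - y) e i = coordL i (∫ y, nearD t (x - y) e) :=
    (coordL i).integral_comp_comm hint2
  refine h2.symm.trans ?_
  have h1 := contDiff_nearK_sub t x i
  have h3 := integral_mul_fderiv_eq_neg_fderiv_mul_of_integrable (μ := volume) (v := e)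
    (f := fun _ : Plane => (1 : ℝ)) (g := fun y => nearK t (x - y) i) (by simp) ?_ ?_
    (fun _ _ => differentiableAt_const _) (fun y _ => h1.differentiable (by simp) y)
  · simp only [fderiv_nearK_sub, mul_neg, one_mul, fderiv_fun_const, Pi.zero_apply,
      _root_.zero_apply, zero_mul, integral_zero, neg_zero, integral_neg, neg_eq_zero] at h3
    simpa using h3
  · simp only [fderiv_nearK_sub, mul_neg, one_mul]
    exact ((coordL i).integrable_comp hint2).neg
  · simpa using h1.continuous.integrable_of_hasCompactSupport
      (hasCompactSupport_nearK_sub ht ht1 x i)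

/-- Since the kernel has mean zero, its singular integral against `ω` sees only `ω y - ω x`, and
converges at points `x` where `ω` is Hölder. -/
theorem norm_integral_smul_nearD_sub_le {α : ℝ} (hα : 0 < α) (hα2 : α < 2) {ω : Plane → ℝ}
    (hω : LocallyIntegrable ω volume) {M : ℝ} (hM : 0 ≤ M) {x : Plane}
    (h : ∀ᵐ y, |ω y - ω x| ≤ M * ‖x - y‖ ^ α) {t s : ℝ} (ht : 0 < t) (ht1 : t ≤ 1) (hs : 0 < s)
    (hs1 : s ≤ 1) : ‖(∫ y, ω y • nearD t (x - y)) - ∫ y, ω y • nearD s (x - y)‖ ≤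
      M * (4 * Real.pi * kernelConst / α * max t s ^ α) := by
  have hc : ∀ r, 0 < r → r ≤ 1 → Integrable (fun y => ω x • nearD r (x - y)) volume :=
    fun r h0 h1 => integrable_smul_nearD (b := fun _ => ω x) (locallyIntegrable_const _) h0 h1 x
  have e : ∀ r, 0 < r → r ≤ 1 → ∫ y, ω y • nearD r (x - y) =
      ∫ y, (ω y • nearD r (x - y) - ω x • nearD r (x - y)) := fun r h0 h1 => by
    rw [integral_sub (integrable_smul_nearD hω h0 h1 x) (hc r h0 h1), integral_smul,
      integral_nearD h0 h1, smul_zero, sub_zero]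
  have hi : ∀ r, 0 < r → r ≤ 1 →
      Integrable (fun y => ω y • nearD r (x - y) - ω x • nearD r (x - y)) volume := fun r h0 h1 =>
    (integrable_smul_nearD hω h0 h1 x).sub (hc r h0 h1)
  rw [e t ht ht1, e s hs hs1, ← integral_sub (hi t ht ht1) (hi s hs hs1)]
  refine norm_integral_kernD_sub_le hα hα2 ht hs hM x ?_
  filter_upwards [h] with y hy
  have e2 : ω y • nearD t (x - y) - ω x • nearD t (x - y) -
      (ω y • nearD s (x - y) - ω x • nearD s (x - y)) =
      (ω y - ω x) • (kernD t (x - y) - kernD s (x - y)) := by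
    ext1 v
    simp [nearD, sub_smul, smul_sub]
    abel
  rw [e2, norm_smul, Real.norm_eq_abs]
  calc |ω y - ω x| * ‖kernD t (x - y) - kernD s (x - y)‖
      ≤ (M * ‖x - y‖ ^ α) * ‖kernD t (x - y) - kernD s (x - y)‖ := by gcongr
    _ = _ := by ring

section

variable {α : ℝ} {ω : Plane → ℝ} {B : ℝ}

theorem velD_eq_add (hω : Integrable ω volume) {t : ℝ} (ht : 0 < t) (x : Plane) :
    velD t ω x = velD 1 ω x + ∫ y, ω y • nearD t (x - y) := by
  rw [← sub_eq_iff_eq_add', velD, velD, ← integral_sub (integrable_smul_kernD hω ht x)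
    (integrable_smul_kernD hω one_pos x)]
  congr 1
  ext1 y
  exact (smul_sub _ _ _).symm

/-- At a distance from `S` the regularized velocity gradients form a Cauchy family, because there
the vorticity is Hölder at small scales and bounded at large scales. -/
theorem exists_norm_velD_sub_le_of_notMem (hα : 0 < α) (hα1 : α < 1) (hω : Integrable ω volume)
    (hB : ∀ᵐ y, |ω y| ≤ B) {S : Set Plane} {M : ℝ} (hM1 : ∀ x ∈ Sᶜ, |ω x| ≤ M)
    (hM2 : ∀ x y, segment ℝ x y ⊆ Sᶜ → |ω x - ω y| ≤ M * ‖x - y‖ ^ α) {δ : ℝ} (hδ : 0 < δ) :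
    ∃ C, 0 ≤ C ∧ ∀ x ∉ Metric.thickening δ S, ∀ t s, 0 < t → t ≤ 1 → 0 < s → s ≤ 1 →
      ‖velD t ω x - velD s ω x‖ ≤ C * max t s ^ α := by
  have hA := kernelConst_nonneg
  have hB0 : 0 ≤ B := by
    obtain ⟨y, hy⟩ := hB.exists
    exact (abs_nonneg _).trans hy
  have hα2 : α < 2 := by linarith
  refine ⟨(|M| + (B + |M|) / δ ^ α) * (4 * Real.pi * kernelConst / α), by positivity,
    fun x hx t s ht ht1 hs hs1 => ?_⟩
  have hxS : x ∈ Sᶜ := fun h => hx (Metric.self_subset_thickening hδ S h)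
  rw [velD_eq_add hω ht, velD_eq_add hω hs, add_sub_add_left_eq_sub, mul_assoc]
  refine norm_integral_smul_nearD_sub_le hα hα2 hω.locallyIntegrable (by positivity) ?_
    ht ht1 hs hs1
  filter_upwards [hB] with y hy
  rcases lt_or_ge ‖x - y‖ δ with h | h
  · have hseg : segment ℝ y x ⊆ Sᶜ := fun z hz hzS => hx <| by
      refine Metric.mem_thickening_iff.2 ⟨z, hzS, ?_⟩
      rw [segment_symm] at hz
      have := norm_sub_le_of_mem_segment hz
      rw [dist_comm, dist_eq_norm]
      rw [norm_sub_rev y x] at this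
      exact this.trans_lt h
    refine (hM2 y x hseg).trans ?_
    rw [norm_sub_rev]
    gcongr
    exact (le_abs_self M).trans (le_add_of_nonneg_right (by positivity))
  · have h1 : |ω y - ω x| ≤ B + |M| :=
      (abs_sub _ _).trans (add_le_add hy ((hM1 x hxS).trans (le_abs_self M)))
    have h2 : 1 ≤ ‖x - y‖ ^ α / δ ^ α := by
      rw [one_le_div (by positivity)]
      gcongr
    calc |ω y - ω x| ≤ (B + |M|) * (‖x - y‖ ^ α / δ ^ α) :=
          h1.trans (le_mul_of_one_le_right (by positivity) h2)
      _ = (B + |M|) / δ ^ α * ‖x - y‖ ^ α := by ring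
      _ ≤ _ := by
        gcongr
        exact le_add_of_nonneg_left (abs_nonneg M)

/-- The derivative of the velocity along `Y` splits into a smooth part, a singular integral of
the divergence of `ω Y`, and a commutator. -/
theorem velD_apply_eq {Y : Plane → Plane} (hY : Continuous Y) (hω : Integrable ω volume) {t : ℝ}
    (ht : 0 < t) (ht1 : t ≤ 1) (x : Plane) : velD t ω x (Y x) =
      velD 1 ω x (Y x) + (∫ y, ω y • nearD t (x - y) (Y y)) + comm ω Y t x := by
  have i1 := integrable_nearD_apply hω.locallyIntegrable ht ht1 x hY
  have i2 := integrable_nearD_apply hω.locallyIntegrable ht ht1 x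
    (w := fun y => Y x - Y y) (continuous_const.sub hY)
  rw [velD_eq_add hω ht, _root_.add_apply, add_assoc, comm, ← integral_add i1 i2,
    ContinuousLinearMap.integral_apply (integrable_smul_nearD hω.locallyIntegrable ht ht1 x)]
  congr 2
  ext1 y
  rw [_root_.smul_apply, map_sub, smul_sub]
  abel

theorem velDiv_sub_eq {Y : Plane → Plane} (hZ : Integrable (fun x => ω x • Y x) volume)
    {t : ℝ} (ht : 0 < t) (x : Plane) : velDiv t (fun x => ω x • Y x) x -
      velDiv 1 (fun x => ω x • Y x) x = ∫ y, ω y • nearD t (x - y) (Y y) := by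
  rw [velDiv, velDiv, ← integral_sub (integrable_kernD_apply hZ ht x)
    (integrable_kernD_apply hZ one_pos x)]
  congr 1
  ext1 y
  simp [nearD, smul_sub]

/-- Schauder estimate: if `div Z = f + div v` with `f` and `v` Hölder, then the regularized
singular integrals of `div Z` are Hölder, uniformly in the regularization, and converge. -/
theorem exists_holderBdd_of_divDist_eq (hα : 0 < α) (hα1 : α < 1) : ∃ C : ℝ, 0 ≤ C ∧
    ∀ (ω : Plane → ℝ) (Y v : Plane → Plane) (f : Plane → ℝ) (N : ℝ),
      LocallyIntegrable ω volume → Continuous Y →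
      LocallyIntegrable (fun x => ω x • Y x) volume →
      divDist (fun x => ω x • Y x) = ofFun f + divDist v → HolderBdd α N f → HolderBdd α N v →
      (∀ t, 0 < t → t ≤ 1 →
        HolderBdd α (C * N) fun x => ∫ y, ω y • nearD t (x - y) (Y y)) ∧
      ∀ t s, 0 < t → t ≤ 1 → 0 < s → s ≤ 1 → ∀ x,
        ‖(∫ y, ω y • nearD t (x - y) (Y y)) - ∫ y, ω y • nearD s (x - y) (Y y)‖ ≤
          C * N * max t s ^ α := by
  have hA := kernelConst_nonneg
  have hα2 : α < 2 := by linarith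
  obtain ⟨C0, hC0, hcomm⟩ := exists_holderBdd_comm hα hα1
  refine ⟨4 * Real.pi + C0 + 4 * Real.pi * kernelConst / α, by positivity, ?_⟩
  intro ω Y v f N hω hY hZ hdiv hf hv
  have hN := hf.nonneg
  have hfc := hf.continuous hα
  have hvc := hv.continuous hα
  have h1 : LocallyIntegrable (fun _ : Plane => (1 : ℝ)) volume := locallyIntegrable_const _
  have hfi : ∀ r, 0 < r → ∀ x, Integrable (fun z => f (x - z) • nearK r z) volume :=
    fun r hr x => (integrable_nearK hr).bdd_smul N
      (hfc.comp (continuous_const.sub continuous_id)).aestronglyMeasurable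
      (Filter.Eventually.of_forall fun z => hf.1 _)
  have key : ∀ t, 0 < t → t ≤ 1 → ∀ x, ∫ y, ω y • nearD t (x - y) (Y y) =
      (∫ z, f (x - z) • nearK t z) - comm (fun _ => 1) v t x := by
    intro t ht ht1 x
    have hcm : comm (fun _ => 1) v t x = -∫ y, nearD t (x - y) (v y) := by
      have j1 := integrable_nearD_apply h1 ht ht1 x (w := fun _ => v x) continuous_const
      have j2 := integrable_nearD_apply h1 ht ht1 x hvc
      simp only [one_smul] at j1 j2
      have j3 : ∫ y, nearD t (x - y) (v x) = 0 := by
        have hint := integrable_smul_nearD h1 ht ht1 x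
        simp only [one_smul] at hint
        rw [← ContinuousLinearMap.integral_apply hint, integral_nearD ht ht1]
        rfl
      simp only [comm, one_smul, map_sub]
      rw [integral_sub j1 j2, j3, zero_sub]
    have hsw : ∫ z, f (x - z) • nearK t z = ∫ y, f y • nearK t (x - y) := by
      rw [← integral_sub_left_eq_self (fun z => f (x - z) • nearK t z) volume x]
      simp
    have hfi' : Integrable (fun y => f y • nearK t (x - y)) volume := by
      have := (hfi t ht x).comp_sub_left x
      simpa using this
    have hZi : Integrable (fun y => ω y • nearD t (x - y) (Y y)) volume :=
      integrable_nearD_apply hω ht ht1 x hY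
    have hvi : Integrable (fun y => nearD t (x - y) (v y)) volume := by
      simpa using integrable_nearD_apply h1 ht ht1 x hvc
    rw [hcm, sub_neg_eq_add, hsw]
    ext i
    -- test the equation against the `i`-th component of the kernel centred at `x`
    have hφ1 := contDiff_nearK_sub t x i
    have hφ2 := hasCompactSupport_nearK_sub ht ht1 x i
    have e := congrArg (fun T : Dist => T (mkTest _ hφ1 hφ2)) hdiv
    have e' : divDist (fun x => ω x • Y x) (mkTest _ hφ1 hφ2) =
      ofFun f (mkTest _ hφ1 hφ2) + divDist v (mkTest _ hφ1 hφ2) := e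
    rw [divDist_apply hZ, divDist_apply hvc.locallyIntegrable,
      ofFun_apply hfc.locallyIntegrable] at e'
    have c1 : ∫ y, (ω y • nearD t (x - y) (Y y)) i = (∫ y, ω y • nearD t (x - y) (Y y)) i :=
      (coordL i).integral_comp_comm hZi
    have c2 : ∫ y, (nearD t (x - y) (v y)) i = (∫ y, nearD t (x - y) (v y)) i :=
      (coordL i).integral_comp_comm hvi
    have c3 : ∫ y, (f y • nearK t (x - y)) i = (∫ y, f y • nearK t (x - y)) i :=
      (coordL i).integral_comp_comm hfi'
    rw [PiLp.add_apply, ← c1, ← c2, ← c3]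
    have d1 : ∀ w : Plane → Plane,
        -∫ y, fderiv ℝ (mkTest _ hφ1 hφ2) y (w y) = ∫ y, nearD t (x - y) (w y) i := fun w => by
      rw [← integral_neg]
      congr 1
      ext1 y
      exact neg_eq_iff_eq_neg.2 (fderiv_nearK_sub t x y (w y) i)
    rw [d1, d1] at e'
    simp only [map_smul, PiLp.smul_apply, smul_eq_mul] at e' ⊢
    rw [e']
    congr 2
    ext1 y
    exact mul_comm _ _
  have hcommB := hcomm (fun _ => 1) v 1 N 0 h1 (Filter.Eventually.of_forall fun y => by simp) hv
    (fun t ht ht1 x => by simp [integral_nearD ht ht1])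
  have hL1 : ∀ t, 0 < t → t ≤ 1 → ∫ z, ‖nearK t z‖ ≤ 4 * Real.pi := fun t ht ht1 => by
    simpa [nearK_one, max_eq_right ht1] using integral_norm_nearK_sub_le ht one_pos
  constructor
  · intro t ht ht1
    have hF : HolderBdd α (4 * Real.pi * N) fun x => ∫ z, f (x - z) • nearK t z := by
      refine ⟨fun x => ?_, fun x x' => ?_⟩
      · refine (norm_integral_le_of_norm_le ((integrable_nearK ht).norm.const_mul N)
          (Filter.Eventually.of_forall fun z => ?_)).trans ?_
        · rw [norm_smul]
          exact mul_le_mul_of_nonneg_right (hf.1 _) (norm_nonneg _)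
        · rw [integral_const_mul, mul_comm]
          exact mul_le_mul_of_nonneg_right (hL1 t ht ht1) hN
      · rw [← integral_sub (hfi t ht x) (hfi t ht x')]
        refine (norm_integral_le_of_norm_le
          ((integrable_nearK ht).norm.const_mul (N * ‖x - x'‖ ^ α))
          (Filter.Eventually.of_forall fun z => ?_)).trans ?_
        · rw [← sub_smul, norm_smul]
          refine mul_le_mul_of_nonneg_right ?_ (norm_nonneg _)
          have := hf.2 (x - z) (x' - z)
          rwa [sub_sub_sub_cancel_right] at this
        · rw [integral_const_mul]
          calc N * ‖x - x'‖ ^ α * ∫ z, ‖nearK t z‖ ≤ N * ‖x - x'‖ ^ α * (4 * Real.pi) := by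
                gcongr
                exact hL1 t ht ht1
            _ = _ := by ring
    have := hF.sub (hcommB t ht ht1)
    rw [show (fun x => ∫ y, ω y • nearD t (x - y) (Y y)) = fun x =>
      (∫ z, f (x - z) • nearK t z) - comm (fun _ => 1) v t x from funext (key t ht ht1)]
    refine this.mono ?_
    have : 0 ≤ 4 * Real.pi * kernelConst / α * N := by positivity
    linarith
  · intro t s ht ht1 hs hs1 x
    rw [key t ht ht1, key s hs hs1]
    have b1 := norm_comm_sub_le hα hα2 h1 (B := 1) (Filter.Eventually.of_forall fun y => by simp)
      hvc hv.2 hN ht ht1 hs hs1 x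
    have b2 : ‖(∫ z, f (x - z) • nearK t z) - ∫ z, f (x - z) • nearK s z‖ ≤
        N * (4 * Real.pi * max t s) := by
      rw [← integral_sub (hfi t ht x) (hfi s hs x)]
      refine (norm_integral_le_of_norm_le
        (((integrable_nearK ht).sub (integrable_nearK hs)).norm.const_mul N)
        (Filter.Eventually.of_forall fun z => ?_)).trans ?_
      · rw [← smul_sub, norm_smul]
        exact mul_le_mul_of_nonneg_right (hf.1 _) (norm_nonneg _)
      · rw [integral_const_mul]
        exact mul_le_mul_of_nonneg_left (integral_norm_nearK_sub_le ht hs) hN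
    have hm : max t s ≤ max t s ^ α := Real.self_le_rpow_of_le_one
      (ht.le.trans (le_max_left _ _)) (max_le ht1 hs1) hα1.le
    have hm0 : 0 ≤ max t s ^ α := Real.rpow_nonneg (ht.le.trans (le_max_left _ _)) α
    rw [sub_sub_sub_comm]
    refine (norm_sub_le _ _).trans ((add_le_add b2 b1).trans ?_)
    have e1 : N * (4 * Real.pi * max t s) ≤ 4 * Real.pi * N * max t s ^ α := by
      calc N * (4 * Real.pi * max t s) = 4 * Real.pi * N * max t s := by ring
        _ ≤ _ := by gcongr
    have e2 : 0 ≤ C0 * N * max t s ^ α := by positivity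
    linarith

end

/-! ### From the divergence of `ω Y` to the derivative of the velocity along `Y` -/

section

variable {α : ℝ} {ω : Plane → ℝ} {B : ℝ}

/-- A divergence-free matrix is bounded by its curl and its value at a vector that is not small. -/
theorem norm_le_of_divOp_eq_zero {A : Plane →L[ℝ] Plane} (hA : divOp A = 0) {y : Plane} {c : ℝ}
    (hc : 0 < c) (hy : c ≤ ‖y‖) : ‖A‖ ≤ 8 * (‖A y‖ / c + |curlOp A|) := by
  have hy0 : 0 < ‖y‖ := hc.trans_le hy
  have h := norm_mul_norm_le_of_divOp_eq_zero A hA y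
  have h1 : ‖A y‖ ≤ ‖A y‖ / c * ‖y‖ := by
    rw [div_mul_eq_mul_div, le_div_iff₀ hc]
    gcongr
  refine le_of_mul_le_mul_right (h.trans ?_) hy0
  rw [mul_assoc, add_mul]
  gcongr

theorem tendsto_mul_max_scale_rpow (hα : 0 < α) (C : ℝ) :
    Filter.Tendsto (fun n : ℕ × ℕ => C * max (scale n.1) (scale n.2) ^ α) Filter.atTop
      (nhds 0) := by
  have h1 : Filter.Tendsto (fun n : ℕ × ℕ => scale n.1) Filter.atTop (nhds 0) := by
    rw [← Filter.prod_atTop_atTop_eq]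
    exact tendsto_scale.comp Filter.tendsto_fst
  have h2 : Filter.Tendsto (fun n : ℕ × ℕ => scale n.2) Filter.atTop (nhds 0) := by
    rw [← Filter.prod_atTop_atTop_eq]
    exact tendsto_scale.comp Filter.tendsto_snd
  have h := ((h1.max h2).rpow_const (p := α) (Or.inr hα.le)).const_mul C
  rwa [max_self, Real.zero_rpow hα.ne', mul_zero] at h

/-- A family that is Cauchy with a Hölder modulus converges along the sequence of scales. -/
theorem exists_tendsto_of_norm_sub_le_rpow {E : Type*} [NormedAddCommGroup E] [CompleteSpace E]
    (hα : 0 < α) {u : ℝ → E} {C : ℝ} (h : ∀ t s, 0 < t → t ≤ 1 → 0 < s → s ≤ 1 →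
      ‖u t - u s‖ ≤ C * max t s ^ α) :
    ∃ a, Filter.Tendsto (fun n => u (scale n)) Filter.atTop (nhds a) := by
  refine cauchySeq_tendsto_of_complete (cauchySeq_iff_tendsto_dist_atTop_0.2 ?_)
  refine squeeze_zero (fun _ => dist_nonneg) (fun n => ?_) (tendsto_mul_max_scale_rpow hα C)
  rw [dist_eq_norm]
  exact h _ _ (scale_pos _) (scale_le_one _) (scale_pos _) (scale_le_one _)

/-- If the regularized velocity gradients are bounded, then the commutators with Hölder vector
fields are Hölder, uniformly in the regularization. -/
theorem holderBdd_comm_of_norm_velD_le (hα : 0 < α) (hα1 : α < 1) (hω : Integrable ω volume)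
    (hB : ∀ᵐ y, |ω y| ≤ B) {M : ℝ} (hM : ∀ t, 0 < t → t ≤ 1 → ∀ x, ‖velD t ω x‖ ≤ M) (V : ℝ) :
    ∃ C, ∀ Y : Plane → Plane, HolderBdd α V Y → ∀ t, 0 < t → t ≤ 1 →
      HolderBdd α C (comm ω Y t) := by
  obtain ⟨C, -, h⟩ := exists_holderBdd_comm hα hα1
  refine ⟨C * (B + 2 * M) * V, fun Y hY => h ω Y B V (2 * M) hω.locallyIntegrable hB hY ?_⟩
  intro t ht ht1 x
  have e : ∫ y, ω y • nearD t (x - y) = velD t ω x - velD 1 ω x :=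
    (sub_eq_of_eq_add' (velD_eq_add hω ht x)).symm
  rw [e, two_mul]
  exact (norm_sub_le _ _).trans (add_le_add (hM t ht ht1 x) (hM 1 one_pos le_rfl x))

/-- If the divergences of `ω Y` are Hölder of exponent `α - 1`, uniformly over a family of vector
fields that does not degenerate near `S`, then the velocity gradient exists, and its values on
the vector fields are uniformly Hölder. -/
theorem exists_isWeakJacobian_holderBdd (hα : 0 < α) (hα1 : α < 1) (hω : Integrable ω volume)
    (hB : ∀ᵐ y, |ω y| ≤ B) {S : Set Plane} {M : ℝ} (hM1 : ∀ x ∈ Sᶜ, |ω x| ≤ M)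
    (hM2 : ∀ x y, segment ℝ x y ⊆ Sᶜ → |ω x - ω y| ≤ M * ‖x - y‖ ^ α) {δ c : ℝ} (hδ : 0 < δ)
    (hc : 0 < c) {L : Type*} {Y : L → Plane → Plane} {V N : ℝ} (hV : 0 ≤ V) (hN : 0 ≤ N)
    (hY : ∀ l, HolderBdd α V (Y l)) (hYc : ∀ x ∈ Metric.thickening δ S, ∃ l, c ≤ ‖Y l x‖)
    (hdiv : ∀ l, ∃ (f : Plane → ℝ) (v : Plane → Plane),
      divDist (fun x => ω x • Y l x) = ofFun f + divDist v ∧ HolderBdd α N f ∧ HolderBdd α N v) :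
    ∃ (G : Plane → Plane →L[ℝ] Plane) (C : ℝ), IsWeakJacobian (biotSavart ω) G ∧
      ∀ l, ∃ F, HolderBdd α C F ∧ F =ᵐ[volume] fun x => G x (Y l x) := by
  have hα2 : α < 2 := by linarith
  have hA := kernelConst_nonneg
  have hB0 : 0 ≤ B := by
    obtain ⟨y, hy⟩ := hB.exists
    exact (abs_nonneg _).trans hy
  have hYcont := fun l => (hY l).continuous hα
  have h1D := holderBdd_velD_one hα hα1.le hω
  set D := 3 * (kernelConst * ∫ y, |ω y|)
  have hD : 0 ≤ D := h1D.nonneg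
  obtain ⟨C1, hC1, hsch⟩ := exists_holderBdd_of_divDist_eq hα hα1
  choose f v hfv hf hv using hdiv
  have hsch' := fun l => hsch ω (Y l) (v l) (f l) N hω.locallyIntegrable (hYcont l)
    (hω.smul_bdd V (hYcont l).aestronglyMeasurable
      (Filter.Eventually.of_forall (hY l).1)).locallyIntegrable (hfv l) (hf l) (hv l)
  -- the regularized derivatives along the vector fields are bounded and Cauchy
  have hbd : ∀ l t, 0 < t → t ≤ 1 → ∀ x, ‖velD t ω x (Y l x)‖ ≤
      2 * (D * V) + C1 * N + B * V * (4 * Real.pi * kernelConst / α) := by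
    intro l t ht ht1 x
    rw [velD_apply_eq (hYcont l) hω ht ht1]
    exact norm_add₃_le.trans (add_le_add (add_le_add ((h1D.clm_apply (hY l)).1 x)
      (((hsch' l).1 t ht ht1).1 x)) (norm_comm_le hα hα2 hω.locallyIntegrable hB (hYcont l)
      (hY l).2 hV ht ht1 x))
  set C0 := 2 * (D * V) + C1 * N + B * V * (4 * Real.pi * kernelConst / α)
  have hC0 : 0 ≤ C0 := by positivity
  obtain ⟨C3, hC3⟩ : ∃ C3, C3 = C1 * N + B * V * (4 * Real.pi * kernelConst / α) := ⟨_, rfl⟩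
  have hcau : ∀ l x t s, 0 < t → t ≤ 1 → 0 < s → s ≤ 1 →
      ‖velD t ω x (Y l x) - velD s ω x (Y l x)‖ ≤ C3 * max t s ^ α := by
    intro l x t s ht ht1 hs hs1
    have h1 := (hsch' l).2 t s ht ht1 hs hs1 x
    have h2 := norm_comm_sub_le hα hα2 hω.locallyIntegrable hB (hYcont l) (hY l).2 hV ht ht1
      hs hs1 x
    rw [velD_apply_eq (hYcont l) hω ht ht1, velD_apply_eq (hYcont l) hω hs hs1,
      add_sub_add_comm, add_sub_add_left_eq_sub, hC3, add_mul]
    refine (norm_add_le _ _).trans (add_le_add h1 (h2.trans_eq ?_))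
    ring
  obtain ⟨C4, hC4, hout⟩ := exists_norm_velD_sub_le_of_notMem hα hα1 hω hB hM1 hM2 hδ
  have hM : ∀ t, 0 < t → t ≤ 1 → ∀ x, ‖velD t ω x‖ ≤ 8 * (C0 / c + B) + (C4 + D) := by
    intro t ht ht1 x
    by_cases hx : x ∈ Metric.thickening δ S
    · obtain ⟨l, hl⟩ := hYc x hx
      refine (norm_le_of_divOp_eq_zero (divOp_velD hω ht x) hc hl).trans ?_
      rw [curlOp_velD hω ht]
      refine le_add_of_le_of_nonneg ?_ (by positivity)
      gcongr
      exacts [hbd l t ht ht1 x, abs_mollify_le hB ht x]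
    · have h := hout x hx t 1 ht ht1 one_pos le_rfl
      rw [max_eq_right ht1, Real.one_rpow, mul_one] at h
      refine le_add_of_nonneg_of_le (by positivity) ?_
      calc ‖velD t ω x‖ = ‖(velD t ω x - velD 1 ω x) + velD 1 ω x‖ := by rw [sub_add_cancel]
        _ ≤ _ := (norm_add_le _ _).trans (add_le_add h (h1D.1 x))
  -- hence the commutators are Hölder, and so are the derivatives along the vector fields
  obtain ⟨C5, hC5⟩ := holderBdd_comm_of_norm_velD_le hα hα1 hω hB hM V
  have hH : ∀ l t, 0 < t → t ≤ 1 → HolderBdd α (2 * (D * V) + C1 * N + C5)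
      fun x => velD t ω x (Y l x) := by
    intro l t ht ht1
    rw [funext fun x => velD_apply_eq (hYcont l) hω ht ht1 x]
    exact ((h1D.clm_apply (hY l)).add ((hsch' l).1 t ht ht1)).add (hC5 (Y l) (hY l) t ht ht1)
  have hlim : ∀ l x, ∃ a, Filter.Tendsto (fun n => velD (scale n) ω x (Y l x)) Filter.atTop
      (nhds a) := fun l x => exists_tendsto_of_norm_sub_le_rpow hα (hcau l x)
  choose F hF using hlim
  have hG : ∀ᵐ x, ∃ A, Filter.Tendsto (fun n => velD (scale n) ω x) Filter.atTop (nhds A) := by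
    filter_upwards [ae_tendsto_mollify hω.locallyIntegrable] with x hx
    by_cases hxS : x ∈ Metric.thickening δ S
    · obtain ⟨l, hl⟩ := hYc x hxS
      refine cauchySeq_tendsto_of_complete (cauchySeq_iff_tendsto_dist_atTop_0.2 ?_)
      have h1 := (tendsto_mul_max_scale_rpow hα C3).div_const c
      have h2 := cauchySeq_iff_tendsto_dist_atTop_0.1 hx.cauchySeq
      have h3 := (h1.add h2).const_mul 8
      rw [zero_div, add_zero, mul_zero] at h3
      refine squeeze_zero (fun _ => dist_nonneg) (fun n => ?_) h3
      have h4 := norm_le_of_divOp_eq_zero (A := velD (scale n.1) ω x - velD (scale n.2) ω x)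
        (by rw [map_sub, divOp_velD hω (scale_pos _), divOp_velD hω (scale_pos _), sub_zero]) hc hl
      rw [map_sub, curlOp_velD hω (scale_pos _), curlOp_velD hω (scale_pos _)] at h4
      rw [dist_eq_norm, Real.dist_eq]
      refine h4.trans ?_
      gcongr
      exact hcau l x _ _ (scale_pos _) (scale_le_one _) (scale_pos _) (scale_le_one _)
    · exact exists_tendsto_of_norm_sub_le_rpow hα (hout x hxS)
  obtain ⟨G, hGm, hGlim⟩ := exists_stronglyMeasurable_limit_of_tendsto_ae
    (fun n => (continuous_velD hω (scale_pos n)).aestronglyMeasurable) hG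
  refine ⟨G, 2 * (D * V) + C1 * N + C5, isWeakJacobian_of_tendsto hω hB
    (fun n => hM _ (scale_pos n) (scale_le_one n)) hGm.aestronglyMeasurable hGlim, fun l =>
    ⟨F l, HolderBdd.of_tendsto (fun n => hH l _ (scale_pos n) (scale_le_one n)) (hF l), ?_⟩⟩
  filter_upwards [hGlim] with x hx
  exact tendsto_nhds_unique (hF l x)
    (((ContinuousLinearMap.apply ℝ Plane (Y l x)).continuous.tendsto _).comp hx)

end

/-! ### From the derivative of the velocity along `Y` to the divergence of `ω Y` -/

section

variable {φ : Plane → ℝ}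

theorem fderiv_fderiv_apply_comm (h1 : ContDiff ℝ (⊤ : ℕ∞) φ) (x v w : Plane) :
    fderiv ℝ (fun y => fderiv ℝ φ y v) x w = fderiv ℝ (fun y => fderiv ℝ φ y w) x v := by
  have hd : DifferentiableAt ℝ (fderiv ℝ φ) x :=
    (h1.fderiv_right (m := (⊤ : ℕ∞)) (by simp)).differentiable (by simp) x
  have hs : IsSymmSndFDerivAt ℝ φ x := h1.contDiffAt.isSymmSndFDerivAt (by
    rw [minSmoothness_of_isRCLikeNormedField]
    exact WithTop.coe_le_coe.2 (le_top : (2 : ℕ∞) ≤ ⊤))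
  have e : ∀ v w : Plane, fderiv ℝ (fun y => fderiv ℝ φ y v) x w =
      fderiv ℝ (fderiv ℝ φ) x w v := fun v w => by
    rw [fderiv_clm_apply hd (differentiableAt_const v)]
    simp
  rw [e, e, hs]

theorem contDiff_fderiv_apply (h1 : ContDiff ℝ (⊤ : ℕ∞) φ) (e : Plane) :
    ContDiff ℝ (⊤ : ℕ∞) fun x => fderiv ℝ φ x e :=
  (h1.fderiv_right (by simp)).clm_apply contDiff_const

/-- Integration by parts moving the derivative in the direction `e` to the test function. -/
theorem integral_fderiv_rot_apply (h1 : ContDiff ℝ (⊤ : ℕ∞) φ) (h2 : HasCompactSupport φ)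
    {u : Plane → Plane} {Du : Plane → Plane →L[ℝ] Plane} (hu : ∀ x, HasFDerivAt u (Du x) x)
    (hc : Continuous Du) (e : Plane) : ∫ x, fderiv ℝ φ x (rot (Du x e)) =
      -∫ x, fderiv ℝ (fun y => fderiv ℝ φ y e) x (rot (u x)) := by
  have huc : Continuous u := continuous_iff_continuousAt.2 fun x => (hu x).continuousAt
  have i1 : ∀ (w : Plane) (i : Fin 2), Integrable (fun x => fderiv ℝ φ x w * Du x e i) volume :=
    fun w i => integrable_fderiv_apply_mul h1 h2 (Continuous.locallyIntegrable
      ((coordL i).continuous.comp (hc.clm_apply continuous_const))) w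
  have i2 := fun (w : Plane) (i : Fin 2) => integrable_fderiv_apply_mul (contDiff_fderiv_apply h1 e)
    (h2.fderiv_apply (𝕜 := ℝ) e) (locallyIntegrable_apply (huc.locallyIntegrable (μ := volume)) i) w
  simp_rw [fderiv_apply_rot]
  rw [integral_sub (i1 _ _) (i1 _ _), integral_sub (i2 _ _) (i2 _ _)]
  have h := fun (w : Plane) (i : Fin 2) => integral_mul_fderiv_coord (contDiff_fderiv_apply h1 w)
    (h2.fderiv_apply (𝕜 := ℝ) w) hu hc e i
  rw [h, h]
  simp_rw [fderiv_fderiv_apply_comm h1 _ _ e]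
  ring

end

section

variable {φ : Plane → ℝ} {B : ℝ}

/-- The curl of the derivative in the direction `e` of the velocity field of `g` is the derivative
of `g`, in the sense of distributions. -/
theorem tendsto_integral_fderiv_rot_velD {g : Plane → ℝ} (hg : Integrable g volume)
    (hB : ∀ᵐ y, |g y| ≤ B) (h1 : ContDiff ℝ (⊤ : ℕ∞) φ) (h2 : HasCompactSupport φ) (e : Plane) :
    Filter.Tendsto (fun n => ∫ x, fderiv ℝ φ x (rot (velD (scale n) g x e))) Filter.atTop
      (nhds (-∫ x, fderiv ℝ φ x e * g x)) := by
  have hψ1 := contDiff_fderiv_apply h1 e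
  have hψ2 := h2.fderiv_apply (𝕜 := ℝ) e
  refine (tendsto_integral_mul (hψ1.continuous.integrable_of_hasCompactSupport hψ2) (M := B)
    (fun n => (continuous_mollify hg (scale_pos n)).aestronglyMeasurable)
    (fun n => Filter.Eventually.of_forall fun x => abs_mollify_le hB (scale_pos n) x)
    (ae_tendsto_mollify hg.locallyIntegrable)).neg.congr fun n => ?_
  rw [integral_fderiv_rot_apply h1 h2 (hasFDerivAt_vel hg (scale_pos n))
    (continuous_velD hg (scale_pos n)), ← integral_mul_curlOp hψ1 hψ2
    (hasFDerivAt_vel hg (scale_pos n)) (continuous_velD hg (scale_pos n))]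
  simp_rw [curlOp_velD hg (scale_pos n)]

theorem velDiv_eq_sum {Z : Plane → Plane} (hZ : Integrable Z volume) {t : ℝ} (ht : 0 < t)
    (x : Plane) : velDiv t Z x = ∑ j, velD t (fun y => Z y j) x (stdVec j) := by
  have hi : ∀ j, Integrable (fun y => Z y j • kernD t (x - y)) volume := fun j =>
    integrable_smul_kernD ((coordL j).integrable_comp hZ) ht x
  have hi' : ∀ j, Integrable (fun y => Z y j • kernD t (x - y) (stdVec j)) volume := fun j =>
    (hi j).apply_continuousLinearMap (stdVec j)
  have e : ∀ j, velD t (fun y => Z y j) x (stdVec j) =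
      ∫ y, Z y j • kernD t (x - y) (stdVec j) := fun j =>
    ContinuousLinearMap.integral_apply (hi j) _
  simp_rw [e]
  rw [← integral_finsetSum _ fun j _ => hi' j, velDiv]
  congr 1
  ext1 y
  conv_lhs => rw [eq_sum_stdVec (Z y)]
  simp

theorem continuous_velDiv {Z : Plane → Plane} (hZ : Integrable Z volume) {t : ℝ} (ht : 0 < t) :
    Continuous (velDiv t Z) := by
  rw [funext fun x => velDiv_eq_sum hZ ht x]
  exact continuous_finsetSum _ fun j _ =>
    (continuous_velD ((coordL j).integrable_comp hZ) ht).clm_apply continuous_const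

/-- A bounded limit of the regularized convolutions of the Biot-Savart kernel with `div Z` is a
vector field whose curl is `div Z`, so that `div Z` is the divergence of the rotated limit. -/
theorem divDist_eq_of_tendsto_velDiv {Z H : Plane → Plane} (hZ : Integrable Z volume)
    (hB : ∀ᵐ y, ‖Z y‖ ≤ B) {M : ℝ} (hM : ∀ n x, ‖velDiv (scale n) Z x‖ ≤ M)
    (hH : LocallyIntegrable H volume)
    (h : ∀ᵐ x, Filter.Tendsto (fun n => velDiv (scale n) Z x) Filter.atTop (nhds (H x))) :
    divDist Z = divDist fun x => rot (-H x) := by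
  ext φ
  have h1 : ContDiff ℝ (⊤ : ℕ∞) φ := φ.contDiff
  have h2 : HasCompactSupport φ := φ.hasCompactSupport
  have hrot : LocallyIntegrable (fun x => rot (-H x)) volume :=
    locallyIntegrable_clm_comp (-rot.toContinuousLinearMap) hH |>.congr
      (Filter.Eventually.of_forall fun x => by simp)
  rw [divDist_apply hZ.locallyIntegrable, divDist_apply hrot]
  have l1 := tendsto_integral_clm_apply (integrable_fderiv_test h1 h2) (M := M)
    (f := fun n x => rot (velDiv (scale n) Z x)) (g := fun x => rot (H x))
    (fun n => (rot.continuous.comp (continuous_velDiv hZ (scale_pos n))).aestronglyMeasurable)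
    (fun n => Filter.Eventually.of_forall fun x => by simpa using hM n x)
    (by filter_upwards [h] with x hx using (rot.continuous.tendsto _).comp hx)
  have hZj : ∀ j, Integrable (fun y => Z y j) volume := fun j => (coordL j).integrable_comp hZ
  have l2 := tendsto_finsetSum Finset.univ fun (j : Fin 2) _ =>
    tendsto_integral_fderiv_rot_velD (B := B) (hZj j)
      (by filter_upwards [hB] with y hy using (abs_coord_le (Z y) j).trans hy) h1 h2 (stdVec j)
  have e1 : ∀ n, ∫ x, fderiv ℝ φ x (rot (velDiv (scale n) Z x)) =
      ∑ j, ∫ x, fderiv ℝ φ x (rot (velD (scale n) (fun y => Z y j) x (stdVec j))) := fun n => by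
    rw [← integral_finsetSum]
    · simp_rw [velDiv_eq_sum hZ (scale_pos n), map_sum]
    · intro j _
      exact integrable_fderiv_apply h1 h2 (Continuous.locallyIntegrable (rot.continuous.comp
        ((continuous_velD (hZj j) (scale_pos n)).clm_apply continuous_const)))
  have e2 : ∑ j, -∫ x, fderiv ℝ φ x (stdVec j) * Z x j = -∫ x, fderiv ℝ φ x (Z x) := by
    rw [Finset.sum_neg_distrib, ← integral_finsetSum _ fun j _ =>
      integrable_fderiv_apply_mul h1 h2 (hZj j).locallyIntegrable _]
    simp_rw [Fin.sum_univ_two, fun x => fderiv_apply_eq φ x (Z x)]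
  simp_rw [e1] at l1
  rw [e2] at l2
  rw [tendsto_nhds_unique l2 l1, ← integral_neg]
  simp

end

section

variable {α : ℝ} {ω : Plane → ℝ} {B : ℝ}

/-- If the derivatives of the velocity along a non-degenerate family of vector fields are
bounded, then so is the velocity gradient. -/
theorem IsWeakJacobian.ae_norm_le_of_mem_thickening {G : Plane → Plane →L[ℝ] Plane}
    (hω : Integrable ω volume) (hB : ∀ᵐ y, |ω y| ≤ B) (hG : IsWeakJacobian (biotSavart ω) G)
    {U : Set Plane} {c : ℝ} (hc : 0 < c) {L : Type*} {Y : L → Plane → Plane} {N : ℝ}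
    (hY : ∀ l, Continuous (Y l)) (hYc : ∀ x ∈ U, ∃ l, c ≤ ‖Y l x‖)
    (hN : ∀ l, ∀ᵐ x, ‖G x (Y l x)‖ ≤ N) :
    ∀ᵐ x, x ∈ U → ‖G x‖ ≤ 8 * (N / (c / 2) + B) := by
  refine ae_iff.2 (measure_null_of_locally_null _ fun x hx => ?_)
  simp only [Classical.not_imp, not_le, mem_ofPred_eq] at hx
  obtain ⟨l, hl⟩ := hYc x hx.1
  have hopen : {y | c / 2 < ‖Y l y‖} ∈ nhds x :=
    (isOpen_lt continuous_const (hY l).norm).mem_nhds ((half_lt_self hc).trans_le hl)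
  refine ⟨_ ∩ {y | c / 2 < ‖Y l y‖}, Filter.inter_mem self_mem_nhdsWithin
    (mem_nhdsWithin_of_mem_nhds hopen), ?_⟩
  have h : ∀ᵐ y, c / 2 < ‖Y l y‖ → ‖G y‖ ≤ 8 * (N / (c / 2) + B) := by
    filter_upwards [hN l, hG.ae_divOp_eq hω hB, hG.ae_curlOp_eq hω hB, hB] with y h1 h2 h3 h4 h5
    refine (norm_le_of_divOp_eq_zero h2 (half_pos hc) h5.le).trans ?_
    rw [h3]
    gcongr
  refine measure_mono_null (fun y hy => ?_) (ae_iff.1 h)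
  simp only [Classical.not_imp, not_le, mem_ofPred_eq, mem_inter_iff] at hy ⊢
  exact ⟨hy.2, hy.1.2⟩

/-- If the derivatives of the velocity along a non-degenerate family of vector fields are
uniformly Hölder, then the divergences of `ω Y` are uniformly Hölder of exponent `α - 1`. -/
theorem exists_holderBdd_divDist_eq (hα : 0 < α) (hα1 : α < 1) (hω : Integrable ω volume)
    (hB : ∀ᵐ y, |ω y| ≤ B) {S : Set Plane} {M : ℝ} (hM1 : ∀ x ∈ Sᶜ, |ω x| ≤ M)
    (hM2 : ∀ x y, segment ℝ x y ⊆ Sᶜ → |ω x - ω y| ≤ M * ‖x - y‖ ^ α) {δ c : ℝ} (hδ : 0 < δ)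
    (hc : 0 < c) {L : Type*} {Y : L → Plane → Plane} {V N : ℝ} (hV : 0 ≤ V) (hN : 0 ≤ N)
    (hY : ∀ l, HolderBdd α V (Y l)) (hYc : ∀ x ∈ Metric.thickening δ S, ∃ l, c ≤ ‖Y l x‖)
    {G : Plane → Plane →L[ℝ] Plane} (hG : IsWeakJacobian (biotSavart ω) G)
    (h : ∀ l, ∃ F, HolderBdd α N F ∧ F =ᵐ[volume] fun x => G x (Y l x)) :
    ∃ C, ∀ l, ∃ v, HolderBdd α C v ∧ divDist (fun x => ω x • Y l x) = divDist v := by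
  have hα2 : α < 2 := by linarith
  have hA := kernelConst_nonneg
  have hB0 : 0 ≤ B := by
    obtain ⟨y, hy⟩ := hB.exists
    exact (abs_nonneg _).trans hy
  have hI : 0 ≤ ∫ y, |ω y| := integral_nonneg fun y => abs_nonneg _
  have hYcont := fun l => (hY l).continuous hα
  have h1D := holderBdd_velD_one hα hα1.le hω
  set D := 3 * (kernelConst * ∫ y, |ω y|)
  have hD : 0 ≤ D := h1D.nonneg
  choose F hF hFG using h
  -- the velocity gradient is bounded near `S`
  have hGM := hG.ae_norm_le_of_mem_thickening hω hB hc hYcont hYc (N := N) fun l => by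
    filter_upwards [hFG l] with x hx
    rw [← hx]
    exact (hF l).1 x
  set M0 := 8 * (N / (c / 2) + B)
  have hM0 : 0 ≤ M0 := by positivity
  obtain ⟨C4, hC4, hout⟩ := exists_norm_velD_sub_le_of_notMem hα hα1 hω hB hM1 hM2 (half_pos hδ)
  have hK : 0 ≤ kernelConst * ((δ / 2) ^ 2)⁻¹ * ∫ y, |ω y| := by positivity
  have hM : ∀ t, 0 < t → t ≤ 1 → ∀ x, ‖velD t ω x‖ ≤
      M0 + kernelConst * ((δ / 2) ^ 2)⁻¹ * (∫ y, |ω y|) + (C4 + D) := by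
    intro t ht ht1 x
    by_cases hx : x ∈ Metric.thickening (δ / 2) S
    · rcases lt_or_ge t (δ / 2) with htδ | htδ
      · have h1 : ‖velD t ω x‖ ≤ M0 := by
          rw [hG.velD_eq hω hB ht]
          refine norm_mollify_le ht x ?_
          filter_upwards [hGM] with y hy hxy
          refine hy ?_
          obtain ⟨z, hz, hxz⟩ := Metric.mem_thickening_iff.1 hx
          refine Metric.mem_thickening_iff.2 ⟨z, hz, ?_⟩
          have h2 := dist_triangle y x z
          rw [dist_comm y x, dist_eq_norm x y] at h2
          linarith
        linarith
      · have h1 : ‖velD t ω x‖ ≤ kernelConst * ((δ / 2) ^ 2)⁻¹ * ∫ y, |ω y| := by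
          refine (norm_velD_le hω ht x).trans ?_
          gcongr
        linarith
    · have h := hout x hx t 1 ht ht1 one_pos le_rfl
      rw [max_eq_right ht1, Real.one_rpow, mul_one] at h
      refine le_add_of_nonneg_of_le (by positivity) ?_
      calc ‖velD t ω x‖ = ‖(velD t ω x - velD 1 ω x) + velD 1 ω x‖ := by rw [sub_add_cancel]
        _ ≤ _ := (norm_add_le _ _).trans (add_le_add h (h1D.1 x))
  set M1 := M0 + kernelConst * ((δ / 2) ^ 2)⁻¹ * (∫ y, |ω y|) + (C4 + D)
  obtain ⟨C5, hC5⟩ := holderBdd_comm_of_norm_velD_le hα hα1 hω hB hM V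
  have hZ : ∀ l, Integrable (fun x => ω x • Y l x) volume := fun l =>
    hω.smul_bdd V (hYcont l).aestronglyMeasurable (Filter.Eventually.of_forall (hY l).1)
  have hZI : ∀ l, ∫ x, ‖ω x • Y l x‖ ≤ (∫ y, |ω y|) * V := fun l => by
    rw [← integral_mul_const]
    refine integral_mono (hZ l).norm (hω.abs.mul_const V) fun x => ?_
    simp only [norm_smul, Real.norm_eq_abs]
    exact mul_le_mul_of_nonneg_left ((hY l).1 x) (abs_nonneg _)
  have h1V : ∀ l, HolderBdd α (3 * (kernelConst * ((∫ y, |ω y|) * V)))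
      (velDiv 1 fun x => ω x • Y l x) := fun l =>
    (holderBdd_velDiv_one hα hα1.le (hZ l)).mono (by gcongr; exact hZI l)
  set D' := 3 * (kernelConst * ((∫ y, |ω y|) * V))
  have hlim : ∀ l x, ∃ a, Filter.Tendsto (fun n => comm ω (Y l) (scale n) x) Filter.atTop
      (nhds a) := fun l x => exists_tendsto_of_norm_sub_le_rpow hα
    (C := B * V * (4 * Real.pi * kernelConst / α)) fun t s ht ht1 hs hs1 =>
      (norm_comm_sub_le hα hα2 hω.locallyIntegrable hB (hYcont l) (hY l).2 hV ht ht1 hs hs1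
        x).trans_eq (by ring)
  choose R hR using hlim
  have hRB : ∀ l, HolderBdd α C5 (R l) := fun l =>
    HolderBdd.of_tendsto (fun n => hC5 (Y l) (hY l) _ (scale_pos n) (scale_le_one n)) (hR l)
  have key : ∀ l n x, velDiv (scale n) (fun x => ω x • Y l x) x =
      velD (scale n) ω x (Y l x) - comm ω (Y l) (scale n) x - velD 1 ω x (Y l x) +
        velDiv 1 (fun x => ω x • Y l x) x := fun l n x => by
    have e1 := velD_apply_eq (hYcont l) hω (scale_pos n) (scale_le_one n) x
    rw [← velDiv_sub_eq (hZ l) (scale_pos n)] at e1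
    rw [e1]
    abel
  have hH : ∀ l, HolderBdd α (N + C5 + 2 * (D * V) + D')
      fun x => F l x - R l x - velD 1 ω x (Y l x) + velDiv 1 (fun x => ω x • Y l x) x := fun l =>
    (((hF l).sub (hRB l)).sub (h1D.clm_apply (hY l))).add (h1V l)
  refine ⟨_, fun l => ⟨_, (hH l).neg.isometry_comp rot, ?_⟩⟩
  refine divDist_eq_of_tendsto_velDiv (B := B * V) (M := M1 * V + C5 + 2 * (D * V) + D') (hZ l)
    ?_ (fun n x => ?_) ((hH l).locallyIntegrable hα) ?_
  · filter_upwards [hB] with y hy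
    rw [norm_smul, Real.norm_eq_abs]
    exact mul_le_mul hy ((hY l).1 y) (norm_nonneg _) hB0
  · have b1 : ‖velD (scale n) ω x (Y l x)‖ ≤ M1 * V :=
      (ContinuousLinearMap.le_opNorm _ _).trans (mul_le_mul (hM _ (scale_pos n) (scale_le_one n) x)
        ((hY l).1 x) (norm_nonneg _) (by positivity))
    have b2 := (hC5 (Y l) (hY l) _ (scale_pos n) (scale_le_one n)).1 x
    rw [key]
    exact (norm_add_le _ _).trans (add_le_add ((norm_sub_le _ _).trans (add_le_add
      ((norm_sub_le _ _).trans (add_le_add b1 b2)) ((h1D.clm_apply (hY l)).1 x))) ((h1V l).1 x))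
  · filter_upwards [ae_tendsto_mollify hG.2.1, hFG l] with x h1 h2
    simp_rw [key, hG.velD_eq hω hB (scale_pos _)]
    rw [h2]
    exact (((((ContinuousLinearMap.apply ℝ Plane (Y l x)).continuous.tendsto _).comp h1).sub
      (hR l x)).sub_const _).add_const _

end

/-! ### Finiteness of the norms -/

/-- The distribution `T` is `f + div v` with functions `f` and `v` that are `α`-Hölder with
bound `N`. -/
def NegHolderBdd (α N : ℝ) (T : Dist) : Prop :=
  ∃ (f : Plane → ℝ) (v : Plane → Plane),
    T = ofFun f + divDist v ∧ HolderBdd α N f ∧ HolderBdd α N v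

section norms

variable {E : Type*} [NormedAddCommGroup E] {L : Type*} {a : ℝ≥0}

theorem iSup_lt_top_iff_exists_lt_ofReal {u : L → ℝ≥0∞} :
    (⨆ l, u l) < ∞ ↔ ∃ N : ℝ, 0 ≤ N ∧ ∀ l, u l < ENNReal.ofReal N := by
  constructor
  · intro h
    refine ⟨(⨆ l, u l).toReal + 1, by positivity, fun l => (le_iSup u l).trans_lt ?_⟩
    rw [ENNReal.lt_ofReal_iff_toReal_lt h.ne]
    exact lt_add_one _
  · rintro ⟨N, -, h⟩
    exact (iSup_le fun l => (h l).le).trans_lt ENNReal.ofReal_lt_top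

theorem iSup_holderNorm_lt_top_iff {f : L → Plane → E} :
    (⨆ l, holderNorm a (f l)) < ∞ ↔ ∃ N : ℝ, 0 ≤ N ∧ ∀ l, HolderBdd a N (f l) := by
  constructor
  · intro h
    obtain ⟨N, hN, h⟩ := iSup_lt_top_iff_exists_lt_ofReal.1 h
    exact ⟨N, hN, fun l => holderBdd_of_holderNorm_le hN (h l).le⟩
  · rintro ⟨N, -, h⟩
    exact (iSup_le fun l => (h l).holderNorm_le).trans_lt ENNReal.ofReal_lt_top

theorem iSup_holderNormAE_lt_top_iff {f : L → Plane → E} :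
    (⨆ l, holderNormAE a (f l)) < ∞ ↔
      ∃ N : ℝ, 0 ≤ N ∧ ∀ l, ∃ g, HolderBdd a N g ∧ g =ᵐ[volume] f l := by
  constructor
  · intro h
    obtain ⟨N, hN, h⟩ := iSup_lt_top_iff_exists_lt_ofReal.1 h
    refine ⟨N, hN, fun l => ?_⟩
    have hl := h l
    simp only [holderNormAE, iInf_lt_iff] at hl
    obtain ⟨g, hg, hgN⟩ := hl
    exact ⟨g, holderBdd_of_holderNorm_le hN hgN.le, hg⟩
  · rintro ⟨N, -, h⟩
    refine (iSup_le fun l => ?_).trans_lt (ENNReal.ofReal_lt_top (r := 2 * N))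
    obtain ⟨g, hgN, hg⟩ := h l
    exact (iInf₂_le g hg).trans hgN.holderNorm_le

theorem iSup_negHolderNorm_lt_top_iff {T : L → Dist} :
    (⨆ l, negHolderNorm a (T l)) < ∞ ↔ ∃ N : ℝ, 0 ≤ N ∧ ∀ l, NegHolderBdd a N (T l) := by
  constructor
  · intro h
    obtain ⟨N, hN, h⟩ := iSup_lt_top_iff_exists_lt_ofReal.1 h
    refine ⟨N, hN, fun l => ?_⟩
    have hl := h l
    simp only [negHolderNorm, iInf_lt_iff] at hl
    obtain ⟨f, v, hT, hfv⟩ := hl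
    exact ⟨f, v, hT, holderBdd_of_holderNorm_le hN (le_self_add.trans hfv.le),
      holderBdd_of_holderNorm_le hN (le_add_self.trans hfv.le)⟩
  · rintro ⟨N, -, h⟩
    refine (iSup_le fun l => ?_).trans_lt
      (ENNReal.add_lt_top.2 ⟨ENNReal.ofReal_lt_top (r := 2 * N),
        ENNReal.ofReal_lt_top (r := 2 * N)⟩)
    obtain ⟨f, v, hT, hf, hv⟩ := h l
    exact iInf_le_of_le f (iInf_le_of_le v (iInf_le_of_le hT
      (add_le_add hf.holderNorm_le hv.holderNorm_le)))

end norms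

/-! ### The divergence of `ω Y` and the derivative of `ω` along `Y` -/

theorem divDist_add {v w : Plane → Plane} (hv : LocallyIntegrable v volume)
    (hw : LocallyIntegrable w volume) : divDist (fun x => v x + w x) = divDist v + divDist w := by
  ext φ
  have h1 : ContDiff ℝ (⊤ : ℕ∞) φ := φ.contDiff
  have h2 : HasCompactSupport φ := φ.hasCompactSupport
  change _ = divDist v φ + divDist w φ
  rw [divDist_apply (v := fun x => v x + w x) (hv.add hw), divDist_apply hv, divDist_apply hw,
    ← neg_add, ← integral_add (integrable_fderiv_apply h1 h2 hv) (integrable_fderiv_apply h1 h2 hw)]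
  simp

theorem divDist_neg {v : Plane → Plane} (hv : LocallyIntegrable v volume) :
    divDist (fun x => -v x) = -divDist v := by
  ext φ
  change _ = -divDist v φ
  rw [divDist_apply (v := fun x => -v x) hv.neg, divDist_apply hv, ← integral_neg]
  simp

/-- A bounded integrable function is the divergence of its rotated velocity field. -/
theorem ofFun_eq_divDist_rot_biotSavart {g : Plane → ℝ} {B : ℝ} (hg : Integrable g volume)
    (hB : ∀ᵐ y, |g y| ≤ B) : ofFun g = divDist fun x => rot (-biotSavart g x) := by
  ext φ
  have hc : Continuous fun x => rot (-biotSavart g x) :=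
    rot.continuous.comp (continuous_biotSavart hg hB).neg
  rw [ofFun_apply hg.locallyIntegrable, divDist_apply hc.locallyIntegrable,
    ← integral_fderiv_rot_biotSavart hg hB φ.contDiff φ.hasCompactSupport, ← integral_neg]
  simp

theorem NegHolderBdd.add_divDist {α N K : ℝ} (hα : 0 < α) {T : Dist} (hT : NegHolderBdd α N T)
    {w : Plane → Plane} (hw : HolderBdd α K w) : NegHolderBdd α (N + K) (T + divDist w) := by
  obtain ⟨f, v, rfl, hf, hv⟩ := hT
  refine ⟨f, fun x => v x + w x, ?_, hf.mono (le_add_of_nonneg_right hw.nonneg), hv.add hw⟩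
  rw [divDist_add (hv.locallyIntegrable hα) (hw.locallyIntegrable hα), add_assoc]

theorem NegHolderBdd.of_divDist {α N : ℝ} {v : Plane → Plane} (hv : HolderBdd α N v) :
    NegHolderBdd α N (divDist v) := by
  have hN := hv.nonneg
  refine ⟨fun _ => 0, v, ?_, ⟨fun x => by simpa using hN, fun x y => ?_⟩, hv⟩
  · have : ofFun (fun _ => 0) = 0 := by
      ext φ
      rw [ofFun_apply (locallyIntegrable_const 0)]
      simp
    rw [this, zero_add]
  · rw [sub_self, norm_zero]
    positivity

/-- The correction `ω div Y` is bounded and integrable, hence the divergence of a Hölder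
vector field. -/
theorem exists_dirDeriv_add_divDist_eq {α : ℝ} (hα : 0 < α) (hα1 : α < 1) {ω : Plane → ℝ} {B : ℝ}
    (hω : Integrable ω volume) (hB : ∀ᵐ y, |ω y| ≤ B) {V : ℝ} : ∃ K,
      ∀ (Y : Plane → Plane) (D : Plane → ℝ), HolderBdd α V D → ∃ w, HolderBdd α K w ∧
        dirDeriv Y D ω + divDist w = divDist fun x => ω x • Y x := by
  obtain ⟨C, hC, h⟩ := exists_holderBdd_biotSavart hα hα1
  refine ⟨C * (B * V + (∫ y, |ω y|) * V), fun Y D hD => ?_⟩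
  have hV := hD.nonneg
  have hB0 : 0 ≤ B := by
    obtain ⟨y, hy⟩ := hB.exists
    exact (abs_nonneg _).trans hy
  have hg : Integrable (fun x => ω x * D x) volume :=
    hω.smul_bdd V (hD.continuous hα).aestronglyMeasurable (Filter.Eventually.of_forall hD.1)
  have hgB : ∀ᵐ y, |ω y * D y| ≤ B * V := by
    filter_upwards [hB] with y hy
    rw [abs_mul]
    exact mul_le_mul hy (hD.1 y) (abs_nonneg _) hB0
  have hgI : ∫ y, |ω y * D y| ≤ (∫ y, |ω y|) * V := by
    rw [← integral_mul_const]
    refine integral_mono hg.abs (hω.abs.mul_const V) fun x => ?_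
    simp only [abs_mul]
    exact mul_le_mul_of_nonneg_left (hD.1 x) (abs_nonneg _)
  refine ⟨_, ((h _ _ hg hgB).mono (by gcongr)).neg.isometry_comp rot, ?_⟩
  rw [← ofFun_eq_divDist_rot_biotSavart hg hgB, dirDeriv, sub_add_cancel]

/-! ### Families of vector fields -/

theorem IsHolderInside.exists_abs_sub_le {a : ℝ≥0} {f : Plane → ℝ} {U : Set Plane}
    (h : IsHolderInside a f U) : ∃ M : ℝ, (∀ x ∈ U, |f x| ≤ M) ∧
      ∀ x y, segment ℝ x y ⊆ U → |f x - f y| ≤ M * ‖x - y‖ ^ (a : ℝ) := by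
  obtain ⟨M, h1, h2⟩ := h
  refine ⟨M, h1, fun x y hxy => ?_⟩
  have h3 := h2 x y hxy
  rwa [edist_dist, edist_dist, dist_eq_norm, dist_eq_norm, Real.norm_eq_abs,
    ENNReal.ofReal_rpow_of_nonneg (norm_nonneg _) a.coe_nonneg, ← ENNReal.ofReal_coe_nnreal,
    ← ENNReal.ofReal_mul M.coe_nonneg, ENNReal.ofReal_le_ofReal_iff (by positivity)] at h3

/-- The equivalences for a family of vector fields that does not degenerate near a set off which
the vorticity is Hölder. -/
theorem iSup_norm_lt_top_iff {a : ℝ≥0} (ha0 : 0 < a) (ha1 : a < 1) {ω : Plane → ℝ}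
    (hω1 : Integrable ω volume) (hω2 : MemLp ω ∞ volume) {S : Set Plane}
    (hS : IsHolderInside a ω Sᶜ) {L : Type*} {Y : L → Plane → Plane} {D : L → Plane → ℝ}
    (hY : (⨆ l, holderNorm a (Y l)) < ∞)
    (hYc : ∃ c > (0 : ℝ), ∃ δ > (0 : ℝ), ∀ x ∈ Metric.thickening δ S, ∃ l, c ≤ ‖Y l x‖)
    (hD : (⨆ l, holderNorm a (D l)) < ∞) :
    ((⨆ l, negHolderNorm a (dirDeriv (Y l) (D l) ω)) < ∞ ↔
      (⨆ l, negHolderNorm a (divDist fun x => ω x • Y l x)) < ∞) ∧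
    ((⨆ l, negHolderNorm a (divDist fun x => ω x • Y l x)) < ∞ ↔
      ∃ G : Plane → Plane →L[ℝ] Plane, IsWeakJacobian (biotSavart ω) G ∧
        (⨆ l, holderNormAE a (fun x => G x (Y l x))) < ∞) := by
  have hα : (0 : ℝ) < a := ha0
  have hα1 : (a : ℝ) < 1 := ha1
  obtain ⟨B, hB⟩ : ∃ B, ∀ᵐ y, |ω y| ≤ B := by
    have h := hω2.eLpNorm_lt_top
    rw [eLpNorm_exponent_top] at h
    refine ⟨(eLpNormEssSup ω volume).toReal, ?_⟩
    filter_upwards [ae_le_eLpNormEssSup (f := ω) (μ := volume)] with y hy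
    rw [← Real.norm_eq_abs, ← toReal_enorm]
    exact ENNReal.toReal_mono h.ne hy
  obtain ⟨M, hM1, hM2⟩ := hS.exists_abs_sub_le
  obtain ⟨V, hV, hY⟩ := iSup_holderNorm_lt_top_iff.1 hY
  obtain ⟨V', -, hD⟩ := iSup_holderNorm_lt_top_iff.1 hD
  obtain ⟨c, hc, δ, hδ, hYc⟩ := hYc
  simp only [iSup_negHolderNorm_lt_top_iff, iSup_holderNormAE_lt_top_iff]
  refine ⟨?_, ?_, ?_⟩
  · obtain ⟨K, hK⟩ := exists_dirDeriv_add_divDist_eq hα hα1 hω1 hB (V := V')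
    choose w hw hwe using fun l => hK (Y l) (D l) (hD l)
    constructor
    · rintro ⟨N, hN, h⟩
      refine ⟨N + |K|, by positivity, fun l => ?_⟩
      rw [← hwe l]
      exact (h l).add_divDist hα ((hw l).mono (le_abs_self K))
    · rintro ⟨N, hN, h⟩
      refine ⟨N + |K|, by positivity, fun l => ?_⟩
      have e : dirDeriv (Y l) (D l) ω =
          (divDist fun x => ω x • Y l x) + divDist fun x => -w l x := by
        rw [divDist_neg ((hw l).locallyIntegrable hα), ← hwe l, add_neg_cancel_right]
      rw [e]
      exact (h l).add_divDist hα ((hw l).mono (le_abs_self K)).neg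
  · rintro ⟨N, hN, h⟩
    obtain ⟨G, C, hG, h⟩ := exists_isWeakJacobian_holderBdd hα hα1 hω1 hB hM1 hM2 hδ hc hV hN hY
      hYc h
    refine ⟨G, hG, |C|, abs_nonneg C, fun l => ?_⟩
    obtain ⟨F, hF, hFG⟩ := h l
    exact ⟨F, hF.mono (le_abs_self C), hFG⟩
  · rintro ⟨G, hG, N, hN, h⟩
    obtain ⟨C, h⟩ := exists_holderBdd_divDist_eq hα hα1 hω1 hB hM1 hM2 hδ hc hV hN hY hYc hG h
    refine ⟨|C|, abs_nonneg C, fun l => ?_⟩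
    obtain ⟨v, hv, hve⟩ := h l
    rw [hve]
    exact NegHolderBdd.of_divDist (hv.mono (le_abs_self C))

end Serfati

end

open Serfati in
/-- Let `0 < α < 1`, `ω₀ ∈ L¹ ∩ L^∞`, `u₀ = K * ω₀`. The first part is about one vector field that
is bounded below near a closed set off which `ω₀` is Hölder; the second part is about a family of
vector fields, membership in a space meaning that the norms are bounded over the family. -/
theorem mainTheorem6 (α : ℝ≥0) (hα0 : 0 < α) (hα1 : α < 1)
    (ω₀ : Plane → ℝ) (hω1 : Integrable ω₀ volume) (hω2 : MemLp ω₀ ∞ volume) :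
    (∀ (S : Set Plane) (Y₀ : Plane → Plane) (divY₀ : Plane → ℝ),
      IsClosed S →
      IsHolderInside α ω₀ Sᶜ →
      holderNorm α Y₀ < ∞ →
      (∃ c > (0 : ℝ), ∃ δ > (0 : ℝ), ∀ x ∈ Metric.thickening δ S, c ≤ ‖Y₀ x‖) →
      IsWeakDiv Y₀ divY₀ →
      holderNorm α divY₀ < ∞ →
      (negHolderNorm α (dirDeriv Y₀ divY₀ ω₀) < ∞ ↔
        negHolderNorm α (divDist fun x => ω₀ x • Y₀ x) < ∞) ∧
      (negHolderNorm α (divDist fun x => ω₀ x • Y₀ x) < ∞ ↔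
        ∃ G : Plane → Plane →L[ℝ] Plane, IsWeakJacobian (biotSavart ω₀) G ∧
          holderNormAE α (fun x => G x (Y₀ x)) < ∞)) ∧
    (∀ (L : Type*) (Y₀ : L → Plane → Plane) (divY₀ : L → Plane → ℝ),
      (⨆ l, holderNorm α (Y₀ l)) < ∞ →
      (∃ c > (0 : ℝ), ∀ x, ∃ l, c ≤ ‖Y₀ l x‖) →
      (∀ l, IsWeakDiv (Y₀ l) (divY₀ l)) →
      (⨆ l, holderNorm α (divY₀ l)) < ∞ →
      ((⨆ l, negHolderNorm α (dirDeriv (Y₀ l) (divY₀ l) ω₀)) < ∞ ↔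
        (⨆ l, negHolderNorm α (divDist fun x => ω₀ x • Y₀ l x)) < ∞) ∧
      ((⨆ l, negHolderNorm α (divDist fun x => ω₀ x • Y₀ l x)) < ∞ ↔
        ∃ G : Plane → Plane →L[ℝ] Plane, IsWeakJacobian (biotSavart ω₀) G ∧
          (⨆ l, holderNormAE α (fun x => G x (Y₀ l x))) < ∞)) := by
  constructor
  · intro S Y₀ divY₀ _ hS hY hc _ hD
    obtain ⟨c, hc, δ, hδ, h⟩ := hc
    have := iSup_norm_lt_top_iff (L := Unit) (Y := fun _ => Y₀) (D := fun _ => divY₀) hα0 hα1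
      hω1 hω2 hS (by simpa only [iSup_const] using hY) ⟨c, hc, δ, hδ, fun x hx => ⟨(), h x hx⟩⟩
      (by simpa only [iSup_const] using hD)
    simpa only [iSup_const] using this
  · intro L Y₀ divY₀ hY hc _ hD
    obtain ⟨c, hc, h⟩ := hc
    -- with `S` the whole plane, no regularity is asked of the vorticity
    exact iSup_norm_lt_top_iff (S := univ) hα0 hα1 hω1 hω2
      ⟨0, fun x hx => (hx trivial).elim, fun x y hxy =>
        (hxy (left_mem_segment ℝ x y) trivial).elim⟩ hY
      ⟨c, hc, 1, one_pos, fun x _ => h x⟩ hD
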